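/- **Setting.** Fix types of values, operator symbols $\oplus$ (with meanings $\mathit{Val}\to\mathit{Val}\to\mathit{Val}$), program variables $v$, lock variables $k$ and registers $r$; a set of values that count as zero (false); two distinct values "free" and "taken" of lock variables. Program and lock variables together are the shared variables; a memory $mem$ maps shared variables to values; a mode state $mds$ maps each mode in $\{\mathbf{AsmNoW},\mathbf{AsmNoRW},\mathbf{GuarNoW},\mathbf{GuarNoRW}\}$ to a set of shared variables. Also given are: a lock interpretation assigning to each lock two disjoint sets $(W_k,RW_k)$ of program variables; a classification $\mathcal L(mem,x)\in\{\mathrm{High},\mathrm{Low}\}$ depending only on the values of the control variables $\mathcal C\mathrm{vars}(x)$, where locks are always Low and are never control variables, and a lock governing $v$ governs the control variables of $v$ in the same way; and a (partial) register allocator: $\mathrm{regalloc}(\Phi,A)$ returns a register outside $A$, and $\mathrm{cached}(\Phi,A,v)$ returns a register $r\notin A$ with $\Phi(r)=v$. Local configurations are triples $\langle tps,mds,mem\rangle$ of thread-private state, mode state and memory. Write $\mathcal C=\bigcup_x\mathcal C\mathrm{vars}(x)$; $x$ is readable if $x\notin mds(\mathbf{AsmNoRW})$, and writable if moreover $x\notin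 mds(\mathbf{AsmNoW})$; $mem_1=^{\rm Low}_{mds}mem_2$ means $mem_1(x)=mem_2(x)$ whenever $x\in\mathcal C$, or $\mathcal L(mem_1,x)=\mathrm{Low}$ and $x$ is readable. Two configurations are modes-equal if they have the same $mds$; they are low-equivalent if moreover their memories are related by $=^{\rm Low}_{mds}$. **Security notions.** A relation $\mathcal B$ on configurations is *cg-consistent* if $(\langle t_1,mds,mem_1\rangle,\langle t_2,mds,mem_2\rangle)\in\mathcal B$ implies $(\langle t_1,mds,mem_1'\rangle,\langle t_2,mds,mem_2'\rangle)\in\mathcal B$ whenever $mem_1'=^{\rm Low}_{mds}mem_2'$ and every $x$ with $mem_1(x)\ne mem_1'(x)$, $mem_2(x)\neq mem_2'(x)$ or $\mathcal L(mem_1,x)\ne\mathcal L(mem_1',x)$ is writable. It is a *strong low-bisimulation modulo modes* if it is cg-consistent, symmetric, and all modes-equal pairs $(lc_1,lc_2)\in\mathcal B$ are low-equivalent, and for each step $lc_1\rightsquigarrow lc_1'$ there is a step $lc_2\rightsquigarrow lc_2'$ with $lc_1',lc_2'$ modes-equal and $(lc_1',lc_2')\in\mathcal B$. *secure-refinement*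 $\mathcal B\,\mathcal R\,\mathcal I$ means: (i) pairs in $\mathcal R$ have equal mode states and memories; (ii) $\mathcal R$ is closed under replacing the common memory $mem$ of a pair by $mem'$ if every $x$ with $mem(x)\ne mem'(x)$ or $\mathcal L(mem,x)\neq\mathcal L(mem',x)$ is writable; (iii) $\mathcal I$ is cg-consistent and symmetric; (iv) for all $(lc_{1A},lc_{1C})\in\mathcal R$ and $lc_{1C}\rightsquigarrow lc_{1C}'$ there are $n$ and $lc_{1A}'$ with $lc_{1A}\rightsquigarrow^n lc_{1A}'$ and $(lc_{1A}',lc_{1C}')\in\mathcal R$ such that for all $lc_{2A},lc_{2C},lc_{2A}'$ with $(lc_{1A},lc_{2A})\in\mathcal B$, $(lc_{2A},lc_{2C})\in\mathcal R$, $(lc_{1C},lc_{2C})\in\mathcal I$, $lc_{2A}\rightsquigarrow^n lc_{2A}'$, and with $lc_{1A},lc_{2A}$, and $lc_{1C},lc_{2C}$, and $lc_{1A}',lc_{2A}'$ modes-equal, there is $lc_{2C}'$ with $lc_{2C}\rightsquigarrow lc_{2C}'$, $lc_{1C}',lc_{2C}'$ modes-equal, $(lc_{2A}',lc_{2C}')\in\mathcal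 R$ and $(lc_{1C}',lc_{2C}')\in\mathcal I$. **Languages.** Expressions $e$ are constants, program variables, and $e\oplus e$. `While` commands (the thread-private state) are $\mathsf{stop}$, $\mathsf{skip}$, $c;c$, $\mathsf{if}\,e\,\mathsf{then}\,c\,\mathsf{else}\,c$, $\mathsf{while}\,e\,\mathsf{do}\,c$, $v:=e$, $\mathsf{LockAcq}\,k$, $\mathsf{LockRel}\,k$, with the usual small-step semantics: $\mathsf{stop};c$ steps to $c$; $\mathsf{while}\,e\,\mathsf{do}\,c$ steps to $\mathsf{if}\,e\,\mathsf{then}\,(c;\mathsf{while}\,e\,\mathsf{do}\,c)\,\mathsf{else}\,\mathsf{stop}$. Acquiring a free lock makes it taken, adds $W_k,RW_k$ to the modes $\mathbf{AsmNoW},\mathbf{AsmNoRW}$ and removes them from $\mathbf{GuarNoW},\mathbf{GuarNoRW}$; releasing a held lock does the reverse; otherwise these commands spin. `RISC` programs are lists of optionally labelled instructions $\mathsf{Load}\,r\,v$, $\mathsf{Store}\,v\,r$, $\mathsf{Jmp}\,l$, $\mathsf{Jz}\,l\,r$, $\mathsf{Nop}$, $\mathsf{Nop}'$, $\mathsf{MoveK}\,r\,n$,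 $\mathsf{MoveR}\,r\,r'$, $\mathsf{Op}\oplus r\,r'$, $\mathsf{LockAcq}\,k$, $\mathsf{LockRel}\,k$, labels being natural numbers; the thread-private state is $(pc,P,regs)$; jumps go to the first instruction with the given label, or to the end of $P$ if there is none. $\mathsf{Nop}'$ acts as $\mathsf{Nop}$ and is emitted for control flow only. **Compiler.** A compilation record $C=(\Phi,\mathcal S)$ consists of a partial map $\Phi$ from registers to expressions and a pair $\mathcal S$ of sets of program variables (those under an active $\mathbf{AsmNoW}$, resp. $\mathbf{AsmNoRW}$). A variable is stable for $\mathcal S$ if it and all its control variables are in the union of $\mathcal S$; $C$ is stable if $\Phi$ only has expressions over stable variables; $C$ is consistent with $(regs,mds,mem)$ if $regs(r)$ is the value of $e$ in $mem$ whenever $\Phi(r)=e$, and $\mathcal S=(mds(\mathbf{AsmNoW}),mds(\mathbf{AsmNoRW}))$. $\mathrm{compile\text{-}cmd}\ C\ l\ nl\ c$, with optional entry label $l$ and next available label $nl$, either fails or returns a program $PCs$ whose instructions are annotated with compilation records, an optional exit label, a new next label and a final record. Expressions are compiled to $\mathsf{MoveK}$, $\mathsf{Load}$, $\mathsf{Op}$,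 reusing cached registers and updating $\Phi$, and fail on unstable variables or if no register is available; $\mathsf{skip}$ becomes $\mathsf{Nop}$; an assignment (which fails if its target is lock-governed and unstable) becomes $P_e\,\mathsf{Store}$ and drops the entries mentioning the target; $c_1;c_2$ becomes $P_1P_2$, the exit label of $P_1$ being the entry label of $P_2$; a conditional becomes $P_e\ (\mathsf{Jz}\ br\ r)\ P_1\ (\mathsf{Jmp}\ ex)\ P_2\ \mathsf{Nop}'$ with entry label $br$ on $P_2$ and exit label $ex$, keeping the register entries common to both branches; a loop becomes $P_e\ (\mathsf{Jz}\ ex\ r)\ P_1\ (\mathsf{Jmp}\ lp)$ with $lp$ on its first instruction, and $P_e$ compiled with an empty $\Phi$; locking commands become the corresponding instructions and update $\mathcal S$, release dropping the entries that become unstable; $\mathsf{stop}$ fails. The labels $br$, $ex$, and $lp$ if there is no entry label, are fresh. The *input requirements* on $C,l,nl,c$ are: $c\ne\mathsf{stop}$; $l<nl$ if $l$ is given; $C$ is stable; and, tracking $\mathcal S$ along $c$, all expressions are over stable variables, all assigned variables are stable if lock-governed, both branches of a conditional lead to the same $\mathcal S$, and loop bodies restore $\mathcal S$. **Relations.** $P_1,P_2$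 are joinable if $P_1$ jumps only to its own labels or the label of the first instruction of $P_2$, and $P_2$ does not jump to labels of $P_1$. $\mathcal R_{\mathsf{wr}}$ is the least relation between `While` and `RISC` configurations (in each pair with the same $mds,mem$) with the following cases, in which compilations are successful and satisfy the input requirements, and in every case except *stop*, *skip\_nop*, the lock cases, *join* and *epilogue\_step* the record annotating the current position (at the end of the program: the final record) is stable and consistent with the configuration; "initially related" means related at $pc=0$ for all $(regs,mds,mem)$ consistent with the (stable) record with which the compilation of that subprogram was started. *stop*: $\mathsf{stop}$ with $pc=|P|$. *skip\_nop*, *lock\_acq*, *lock\_rel*: the command with the start of its one-instruction program. *assign\_expr*, *assign\_store*: $v:=e$ with a position in $P_e$, resp. at the $\mathsf{Store}$ (where $v$ is stable if lock-governed). *seq*: $d;c_2$ with $pc\le|P_1|$ in $P_1P_2$, for consecutive compilations $P_1,P_2$ of $c_1,c_2$ which are joinable, if $d$ is related to $pc$ in $P_1$ and $c_2,P_2$ are initially related. *join*: $c$ with $pc\ge|P_1|$ in $P_1P_2$, if $P_1,P_2$ are joinable and $c$ is related to $pc-|P_1|$ in $P_2$. *if\_expr*: the conditional with a position in $P_e$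 or at $\mathsf{Jz}$, if $c_1,P_1$ and $c_2,P_2$ are initially related. *if\_c1*, *if\_c2*: $d$ with a position in the $P_1$-part, resp. $P_2$-part, if $d$ is related to that position of $P_1$, resp. $P_2$, alone. *epilogue\_step*: $\mathsf{stop}$ with a position at a $\mathsf{Nop}'$ or a forward $\mathsf{Jmp}$, if $\mathsf{stop}$ is related to the configuration after the `RISC` step. *while\_expr*: $\mathsf{while}\,e\,\mathsf{do}\,c$ with $pc=0$, and $\mathsf{if}\,e\,\mathsf{then}\,(c;\mathsf{while}\,e\,\mathsf{do}\,c)\,\mathsf{else}\,\mathsf{stop}$ with $0<pc\le|P_e|$, if $c,P_1$ are initially related. *while\_inner*: $d;\mathsf{while}\,e\,\mathsf{do}\,c$ with a position in the $P_1$-part, if $d$ is related to that position of $P_1$ alone and $c,P_1$ are initially related. *while\_loop*: $\mathsf{stop};\mathsf{while}\,e\,\mathsf{do}\,c$ with a position in the $P_1$-part or at the final $\mathsf{Jmp}$, if $\mathsf{stop}$ is related to that position (resp. the end) of $P_1$ alone and $c,P_1$ are initially related. $\mathcal I_{\mathsf{wr}}$ relates `RISC` configurations with equal $pc$ and equal program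 text. A relation $\mathcal B$ on `While` configurations is *non-High-branching* if $(\langle c,mds,mem\rangle,\langle c',mds,mem'\rangle)\in\mathcal B$ implies $c=c'$ and, whenever the leftmost command of $c$ is a conditional with condition $e$, that $e$ has the same value in $mem$ and $mem'$. **Statement.** Let $\mathcal B$ be a non-High-branching strong low-bisimulation modulo modes on `While` configurations. Then secure-refinement $\mathcal B\ \mathcal R_{\mathsf{wr}}\ \mathcal I_{\mathsf{wr}}$ holds. Consequently the compiler preserves concurrent value-dependent noninterference: the relation $\mathcal B_{\mathsf C}$ of all low-equivalent (in particular modes-equal) pairs $(lc_{1C},lc_{2C})\in\mathcal I_{\mathsf{wr}}$ for which there are $(lc_{1A},lc_{2A})\in\mathcal B$ with $(lc_{1A},lc_{1C}),(lc_{2A},lc_{2C})\in\mathcal R_{\mathsf{wr}}$ is a strong low-bisimulation modulo modes on `RISC` configurations; and if $\mathrm{compile\text{-}cmd}\ C\ l\ nl\ c$ succeeds with program text $P$, its inputs satisfy the input requirements, $C$ is consistent with $(regs,mds,mem_1)$ and $(regs,mds,mem_2)$, $mem_1=^{\rm Low}_{mds}mem_2$ and $(\langle c,mds,mem_1\rangle,\langle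 c,mds,mem_2\rangle)\in\mathcal B$, then $(\langle(0,P,regs),mds,mem_1\rangle,\langle(0,P,regs),mds,mem_2\rangle)\in\mathcal B_{\mathsf C}$. -/

import Mathlib

/-!  The syntax and semantics of the source language `While` and the target language `RISC`,
concurrent value-dependent noninterference, secure refinement, the While-to-RISC compiler, its
refinement relation and its coupling invariant. -/

noncomputable section

open scoped Classical

namespace WR

/-! ### Shared memory, modes, local configurations -/

/-- Shared variables: program variables and lock variables. -/
inductive Shared (Var Lock : Type*)
  | var (v : Var)
  | lock (k : Lock)

/-- Access modes: assumptions / guarantees of no write (by others / by this thread), and of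
neither read nor write. -/
inductive Mode
  | asmNoW
  | asmNoRW
  | guarNoW
  | guarNoRW

/-- Security classifications. -/
inductive Sec
  | High
  | Low

abbrev Mem (Val Var Lock : Type*) := Shared Var Lock → Val

abbrev Mds (Var Lock : Type*) := Mode → Set (Shared Var Lock)

/-- Local configurations: thread-private state, mode state, shared memory. -/
structure LocalConf (TPS Val Var Lock : Type*) where
  tps : TPS
  mds : Mds Var Lock
  mem : Mem Val Var Lock

/-- Expressions over program variables; `Opr` is the type of binary operator symbols. -/
inductive Exp (Val Opr Var : Type*)
  | const (n : Val)
  | var (v : Var)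
  | op (o : Opr) (e₁ e₂ : Exp Val Opr Var)

/-- The program variables that an expression mentions. -/
def Exp.vars {Val Opr Var : Type*} : Exp Val Opr Var → Set Var
  | .const _ => ∅
  | .var v => {v}
  | .op _ e₁ e₂ => e₁.vars ∪ e₂.vars

/-- Register records: partial maps from registers to expressions. -/
abbrev RegRec (Val Opr Var Reg : Type*) := Reg → Option (Exp Val Opr Var)

/-- Assumption records: the variables with an active `asmNoW`, resp. `asmNoRW`, assumption. -/
abbrev AsmRec (Var : Type*) := Set Var × Set Var

/-- Compilation records: the first component is the register record `regrec`, the second one the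
assumption record `asmrec`. -/
abbrev CompRec (Val Opr Var Reg : Type*) := RegRec Val Opr Var Reg × AsmRec Var

/-- What the user of the theory supplies: the meaning of operator symbols, the values that count
as zero (false), the two values of a lock variable, the locking discipline, the value-dependent
classification with its control variables, and the register allocation scheme. -/
structure Params (Val Opr Var Lock Reg : Type*) where
  evalOp : Opr → Val → Val → Val
  isZero : Val → Prop
  lockFree : Val
  lockTaken : Val
  lockFree_ne_lockTaken : lockFree ≠ lockTaken
  /-- The variables to which holding a lock gives exclusive permission to write, resp. to read
  and write. -/
  lockInterp : Lock → Set Var × Set Var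
  lockInterp_disjoint : ∀ k, Disjoint (lockInterp k).1 (lockInterp k).2
  /-- The value-dependent classification. -/
  classify : Mem Val Var Lock → Shared Var Lock → Sec
  /-- The control variables of a variable. -/
  cvars : Shared Var Lock → Set (Shared Var Lock)
  classify_congr : ∀ m₁ m₂ x, (∀ y ∈ cvars x, m₁ y = m₂ y) → classify m₁ x = classify m₂ x
  lock_notMem_cvars : ∀ k x, Shared.lock k ∉ cvars x
  classify_lock : ∀ m k, classify m (.lock k) = .Low
  lockInterp_cvars_fst : ∀ k, ∀ v ∈ (lockInterp k).1, ∀ w,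
    Shared.var w ∈ cvars (.var v) → w ∈ (lockInterp k).1
  lockInterp_cvars_snd : ∀ k, ∀ v ∈ (lockInterp k).2, ∀ w,
    Shared.var w ∈ cvars (.var v) → w ∈ (lockInterp k).2
  /-- Allocation of a register outside of a given set; it may fail. -/
  regAlloc : RegRec Val Opr Var Reg → Set Reg → Option Reg
  /-- Search for a register outside of a given set which is recorded as containing a given
  variable; it may fail. -/
  regAllocCached : RegRec Val Opr Var Reg → Set Reg → Var → Option Reg
  regAlloc_notMem : ∀ Φ A r, regAlloc Φ A = some r → r ∉ A
  regAllocCached_notMem : ∀ Φ A v r, regAllocCached Φ A v = some r → r ∉ A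
  regAllocCached_eq : ∀ Φ A v r, regAllocCached Φ A v = some r → Φ r = some (.var v)

section Generic

variable {Val Opr Var Lock Reg TPS TPA TPC : Type*}

/-! ### Security property and secure refinement, for arbitrary step semantics -/

def writable (mds : Mds Var Lock) (x : Shared Var Lock) : Prop :=
  x ∉ mds .asmNoW ∧ x ∉ mds .asmNoRW

def readable (mds : Mds Var Lock) (x : Shared Var Lock) : Prop :=
  x ∉ mds .asmNoRW

/-- The set of all control variables. -/
def controlVars (T : Params Val Opr Var Lock Reg) : Set (Shared Var Lock) :=
  {y | ∃ x, y ∈ T.cvars x}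

/-- Low-equivalence of memories modulo modes. -/
def lowMdsEq (T : Params Val Opr Var Lock Reg) (mds : Mds Var Lock)
    (m₁ m₂ : Mem Val Var Lock) : Prop :=
  ∀ x, (x ∈ controlVars T ∨ (T.classify m₁ x = .Low ∧ readable mds x)) → m₁ x = m₂ x

/-- Low-equivalence modulo modes of modes-equal configurations. -/
def confLowMdsEq (T : Params Val Opr Var Lock Reg) (lc₁ lc₂ : LocalConf TPS Val Var Lock) : Prop :=
  lc₁.mds = lc₂.mds ∧ lowMdsEq T lc₁.mds lc₁.mem lc₂.mem

/-- Closedness under globally consistent changes. -/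
def cgConsistent (T : Params Val Opr Var Lock Reg)
    (B : Set (LocalConf TPS Val Var Lock × LocalConf TPS Val Var Lock)) : Prop :=
  ∀ (t₁ : TPS) (m₁ : Mem Val Var Lock) (t₂ : TPS) (m₂ : Mem Val Var Lock) (mds : Mds Var Lock),
    (⟨t₁, mds, m₁⟩, ⟨t₂, mds, m₂⟩) ∈ B →
    ∀ m₁' m₂' : Mem Val Var Lock,
      (∀ x, (m₁ x ≠ m₁' x ∨ m₂ x ≠ m₂' x ∨ T.classify m₁ x ≠ T.classify m₁' x) →
        writable mds x) →
      lowMdsEq T mds m₁' m₂' →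
      (⟨t₁, mds, m₁'⟩, ⟨t₂, mds, m₂'⟩) ∈ B

def symRel {α : Type*} (B : Set (α × α)) : Prop :=
  ∀ a b, (a, b) ∈ B → (b, a) ∈ B

/-- Strong low-bisimulations modulo modes, for the step relation `step`. -/
def strongLowBisimMM (T : Params Val Opr Var Lock Reg)
    (step : LocalConf TPS Val Var Lock → LocalConf TPS Val Var Lock → Prop)
    (B : Set (LocalConf TPS Val Var Lock × LocalConf TPS Val Var Lock)) : Prop :=
  cgConsistent T B ∧ symRel B ∧
  ∀ lc₁ lc₂, (lc₁, lc₂) ∈ B → lc₁.mds = lc₂.mds →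
    confLowMdsEq T lc₁ lc₂ ∧
    ∀ lc₁', step lc₁ lc₁' →
      ∃ lc₂', step lc₂ lc₂' ∧ lc₁'.mds = lc₂'.mds ∧ (lc₁', lc₂') ∈ B

/-- Exactly `n` steps. -/
def nSteps {α : Type*} (step : α → α → Prop) : ℕ → α → α → Prop
  | 0, a, b => a = b
  | n + 1, a, b => ∃ c, step a c ∧ nSteps step n c b

def preservesModesMem
    (R : Set (LocalConf TPA Val Var Lock × LocalConf TPC Val Var Lock)) : Prop :=
  ∀ lcA lcC, (lcA, lcC) ∈ R → lcA.mds = lcC.mds ∧ lcA.mem = lcC.mem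

/-- Closedness of refinements under changes by others. -/
def closedOthers (T : Params Val Opr Var Lock Reg)
    (R : Set (LocalConf TPA Val Var Lock × LocalConf TPC Val Var Lock)) : Prop :=
  ∀ (tA : TPA) (tC : TPC) (mds : Mds Var Lock) (m m' : Mem Val Var Lock),
    (⟨tA, mds, m⟩, ⟨tC, mds, m⟩) ∈ R →
    (∀ x, (m x ≠ m' x ∨ T.classify m x ≠ T.classify m' x) → writable mds x) →
    (⟨tA, mds, m'⟩, ⟨tC, mds, m'⟩) ∈ R

/-- The cube-shaped refinement preservation obligation. -/
def couplingInvPres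
    (stepA : LocalConf TPA Val Var Lock → LocalConf TPA Val Var Lock → Prop)
    (stepC : LocalConf TPC Val Var Lock → LocalConf TPC Val Var Lock → Prop)
    (B : Set (LocalConf TPA Val Var Lock × LocalConf TPA Val Var Lock))
    (R : Set (LocalConf TPA Val Var Lock × LocalConf TPC Val Var Lock))
    (I : Set (LocalConf TPC Val Var Lock × LocalConf TPC Val Var Lock)) : Prop :=
  ∀ lc₁A lc₁C, (lc₁A, lc₁C) ∈ R →
    ∀ lc₁C', stepC lc₁C lc₁C' →
      ∃ n lc₁A', nSteps stepA n lc₁A lc₁A' ∧ (lc₁A', lc₁C') ∈ R ∧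
        ∀ lc₂A lc₂C lc₂A',
          (lc₁A, lc₂A) ∈ B → lc₁A.mds = lc₂A.mds →
          (lc₂A, lc₂C) ∈ R → (lc₁C, lc₂C) ∈ I → lc₁C.mds = lc₂C.mds →
          nSteps stepA n lc₂A lc₂A' → lc₁A'.mds = lc₂A'.mds →
          ∃ lc₂C', stepC lc₂C lc₂C' ∧ lc₁C'.mds = lc₂C'.mds ∧
            (lc₂A', lc₂C') ∈ R ∧ (lc₁C', lc₂C') ∈ I

/-- Secure refinement of the per-thread noninterference property. -/
def secureRefinement (T : Params Val Opr Var Lock Reg)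
    (stepA : LocalConf TPA Val Var Lock → LocalConf TPA Val Var Lock → Prop)
    (stepC : LocalConf TPC Val Var Lock → LocalConf TPC Val Var Lock → Prop)
    (B : Set (LocalConf TPA Val Var Lock × LocalConf TPA Val Var Lock))
    (R : Set (LocalConf TPA Val Var Lock × LocalConf TPC Val Var Lock))
    (I : Set (LocalConf TPC Val Var Lock × LocalConf TPC Val Var Lock)) : Prop :=
  preservesModesMem R ∧ closedOthers T R ∧ cgConsistent T I ∧ symRel I ∧
    couplingInvPres stepA stepC B R I

/-- The relation on concrete configurations induced by `B`, `R` and `I`. -/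
def concreteBisim (T : Params Val Opr Var Lock Reg)
    (B : Set (LocalConf TPA Val Var Lock × LocalConf TPA Val Var Lock))
    (R : Set (LocalConf TPA Val Var Lock × LocalConf TPC Val Var Lock))
    (I : Set (LocalConf TPC Val Var Lock × LocalConf TPC Val Var Lock)) :
    Set (LocalConf TPC Val Var Lock × LocalConf TPC Val Var Lock) :=
  {p | ∃ lc₁A lc₂A, (lc₁A, p.1) ∈ R ∧ (lc₂A, p.2) ∈ R ∧ (lc₁A, lc₂A) ∈ B ∧
    confLowMdsEq T p.1 p.2 ∧ p ∈ I}

end Generic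

/-! ### Locking primitives -/

section Locks

variable {Val Opr Var Lock Reg : Type*}

/-- Update of a function at one point. -/
def upd {α β : Type*} (f : α → β) (a : α) (b : β) : α → β :=
  fun x => if x = a then b else f x

/-- The mode state after acquiring the lock `k`. -/
def lockAcqUpd (T : Params Val Opr Var Lock Reg) (k : Lock) (mds : Mds Var Lock) : Mds Var Lock
  | .asmNoW => mds .asmNoW ∪ Shared.var '' (T.lockInterp k).1
  | .asmNoRW => mds .asmNoRW ∪ Shared.var '' (T.lockInterp k).2
  | .guarNoW => mds .guarNoW \ Shared.var '' (T.lockInterp k).1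
  | .guarNoRW => mds .guarNoRW \ Shared.var '' (T.lockInterp k).2

/-- The mode state after releasing the lock `k`. -/
def lockRelUpd (T : Params Val Opr Var Lock Reg) (k : Lock) (mds : Mds Var Lock) : Mds Var Lock
  | .asmNoW => mds .asmNoW \ Shared.var '' (T.lockInterp k).1
  | .asmNoRW => mds .asmNoRW \ Shared.var '' (T.lockInterp k).2
  | .guarNoW => mds .guarNoW ∪ Shared.var '' (T.lockInterp k).1
  | .guarNoRW => mds .guarNoRW ∪ Shared.var '' (T.lockInterp k).2

/-- The mode state records the permissions that the lock `k` grants. -/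
def lockHeld (T : Params Val Opr Var Lock Reg) (k : Lock) (mds : Mds Var Lock) : Prop :=
  Shared.var '' (T.lockInterp k).1 ⊆ mds .asmNoW ∧ Shared.var '' (T.lockInterp k).2 ⊆ mds .asmNoRW

end Locks

/-! ### The source language -/

/-- `While` programs; `stopped` is the terminated program. -/
inductive Cmd (Val Opr Var Lock : Type*)
  | stopped
  | skip
  | seq (c₁ c₂ : Cmd Val Opr Var Lock)
  | ite (e : Exp Val Opr Var) (c₁ c₂ : Cmd Val Opr Var Lock)
  | while (e : Exp Val Opr Var) (c : Cmd Val Opr Var Lock)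
  | assign (v : Var) (e : Exp Val Opr Var)
  | lockAcq (k : Lock)
  | lockRel (k : Lock)

section While

variable {Val Opr Var Lock Reg : Type*}

/-- Evaluation of an expression in a memory. -/
def evExp (T : Params Val Opr Var Lock Reg) (m : Mem Val Var Lock) : Exp Val Opr Var → Val
  | .const n => n
  | .var v => m (.var v)
  | .op o e₁ e₂ => T.evalOp o (evExp T m e₁) (evExp T m e₂)

abbrev WConf (Val Opr Var Lock : Type*) := LocalConf (Cmd Val Opr Var Lock) Val Var Lock

/-- The step semantics of `While`. A thread that acquires a taken lock, or releases a lock that it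
does not hold, spins. -/
inductive WStep (T : Params Val Opr Var Lock Reg) :
    WConf Val Opr Var Lock → WConf Val Opr Var Lock → Prop
  | skip (mds m) : WStep T ⟨.skip, mds, m⟩ ⟨.stopped, mds, m⟩
  | assign (v e mds m) :
      WStep T ⟨.assign v e, mds, m⟩ ⟨.stopped, mds, upd m (.var v) (evExp T m e)⟩
  | seqStop (c mds m) : WStep T ⟨.seq .stopped c, mds, m⟩ ⟨c, mds, m⟩
  | seq (c₁ c₁' c₂ mds mds' m m') (h : WStep T ⟨c₁, mds, m⟩ ⟨c₁', mds', m'⟩) :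
      WStep T ⟨.seq c₁ c₂, mds, m⟩ ⟨.seq c₁' c₂, mds', m'⟩
  | iteTrue (e c₁ c₂ mds m) (h : ¬ T.isZero (evExp T m e)) :
      WStep T ⟨.ite e c₁ c₂, mds, m⟩ ⟨c₁, mds, m⟩
  | iteFalse (e c₁ c₂ mds m) (h : T.isZero (evExp T m e)) :
      WStep T ⟨.ite e c₁ c₂, mds, m⟩ ⟨c₂, mds, m⟩
  | while (e c mds m) :
      WStep T ⟨.while e c, mds, m⟩ ⟨.ite e (.seq c (.while e c)) .stopped, mds, m⟩
  | lockAcq (k mds m) (h : m (.lock k) = T.lockFree) :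
      WStep T ⟨.lockAcq k, mds, m⟩ ⟨.stopped, lockAcqUpd T k mds, upd m (.lock k) T.lockTaken⟩
  | lockSpin (k mds m) (h : m (.lock k) ≠ T.lockFree) :
      WStep T ⟨.lockAcq k, mds, m⟩ ⟨.lockAcq k, mds, m⟩
  | lockRel (k mds m) (h : lockHeld T k mds) :
      WStep T ⟨.lockRel k, mds, m⟩ ⟨.stopped, lockRelUpd T k mds, upd m (.lock k) T.lockFree⟩
  | lockInvalid (k mds m) (h : ¬ lockHeld T k mds) :
      WStep T ⟨.lockRel k, mds, m⟩ ⟨.lockRel k, mds, m⟩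

/-- The leftmost command of a sequence of `;`-separated commands. -/
def leftmostCmd : Cmd Val Opr Var Lock → Cmd Val Opr Var Lock
  | .seq c₁ _ => leftmostCmd c₁
  | c => c

/-- Relations that describe only programs which do not branch on high values. -/
def noHighBranching (T : Params Val Opr Var Lock Reg)
    (B : Set (WConf Val Opr Var Lock × WConf Val Opr Var Lock)) : Prop :=
  ∀ (c c' : Cmd Val Opr Var Lock) (mds : Mds Var Lock) (m m' : Mem Val Var Lock),
    (⟨c, mds, m⟩, ⟨c', mds, m'⟩) ∈ B →
    c = c' ∧ ∀ e c₁ c₂, leftmostCmd c = .ite e c₁ c₂ → evExp T m e = evExp T m' e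

end While

/-! ### The target language -/

/-- Labels. -/
abbrev Lab := ℕ

/-- `RISC` instructions. `epi` is a copy of `nop` which the compiler emits for control flow only. -/
inductive Instr (Val Opr Var Lock Reg : Type*)
  | load (r : Reg) (v : Var)
  | store (v : Var) (r : Reg)
  | jmp (l : Lab)
  | jz (l : Lab) (r : Reg)
  | nop
  | epi
  | moveK (r : Reg) (n : Val)
  | moveR (r r' : Reg)
  | op (o : Opr) (r r' : Reg)
  | lockAcq (k : Lock)
  | lockRel (k : Lock)

/-- Optionally labelled instructions. -/
abbrev LInstr (Val Opr Var Lock Reg : Type*) := Option Lab × Instr Val Opr Var Lock Reg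

abbrev Prog (Val Opr Var Lock Reg : Type*) := List (LInstr Val Opr Var Lock Reg)

/-- Thread-private state of `RISC`: program counter, program text, registers. -/
structure RState (Val Opr Var Lock Reg : Type*) where
  pc : ℕ
  prog : Prog Val Opr Var Lock Reg
  regs : Reg → Val

abbrev RConf (Val Opr Var Lock Reg : Type*) :=
  LocalConf (RState Val Opr Var Lock Reg) Val Var Lock

section Risc

variable {Val Opr Var Lock Reg : Type*}

/-- The position of the first instruction with label `l`, or the end of the program if there is
none. -/
def resolve (P : Prog Val Opr Var Lock Reg) (l : Lab) : ℕ :=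
  P.findIdx (fun i => decide (i.1 = some l))

/-- The step semantics of `RISC`. -/
inductive RStep (T : Params Val Opr Var Lock Reg) :
    RConf Val Opr Var Lock Reg → RConf Val Opr Var Lock Reg → Prop
  | load (pc P regs mds m l r v) (h : P[pc]? = some (l, .load r v)) :
      RStep T ⟨⟨pc, P, regs⟩, mds, m⟩ ⟨⟨pc + 1, P, upd regs r (m (.var v))⟩, mds, m⟩
  | store (pc P regs mds m l v r) (h : P[pc]? = some (l, .store v r)) :
      RStep T ⟨⟨pc, P, regs⟩, mds, m⟩ ⟨⟨pc + 1, P, regs⟩, mds, upd m (.var v) (regs r)⟩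
  | jmp (pc P regs mds m l l') (h : P[pc]? = some (l, .jmp l')) :
      RStep T ⟨⟨pc, P, regs⟩, mds, m⟩ ⟨⟨resolve P l', P, regs⟩, mds, m⟩
  | jzZero (pc P regs mds m l l' r) (h : P[pc]? = some (l, .jz l' r)) (hz : T.isZero (regs r)) :
      RStep T ⟨⟨pc, P, regs⟩, mds, m⟩ ⟨⟨resolve P l', P, regs⟩, mds, m⟩
  | jzNonzero (pc P regs mds m l l' r) (h : P[pc]? = some (l, .jz l' r))
      (hz : ¬ T.isZero (regs r)) :
      RStep T ⟨⟨pc, P, regs⟩, mds, m⟩ ⟨⟨pc + 1, P, regs⟩, mds, m⟩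
  | nop (pc P regs mds m l) (h : P[pc]? = some (l, .nop)) :
      RStep T ⟨⟨pc, P, regs⟩, mds, m⟩ ⟨⟨pc + 1, P, regs⟩, mds, m⟩
  | epi (pc P regs mds m l) (h : P[pc]? = some (l, .epi)) :
      RStep T ⟨⟨pc, P, regs⟩, mds, m⟩ ⟨⟨pc + 1, P, regs⟩, mds, m⟩
  | moveK (pc P regs mds m l r n) (h : P[pc]? = some (l, .moveK r n)) :
      RStep T ⟨⟨pc, P, regs⟩, mds, m⟩ ⟨⟨pc + 1, P, upd regs r n⟩, mds, m⟩
  | moveR (pc P regs mds m l r r') (h : P[pc]? = some (l, .moveR r r')) :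
      RStep T ⟨⟨pc, P, regs⟩, mds, m⟩ ⟨⟨pc + 1, P, upd regs r (regs r')⟩, mds, m⟩
  | op (pc P regs mds m l o r r') (h : P[pc]? = some (l, .op o r r')) :
      RStep T ⟨⟨pc, P, regs⟩, mds, m⟩
        ⟨⟨pc + 1, P, upd regs r (T.evalOp o (regs r) (regs r'))⟩, mds, m⟩
  | lockAcq (pc P regs mds m l k) (h : P[pc]? = some (l, .lockAcq k))
      (hk : m (.lock k) = T.lockFree) :
      RStep T ⟨⟨pc, P, regs⟩, mds, m⟩
        ⟨⟨pc + 1, P, regs⟩, lockAcqUpd T k mds, upd m (.lock k) T.lockTaken⟩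
  | lockSpin (pc P regs mds m l k) (h : P[pc]? = some (l, .lockAcq k))
      (hk : m (.lock k) ≠ T.lockFree) :
      RStep T ⟨⟨pc, P, regs⟩, mds, m⟩ ⟨⟨pc, P, regs⟩, mds, m⟩
  | lockRel (pc P regs mds m l k) (h : P[pc]? = some (l, .lockRel k))
      (hk : lockHeld T k mds) :
      RStep T ⟨⟨pc, P, regs⟩, mds, m⟩
        ⟨⟨pc + 1, P, regs⟩, lockRelUpd T k mds, upd m (.lock k) T.lockFree⟩
  | lockInvalid (pc P regs mds m l k) (h : P[pc]? = some (l, .lockRel k))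
      (hk : ¬ lockHeld T k mds) :
      RStep T ⟨⟨pc, P, regs⟩, mds, m⟩ ⟨⟨pc, P, regs⟩, mds, m⟩

/-- The labels that occur on instructions of a program. -/
def labels (P : Prog Val Opr Var Lock Reg) : Set Lab :=
  {l | ∃ i ∈ P, i.1 = some l}

/-- The labels to which a program jumps. -/
def jumps (P : Prog Val Opr Var Lock Reg) : Set Lab :=
  {l | ∃ i ∈ P, i.2 = .jmp l ∨ ∃ r, i.2 = .jz l r}

/-- `P₁` only jumps to its own labels or to the label of the first instruction of `P₂`. -/
def joinableForward (P₁ P₂ : Prog Val Opr Var Lock Reg) : Prop :=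
  ∀ l ∈ jumps P₁, l ∈ labels P₁ ∨ ∃ i, P₂.head? = some i ∧ i.1 = some l

/-- `P₂` does not jump to labels of `P₁`. -/
def joinableBackward (P₁ P₂ : Prog Val Opr Var Lock Reg) : Prop :=
  ∀ l ∈ jumps P₂, l ∉ labels P₁

def joinable (P₁ P₂ : Prog Val Opr Var Lock Reg) : Prop :=
  joinableForward P₁ P₂ ∧ joinableBackward P₁ P₂

/-- Silent control flow towards the end of a program: `epi`, or a forward jump. -/
def isEpilogueStep (P : Prog Val Opr Var Lock Reg) (pc : ℕ) : Prop :=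
  (∃ l, P[pc]? = some (l, .epi)) ∨ ∃ l l', P[pc]? = some (l, .jmp l') ∧ pc < resolve P l'

end Risc

/-! ### The compiler -/

section Compiler

variable {Val Opr Var Lock Reg : Type*}

/-- A variable and all its control variables are recorded as stable. -/
def varStable (T : Params Val Opr Var Lock Reg) (S : AsmRec Var) (v : Var) : Prop :=
  v ∈ S.1 ∪ S.2 ∧ ∀ y ∈ T.cvars (.var v), ∃ w ∈ S.1 ∪ S.2, y = .var w

def regrecStable (T : Params Val Opr Var Lock Reg) (C : CompRec Val Opr Var Reg) : Prop :=
  ∀ r e, C.1 r = some e → ∀ v ∈ e.vars, varStable T C.2 v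

/-- The variable is governed by some lock. -/
def lockGoverned (T : Params Val Opr Var Lock Reg) (v : Var) : Prop :=
  ∃ k, v ∈ (T.lockInterp k).1 ∪ (T.lockInterp k).2

/-- An assignment to `v` respects the locking discipline. -/
def writeAllowed (T : Params Val Opr Var Lock Reg) (S : AsmRec Var) (v : Var) : Prop :=
  lockGoverned T v → varStable T S v

def asmAcq (T : Params Val Opr Var Lock Reg) (k : Lock) (S : AsmRec Var) : AsmRec Var :=
  (S.1 ∪ (T.lockInterp k).1, S.2 ∪ (T.lockInterp k).2)

def asmRel (T : Params Val Opr Var Lock Reg) (k : Lock) (S : AsmRec Var) : AsmRec Var :=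
  (S.1 \ (T.lockInterp k).1, S.2 \ (T.lockInterp k).2)

/-- The assumption record after running a program. -/
def asmAfter (T : Params Val Opr Var Lock Reg) : Cmd Val Opr Var Lock → AsmRec Var → AsmRec Var
  | .stopped, S => S
  | .skip, S => S
  | .seq c₁ c₂, S => asmAfter T c₂ (asmAfter T c₁ S)
  | .ite _ c₁ _, S => asmAfter T c₁ S
  | .while _ _, S => S
  | .assign _ _, S => S
  | .lockAcq k, S => asmAcq T k S
  | .lockRel k, S => asmRel T k S

/-- The static check on source programs: expressions mention stable variables only, assignments
respect the locking discipline, the branches of a conditional act on the assumption record in the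
same way, and loop bodies restore it. -/
def noUnstableExprsAsm (T : Params Val Opr Var Lock Reg) : Cmd Val Opr Var Lock → AsmRec Var → Prop
  | .stopped, _ => True
  | .skip, _ => True
  | .seq c₁ c₂, S => noUnstableExprsAsm T c₁ S ∧ noUnstableExprsAsm T c₂ (asmAfter T c₁ S)
  | .ite e c₁ c₂, S => (∀ v ∈ e.vars, varStable T S v) ∧
      noUnstableExprsAsm T c₁ S ∧ noUnstableExprsAsm T c₂ S ∧ asmAfter T c₁ S = asmAfter T c₂ S
  | .while e c, S => (∀ v ∈ e.vars, varStable T S v) ∧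
      noUnstableExprsAsm T c S ∧ asmAfter T c S = S
  | .assign v e, S => (∀ w ∈ e.vars, varStable T S w) ∧ writeAllowed T S v
  | .lockAcq _, _ => True
  | .lockRel _, _ => True

def noUnstableExprs (T : Params Val Opr Var Lock Reg) (c : Cmd Val Opr Var Lock)
    (C : CompRec Val Opr Var Reg) : Prop :=
  noUnstableExprsAsm T c C.2

/-- Requirements on the inputs of the compiler. -/
def compileCmdInputReqs (T : Params Val Opr Var Lock Reg) (C : CompRec Val Opr Var Reg)
    (l : Option Lab) (nl : Lab) (c : Cmd Val Opr Var Lock) : Prop :=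
  c ≠ .stopped ∧ (∀ x, l = some x → x < nl) ∧ noUnstableExprs T c C ∧ regrecStable T C

/-- Removal of the entries that mention a variable in `bad`. -/
def purge (Φ : RegRec Val Opr Var Reg) (bad : Set Var) : RegRec Val Opr Var Reg :=
  fun r => (Φ r).bind fun e => if Disjoint e.vars bad then some e else none

/-- The entries on which two register records agree. -/
def meet (Φ Φ' : RegRec Val Opr Var Reg) : RegRec Val Opr Var Reg :=
  fun r => if Φ r = Φ' r then Φ r else none

/-- Compiled programs; each instruction is annotated with the compilation record that holds just
before it is executed. -/
abbrev AProg (Val Opr Var Lock Reg : Type*) :=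
  List (LInstr Val Opr Var Lock Reg × CompRec Val Opr Var Reg)

/-- The program text of an annotated program. -/
def AProg.text (PCs : AProg Val Opr Var Lock Reg) : Prog Val Opr Var Lock Reg :=
  PCs.map Prod.fst

/-- The compilation record that holds at position `pc`; at the end of the program, it is the final
record `C'` of the compilation. -/
def AProg.recAt (PCs : AProg Val Opr Var Lock Reg) (C' : CompRec Val Opr Var Reg) (pc : ℕ) :
    CompRec Val Opr Var Reg :=
  (PCs.map Prod.snd).getD pc C'

/-- The expression compiler. `A` is the set of registers whose contents are still needed. The
result consists of the compiled program, the register that finally holds the value of the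
expression, and the final compilation record; `none` stands for failure. -/
def compileExpr (T : Params Val Opr Var Lock Reg) :
    CompRec Val Opr Var Reg → Set Reg → Option Lab → Exp Val Opr Var →
      Option (AProg Val Opr Var Lock Reg × Reg × CompRec Val Opr Var Reg)
  | C, A, l, .const n =>
      (T.regAlloc C.1 A).bind fun r =>
        some ([((l, .moveK r n), C)], r, (upd C.1 r (some (.const n)), C.2))
  | C, A, l, .var v =>
      if varStable T C.2 v then
        match T.regAllocCached C.1 A v with
        | some r => some ([], r, C)
        | none =>
          (T.regAlloc C.1 A).bind fun r =>
            some ([((l, .load r v), C)], r, (upd C.1 r (some (.var v)), C.2))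
      else none
  | C, A, l, .op o e₁ e₂ =>
      (compileExpr T C A l e₁).bind fun (P₁, r₁, C₁) =>
        (compileExpr T C₁ (A ∪ {r₁}) (if P₁ = [] then l else none) e₂).bind fun (P₂, r₂, C₂) =>
          some (P₁ ++ P₂ ++ [((if P₁ ++ P₂ = [] then l else none, .op o r₁ r₂), C₂)], r₁,
            (upd C₂.1 r₁ (some (.op o e₁ e₂)), C₂.2))

/-- The label of the head of a loop, and the next available label. -/
def loopLabel (l : Option Lab) (nl : Lab) : Lab × Lab :=
  match l with
  | some lp => (lp, nl)
  | none => (nl, nl + 1)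

/-- The compiler. It takes an initial compilation record, an optional entry label, the next
available label and a source program; it returns the annotated program, an optional exit label, the
new next available label and the final compilation record; `none` stands for failure. -/
def compileCmd (T : Params Val Opr Var Lock Reg) :
    CompRec Val Opr Var Reg → Option Lab → Lab → Cmd Val Opr Var Lock →
      Option (AProg Val Opr Var Lock Reg × Option Lab × Lab × CompRec Val Opr Var Reg)
  | _, _, _, .stopped => none
  | C, l, nl, .skip => some ([((l, .nop), C)], none, nl, C)
  | C, l, nl, .seq c₁ c₂ =>
      (compileCmd T C l nl c₁).bind fun (P₁, l₁, nl₁, C₁) =>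
        (compileCmd T C₁ l₁ nl₁ c₂).bind fun (P₂, l₂, nl₂, C₂) =>
          some (P₁ ++ P₂, l₂, nl₂, C₂)
  | C, l, nl, .ite e c₁ c₂ =>
      (compileExpr T C ∅ l e).bind fun (Pe, r, C₁) =>
        (compileCmd T C₁ none (nl + 2) c₁).bind fun (P₁, l₁, nl₁, C₂) =>
          (compileCmd T C₁ (some nl) nl₁ c₂).bind fun (P₂, l₂, nl₂, C₃) =>
            some (Pe ++ [((if Pe = [] then l else none, .jz nl r), C₁)] ++
                P₁ ++ [((l₁, .jmp (nl + 1)), C₂)] ++ P₂ ++ [((l₂, .epi), C₃)],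
              some (nl + 1), nl₂, (meet C₂.1 C₃.1, C₂.2))
  | C, l, nl, .while e c =>
      (compileExpr T (fun _ => none, C.2) ∅ (some (loopLabel l nl).1) e).bind fun (Pe, r, C₁) =>
        (compileCmd T C₁ none ((loopLabel l nl).2 + 1) c).bind fun (P₁, l₁, nl₁, C₂) =>
          some (Pe ++ [((if Pe = [] then some (loopLabel l nl).1 else none,
                .jz (loopLabel l nl).2 r), C₁)] ++
              P₁ ++ [((l₁, .jmp (loopLabel l nl).1), C₂)],
            some (loopLabel l nl).2, nl₁, C₁)
  | C, l, nl, .assign v e =>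
      if writeAllowed T C.2 v then
        (compileExpr T C ∅ l e).bind fun (Pe, r, C₁) =>
          some (Pe ++ [((if Pe = [] then l else none, .store v r), C₁)], none, nl,
            (purge C₁.1 {v}, C₁.2))
      else none
  | C, l, nl, .lockAcq k => some ([((l, .lockAcq k), C)], none, nl, (C.1, asmAcq T k C.2))
  | C, l, nl, .lockRel k =>
      some ([((l, .lockRel k), C)], none, nl,
        (purge C.1 {v | ¬ varStable T (asmRel T k C.2) v}, asmRel T k C.2))

/-! ### The refinement relation and the coupling invariant -/

def regrecMemConsistent (T : Params Val Opr Var Lock Reg) (Φ : RegRec Val Opr Var Reg)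
    (regs : Reg → Val) (m : Mem Val Var Lock) : Prop :=
  ∀ r e, Φ r = some e → regs r = evExp T m e

def asmrecMdsConsistent (S : AsmRec Var) (mds : Mds Var Lock) : Prop :=
  Shared.var '' S.1 = mds .asmNoW ∧ Shared.var '' S.2 = mds .asmNoRW

/-- Consistency of a compilation record with registers, mode state and memory. -/
def compiledCmdConfigConsistent (T : Params Val Opr Var Lock Reg) (C : CompRec Val Opr Var Reg)
    (regs : Reg → Val) (mds : Mds Var Lock) (m : Mem Val Var Lock) : Prop :=
  regrecMemConsistent T C.1 regs m ∧ asmrecMdsConsistent C.2 mds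

/-- The refinement relation, as a predicate. -/
inductive RwrRel (T : Params Val Opr Var Lock Reg) :
    WConf Val Opr Var Lock → RConf Val Opr Var Lock Reg → Prop
  /-- A terminated `While` program and a terminated `RISC` program. -/
  | stopped (P regs mds m) :
      RwrRel T ⟨.stopped, mds, m⟩ ⟨⟨P.length, P, regs⟩, mds, m⟩
  | skip_nop (l regs mds m) :
      RwrRel T ⟨.skip, mds, m⟩ ⟨⟨0, [(l, .nop)], regs⟩, mds, m⟩
  /-- Evaluation of the expression of an assignment. -/
  | assign_expr (C l nl v e PCs l' nl' C' Pe r C₁ pc regs mds m)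
      (hreq : compileCmdInputReqs T C l nl (.assign v e))
      (hc : compileCmd T C l nl (.assign v e) = some (PCs, l', nl', C'))
      (he : compileExpr T C ∅ l e = some (Pe, r, C₁))
      (hpc : pc < Pe.length)
      (hcons : compiledCmdConfigConsistent T (PCs.recAt C' pc) regs mds m)
      (hstab : regrecStable T (PCs.recAt C' pc)) :
      RwrRel T ⟨.assign v e, mds, m⟩ ⟨⟨pc, PCs.text, regs⟩, mds, m⟩
  /-- The final `store` of an assignment. -/
  | assign_store (C l nl v e PCs l' nl' C' Pe r C₁ pc regs mds m)
      (hreq : compileCmdInputReqs T C l nl (.assign v e))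
      (hc : compileCmd T C l nl (.assign v e) = some (PCs, l', nl', C'))
      (he : compileExpr T C ∅ l e = some (Pe, r, C₁))
      (hpc : pc = Pe.length)
      (hcons : compiledCmdConfigConsistent T (PCs.recAt C' pc) regs mds m)
      (hstab : regrecStable T (PCs.recAt C' pc))
      (hw : writeAllowed T (PCs.recAt C' pc).2 v) :
      RwrRel T ⟨.assign v e, mds, m⟩ ⟨⟨pc, PCs.text, regs⟩, mds, m⟩
  | lock_acq (l k regs mds m) :
      RwrRel T ⟨.lockAcq k, mds, m⟩ ⟨⟨0, [(l, .lockAcq k)], regs⟩, mds, m⟩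
  | lock_rel (l k regs mds m) :
      RwrRel T ⟨.lockRel k, mds, m⟩ ⟨⟨0, [(l, .lockRel k)], regs⟩, mds, m⟩
  /-- The first part of a sequential composition; `c₁` is the program that was compiled, and `d` is
  what is left of it. -/
  | seq (C l nl c₁ PCs₁ l₁ nl₁ C₁ c₂ PCs₂ l₂ nl₂ C₂ d pc regs mds m)
      (hreq : compileCmdInputReqs T C l nl c₁)
      (hc₁ : compileCmd T C l nl c₁ = some (PCs₁, l₁, nl₁, C₁))
      (hc₂ : compileCmd T C₁ l₁ nl₁ c₂ = some (PCs₂, l₂, nl₂, C₂))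
      (hj : joinable PCs₁.text PCs₂.text)
      (hpc : pc ≤ PCs₁.length)
      (hcons : compiledCmdConfigConsistent T (PCs₁.recAt C₁ pc) regs mds m)
      (hstab : regrecStable T (PCs₁.recAt C₁ pc))
      (h₁ : RwrRel T ⟨d, mds, m⟩ ⟨⟨pc, PCs₁.text, regs⟩, mds, m⟩)
      (h₂ : ∀ mds' m' regs', compiledCmdConfigConsistent T C₁ regs' mds' m' → regrecStable T C₁ →
        RwrRel T ⟨c₂, mds', m'⟩ ⟨⟨0, PCs₂.text, regs'⟩, mds', m'⟩) :
      RwrRel T ⟨.seq d c₂, mds, m⟩ ⟨⟨pc, PCs₁.text ++ PCs₂.text, regs⟩, mds, m⟩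
  /-- Prepending unreachable instructions. -/
  | join (P₁ P₂ c pc regs mds m)
      (hj : joinable P₁ P₂)
      (hpc : P₁.length ≤ pc)
      (h : RwrRel T ⟨c, mds, m⟩ ⟨⟨pc - P₁.length, P₂, regs⟩, mds, m⟩) :
      RwrRel T ⟨c, mds, m⟩ ⟨⟨pc, P₁ ++ P₂, regs⟩, mds, m⟩
  /-- Evaluation of the expression of a conditional, and the conditional jump. -/
  | if_expr (C l nl e c₁ c₂ PCs l' nl₂ C' Pe r C₁ PCs₁ l₁ nl₁ C₂ PCs₂ l₂ C₃ pc regs mds m)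
      (hreq : compileCmdInputReqs T C l nl (.ite e c₁ c₂))
      (hc : compileCmd T C l nl (.ite e c₁ c₂) = some (PCs, l', nl₂, C'))
      (he : compileExpr T C ∅ l e = some (Pe, r, C₁))
      (hc₁ : compileCmd T C₁ none (nl + 2) c₁ = some (PCs₁, l₁, nl₁, C₂))
      (hc₂ : compileCmd T C₁ (some nl) nl₁ c₂ = some (PCs₂, l₂, nl₂, C₃))
      (hpc : pc ≤ Pe.length)
      (hcons : compiledCmdConfigConsistent T (PCs.recAt C' pc) regs mds m)
      (hstab : regrecStable T (PCs.recAt C' pc))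
      (h₁ : ∀ mds' m' regs', compiledCmdConfigConsistent T C₁ regs' mds' m' → regrecStable T C₁ →
        RwrRel T ⟨c₁, mds', m'⟩ ⟨⟨0, PCs₁.text, regs'⟩, mds', m'⟩)
      (h₂ : ∀ mds' m' regs', compiledCmdConfigConsistent T C₁ regs' mds' m' → regrecStable T C₁ →
        RwrRel T ⟨c₂, mds', m'⟩ ⟨⟨0, PCs₂.text, regs'⟩, mds', m'⟩) :
      RwrRel T ⟨.ite e c₁ c₂, mds, m⟩ ⟨⟨pc, PCs.text, regs⟩, mds, m⟩
  /-- The first branch of a conditional; `d` is what is left of it. -/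
  | if_c1 (C l nl e c₁ c₂ PCs l' nl₂ C' Pe r C₁ PCs₁ l₁ nl₁ C₂ PCs₂ l₂ C₃ d pc₁ pc regs mds m)
      (hreq : compileCmdInputReqs T C l nl (.ite e c₁ c₂))
      (hc : compileCmd T C l nl (.ite e c₁ c₂) = some (PCs, l', nl₂, C'))
      (he : compileExpr T C ∅ l e = some (Pe, r, C₁))
      (hc₁ : compileCmd T C₁ none (nl + 2) c₁ = some (PCs₁, l₁, nl₁, C₂))
      (hc₂ : compileCmd T C₁ (some nl) nl₁ c₂ = some (PCs₂, l₂, nl₂, C₃))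
      (hpc₁ : pc₁ < PCs₁.length)
      (hpc : pc = Pe.length + 1 + pc₁)
      (hcons : compiledCmdConfigConsistent T (PCs.recAt C' pc) regs mds m)
      (hstab : regrecStable T (PCs.recAt C' pc))
      (h : RwrRel T ⟨d, mds, m⟩ ⟨⟨pc₁, PCs₁.text, regs⟩, mds, m⟩) :
      RwrRel T ⟨d, mds, m⟩ ⟨⟨pc, PCs.text, regs⟩, mds, m⟩
  /-- The second branch of a conditional; `d` is what is left of it. -/
  | if_c2 (C l nl e c₁ c₂ PCs l' nl₂ C' Pe r C₁ PCs₁ l₁ nl₁ C₂ PCs₂ l₂ C₃ d pc₂ pc regs mds m)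
      (hreq : compileCmdInputReqs T C l nl (.ite e c₁ c₂))
      (hc : compileCmd T C l nl (.ite e c₁ c₂) = some (PCs, l', nl₂, C'))
      (he : compileExpr T C ∅ l e = some (Pe, r, C₁))
      (hc₁ : compileCmd T C₁ none (nl + 2) c₁ = some (PCs₁, l₁, nl₁, C₂))
      (hc₂ : compileCmd T C₁ (some nl) nl₁ c₂ = some (PCs₂, l₂, nl₂, C₃))
      (hpc₂ : pc₂ < PCs₂.length)
      (hpc : pc = Pe.length + 1 + PCs₁.length + 1 + pc₂)
      (hcons : compiledCmdConfigConsistent T (PCs.recAt C' pc) regs mds m)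
      (hstab : regrecStable T (PCs.recAt C' pc))
      (h : RwrRel T ⟨d, mds, m⟩ ⟨⟨pc₂, PCs₂.text, regs⟩, mds, m⟩) :
      RwrRel T ⟨d, mds, m⟩ ⟨⟨pc, PCs.text, regs⟩, mds, m⟩
  /-- Silent steps of a terminated `While` program to the end of a `RISC` program. -/
  | epilogue_step (pc P regs mds m)
      (hp : isEpilogueStep P pc)
      (h : ∀ pc' regs' mds' m',
        RStep T ⟨⟨pc, P, regs⟩, mds, m⟩ ⟨⟨pc', P, regs'⟩, mds', m'⟩ →
        RwrRel T ⟨.stopped, mds', m'⟩ ⟨⟨pc', P, regs'⟩, mds', m'⟩) :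
      RwrRel T ⟨.stopped, mds, m⟩ ⟨⟨pc, P, regs⟩, mds, m⟩
  /-- The initial step of a loop to a conditional, evaluation of its expression, and the
  conditional jump. -/
  | while_expr (C l nl e c PCs l' nl₁ C' Pe r C₁ PCs₁ l₁ C₂ d pc regs mds m)
      (hreq : compileCmdInputReqs T C l nl (.while e c))
      (hc : compileCmd T C l nl (.while e c) = some (PCs, l', nl₁, C'))
      (he : compileExpr T (fun _ => none, C.2) ∅ (some (loopLabel l nl).1) e = some (Pe, r, C₁))
      (hc₁ : compileCmd T C₁ none ((loopLabel l nl).2 + 1) c = some (PCs₁, l₁, nl₁, C₂))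
      (hd : (pc = 0 ∧ d = .while e c) ∨
        (0 < pc ∧ pc ≤ Pe.length ∧ d = .ite e (.seq c (.while e c)) .stopped))
      (hcons : compiledCmdConfigConsistent T (PCs.recAt C' pc) regs mds m)
      (hstab : regrecStable T (PCs.recAt C' pc))
      (h : ∀ mds' m' regs', compiledCmdConfigConsistent T C₁ regs' mds' m' → regrecStable T C₁ →
        RwrRel T ⟨c, mds', m'⟩ ⟨⟨0, PCs₁.text, regs'⟩, mds', m'⟩) :
      RwrRel T ⟨d, mds, m⟩ ⟨⟨pc, PCs.text, regs⟩, mds, m⟩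
  /-- The body of a loop; `d` is what is left of it. -/
  | while_inner (C l nl e c PCs l' nl₁ C' Pe r C₁ PCs₁ l₁ C₂ d pc₁ pc regs mds m)
      (hreq : compileCmdInputReqs T C l nl (.while e c))
      (hc : compileCmd T C l nl (.while e c) = some (PCs, l', nl₁, C'))
      (he : compileExpr T (fun _ => none, C.2) ∅ (some (loopLabel l nl).1) e = some (Pe, r, C₁))
      (hc₁ : compileCmd T C₁ none ((loopLabel l nl).2 + 1) c = some (PCs₁, l₁, nl₁, C₂))
      (hpc₁ : pc₁ < PCs₁.length)
      (hpc : pc = Pe.length + 1 + pc₁)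
      (hcons : compiledCmdConfigConsistent T (PCs.recAt C' pc) regs mds m)
      (hstab : regrecStable T (PCs.recAt C' pc))
      (h : RwrRel T ⟨d, mds, m⟩ ⟨⟨pc₁, PCs₁.text, regs⟩, mds, m⟩)
      (h' : ∀ mds' m' regs', compiledCmdConfigConsistent T C₁ regs' mds' m' → regrecStable T C₁ →
        RwrRel T ⟨c, mds', m'⟩ ⟨⟨0, PCs₁.text, regs'⟩, mds', m'⟩) :
      RwrRel T ⟨.seq d (.while e c), mds, m⟩ ⟨⟨pc, PCs.text, regs⟩, mds, m⟩
  /-- The epilogue of the body of a loop, and the final jump back to the head of the loop. -/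
  | while_loop (C l nl e c PCs l' nl₁ C' Pe r C₁ PCs₁ l₁ C₂ pc₁ pc regs mds m)
      (hreq : compileCmdInputReqs T C l nl (.while e c))
      (hc : compileCmd T C l nl (.while e c) = some (PCs, l', nl₁, C'))
      (he : compileExpr T (fun _ => none, C.2) ∅ (some (loopLabel l nl).1) e = some (Pe, r, C₁))
      (hc₁ : compileCmd T C₁ none ((loopLabel l nl).2 + 1) c = some (PCs₁, l₁, nl₁, C₂))
      (hpc₁ : pc₁ ≤ PCs₁.length)
      (hpc : pc = Pe.length + 1 + pc₁)
      (hcons : compiledCmdConfigConsistent T (PCs.recAt C' pc) regs mds m)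
      (hstab : regrecStable T (PCs.recAt C' pc))
      (h : RwrRel T ⟨.stopped, mds, m⟩ ⟨⟨pc₁, PCs₁.text, regs⟩, mds, m⟩)
      (h' : ∀ mds' m' regs', compiledCmdConfigConsistent T C₁ regs' mds' m' → regrecStable T C₁ →
        RwrRel T ⟨c, mds', m'⟩ ⟨⟨0, PCs₁.text, regs'⟩, mds', m'⟩) :
      RwrRel T ⟨.seq .stopped (.while e c), mds, m⟩ ⟨⟨pc, PCs.text, regs⟩, mds, m⟩

/-- The refinement relation of the compiler. -/
def Rwr (T : Params Val Opr Var Lock Reg) :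
    Set (WConf Val Opr Var Lock × RConf Val Opr Var Lock Reg) :=
  {p | RwrRel T p.1 p.2}

/-- The coupling invariant: equal program counters and program texts. -/
def Iwr (Val Opr Var Lock Reg : Type*) :
    Set (RConf Val Opr Var Lock Reg × RConf Val Opr Var Lock Reg) :=
  {p | p.1.tps.pc = p.2.tps.pc ∧ p.1.tps.prog = p.2.tps.prog}

end Compiler

end WR

end

noncomputable section

open scoped Classical

namespace WR

/-! ### Deterministic execution of single `RISC` instructions -/

section Exec

variable {Val Opr Var Lock Reg : Type*}

/-! Both languages are deterministic, and this drives the proof. Take related configurations and one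
`RISC` step. `RwrRel.simulated` matches the step by exactly `stepsAt P pc d` source steps. This
number is computed from the program text, the position and the source command alone, and does not
depend on registers or memory. In the cube, the two runs share text and position by the coupling
invariant, and they share the source command because `B` is non-High-branching. So the same number
of steps serves both sides. By determinism, the second source run handed in by the obligation is the
one that the simulation constructs for the second `RISC` step.

It remains to see that both `RISC` runs reach the same position (`exec_pc_eq`). The next position
depends on data only at `jz`, `lockAcq` and `lockRel`. At a `jz`, the tested register holds the
value of the condition of the conditional that the source is about to execute
(`RwrRel.controlSpec`), and `B` makes the two values equal. At a `lockAcq`, if one run acquired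
while the other spun, `B` would relate different commands. A `lockRel` looks only at the mode state,
which is common to both runs.

The simulation rests on two static facts about compiled code. The first is modularity. Labels are
fresh, so a compiled subprogram behaves inside the whole program as it does alone, translated by an
offset, and leaving it means entering what follows (`Embeds`, `labelSpec_of_compileCmd`). The second
is soundness of the annotations. Each instruction leads from configurations consistent with the
record at its position to configurations consistent with the record at the position reached
(`annSoundAt_compileCmd`). Thus the register used by a `store` or a `jz` really holds the value of
the source expression.

Writes by other threads are harmless because records mention stable variables only, and these are
not writable (`RwrRel.change_mem`). The transfer of bisimulations along a secure refinement
(`strongLowBisimMM_concreteBisim`) holds for arbitrary step relations. Since the refinement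
preserves mode states and memories, low-equivalence of the target configurations after a step is
inherited from the source. -/

/-- The effect of an instruction on program counter, registers, mode state and memory, where `f`
resolves labels. -/
def exec (T : Params Val Opr Var Lock Reg) (f : Lab → ℕ) (pc : ℕ) (regs : Reg → Val)
    (mds : Mds Var Lock) (m : Mem Val Var Lock) :
    Instr Val Opr Var Lock Reg → ℕ × (Reg → Val) × Mds Var Lock × Mem Val Var Lock
  | .load r v => (pc + 1, upd regs r (m (.var v)), mds, m)
  | .store v r => (pc + 1, regs, mds, upd m (.var v) (regs r))
  | .jmp l => (f l, regs, mds, m)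
  | .jz l r => (if T.isZero (regs r) then f l else pc + 1, regs, mds, m)
  | .nop => (pc + 1, regs, mds, m)
  | .epi => (pc + 1, regs, mds, m)
  | .moveK r n => (pc + 1, upd regs r n, mds, m)
  | .moveR r r' => (pc + 1, upd regs r (regs r'), mds, m)
  | .op o r r' => (pc + 1, upd regs r (T.evalOp o (regs r) (regs r')), mds, m)
  | .lockAcq k =>
      if m (.lock k) = T.lockFree then
        (pc + 1, regs, lockAcqUpd T k mds, upd m (.lock k) T.lockTaken)
      else (pc, regs, mds, m)
  | .lockRel k =>
      if lockHeld T k mds then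
        (pc + 1, regs, lockRelUpd T k mds, upd m (.lock k) T.lockFree)
      else (pc, regs, mds, m)

/-- The configuration with program text `P` and the other components given by `s`. -/
def confOf (P : Prog Val Opr Var Lock Reg)
    (s : ℕ × (Reg → Val) × Mds Var Lock × Mem Val Var Lock) : RConf Val Opr Var Lock Reg :=
  ⟨⟨s.1, P, s.2.1⟩, s.2.2.1, s.2.2.2⟩

/-- Turns the step relation into a partial function of the instruction at the current position.
Steps are inverted and constructed through this form below, and it makes determinism evident. -/
theorem rstep_iff {T : Params Val Opr Var Lock Reg} {pc : ℕ} {P : Prog Val Opr Var Lock Reg}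
    {regs : Reg → Val} {mds : Mds Var Lock} {m : Mem Val Var Lock}
    {x : RConf Val Opr Var Lock Reg} :
    RStep T ⟨⟨pc, P, regs⟩, mds, m⟩ x ↔
      ∃ l i, P[pc]? = some (l, i) ∧ x = confOf P (exec T (resolve P) pc regs mds m i) := by
  constructor
  · intro h
    cases h <;> exact ⟨_, _, ‹_›, by simp [confOf, exec, *]⟩
  · rintro ⟨l, i, h, rfl⟩
    cases i <;> simp only [exec, confOf]
    case load => exact .load _ _ _ _ _ _ _ _ h
    case store => exact .store _ _ _ _ _ _ _ _ h
    case jmp => exact .jmp _ _ _ _ _ _ _ h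
    case jz =>
      split_ifs with hz
      · exact .jzZero _ _ _ _ _ _ _ _ h hz
      · exact .jzNonzero _ _ _ _ _ _ _ _ h hz
    case nop => exact .nop _ _ _ _ _ _ h
    case epi => exact .epi _ _ _ _ _ _ h
    case moveK => exact .moveK _ _ _ _ _ _ _ _ h
    case moveR => exact .moveR _ _ _ _ _ _ _ _ h
    case op => exact .op _ _ _ _ _ _ _ _ _ h
    case lockAcq =>
      split_ifs with hz
      · exact .lockAcq _ _ _ _ _ _ _ h hz
      · exact .lockSpin _ _ _ _ _ _ _ h hz
    case lockRel =>
      split_ifs with hz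
      · exact .lockRel _ _ _ _ _ _ _ h hz
      · exact .lockInvalid _ _ _ _ _ _ _ h hz

/-! ### Labels, jumps and their resolution -/

theorem labels_nil : labels ([] : Prog Val Opr Var Lock Reg) = ∅ := by
  simp [labels]

theorem mem_labels_append {P Q : Prog Val Opr Var Lock Reg} {x : Lab} :
    x ∈ labels (P ++ Q) ↔ x ∈ labels P ∨ x ∈ labels Q := by
  simp only [labels, Set.mem_ofPred_eq, List.mem_append]
  grind

theorem mem_labels_singleton {l : Option Lab} {i : Instr Val Opr Var Lock Reg} {x : Lab} :
    x ∈ labels [(l, i)] ↔ l = some x := by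
  simp [labels]

theorem mem_jumps_append {P Q : Prog Val Opr Var Lock Reg} {x : Lab} :
    x ∈ jumps (P ++ Q) ↔ x ∈ jumps P ∨ x ∈ jumps Q := by
  simp only [jumps, Set.mem_ofPred_eq, List.mem_append]
  grind

theorem mem_jumps_singleton {l : Option Lab} {i : Instr Val Opr Var Lock Reg} {x : Lab} :
    x ∈ jumps [(l, i)] ↔ i = .jmp x ∨ ∃ r, i = .jz x r := by
  simp [jumps]

theorem resolve_le (P : Prog Val Opr Var Lock Reg) (x : Lab) : resolve P x ≤ P.length :=
  List.findIdx_le_length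

theorem resolve_lt_iff {P : Prog Val Opr Var Lock Reg} {x : Lab} :
    resolve P x < P.length ↔ x ∈ labels P := by
  simp [resolve, labels]

theorem resolve_of_notMem {P : Prog Val Opr Var Lock Reg} {x : Lab} (h : x ∉ labels P) :
    resolve P x = P.length :=
  le_antisymm (resolve_le P x) (not_lt.1 fun hlt => h (resolve_lt_iff.1 hlt))

theorem resolve_append_of_mem {P Q : Prog Val Opr Var Lock Reg} {x : Lab} (h : x ∈ labels P) :
    resolve (P ++ Q) x = resolve P x := by
  have h' := resolve_lt_iff.2 h
  unfold resolve at *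
  rw [List.findIdx_append, if_pos h']

theorem resolve_append_of_notMem {P Q : Prog Val Opr Var Lock Reg} {x : Lab} (h : x ∉ labels P) :
    resolve (P ++ Q) x = P.length + resolve Q x := by
  have h' := fun hlt => h (resolve_lt_iff.1 hlt)
  unfold resolve at *
  rw [List.findIdx_append, if_neg h', add_comm]

/-- The first instruction of `P` has label `x`. -/
def HeadLabel (P : Prog Val Opr Var Lock Reg) (x : Lab) : Prop :=
  ∃ i, P.head? = some i ∧ i.1 = some x

theorem HeadLabel.append {P : Prog Val Opr Var Lock Reg} {x : Lab} (h : HeadLabel P x)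
    (Q : Prog Val Opr Var Lock Reg) : HeadLabel (P ++ Q) x := by
  obtain ⟨i, hi, hx⟩ := h
  exact ⟨i, by simp [hi], hx⟩

theorem headLabel_cons {l : Option Lab} {i : Instr Val Opr Var Lock Reg}
    {P : Prog Val Opr Var Lock Reg} {x : Lab} : HeadLabel ((l, i) :: P) x ↔ l = some x := by
  simp [HeadLabel]

theorem HeadLabel.resolve_eq_zero {P : Prog Val Opr Var Lock Reg} {x : Lab} (h : HeadLabel P x) :
    resolve P x = 0 := by
  obtain ⟨i, hi, hx⟩ := h
  cases P with
  | nil => simp at hi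
  | cons a P =>
    simp only [List.head?_cons, Option.some.injEq] at hi
    subst hi
    simp [resolve, List.findIdx_cons, hx]

theorem HeadLabel.mem_labels {P : Prog Val Opr Var Lock Reg} {x : Lab} (h : HeadLabel P x) :
    x ∈ labels P := by
  obtain ⟨i, hi, hx⟩ := h
  exact ⟨i, List.mem_of_mem_head? hi, hx⟩

/-! ### Programs as parts of larger programs -/

/-- The control flow of `Q` within `A ++ Q ++ B` agrees with that of `Q` alone, where leaving `Q`
means to proceed to the start of `B`. -/
def Embeds (A Q B : Prog Val Opr Var Lock Reg) : Prop :=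
  ∀ x ∈ jumps Q, x ∉ labels A ∧ (x ∈ labels Q ∨ B = [] ∨ HeadLabel B x)

/-- A label absent from `Q` resolves to the end of `Q` when `Q` stands alone. In the large program
the same label is found at the head of `B`, or `B` is empty and the label is found nowhere. Both
give position `|A| + |Q|`, so one formula covers internal and leaving jumps. -/
theorem Embeds.resolve_eq {A Q B : Prog Val Opr Var Lock Reg} (h : Embeds A Q B) {x : Lab}
    (hx : x ∈ jumps Q) : resolve (A ++ Q ++ B) x = A.length + resolve Q x := by
  obtain ⟨hA, hQ⟩ := h x hx
  rw [List.append_assoc, resolve_append_of_notMem hA]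
  congr 1
  by_cases hxQ : x ∈ labels Q
  · exact resolve_append_of_mem hxQ
  · rw [resolve_append_of_notMem hxQ, resolve_of_notMem hxQ]
    rcases hQ with hQ | rfl | hQ
    · exact absurd hQ hxQ
    · rfl
    · rw [hQ.resolve_eq_zero, add_zero]

theorem getElem?_embed (A Q B : Prog Val Opr Var Lock Reg) {i : ℕ} (hi : i < Q.length) :
    (A ++ Q ++ B)[A.length + i]? = Q[i]? := by
  rw [List.append_assoc, List.getElem?_append_right (by omega), Nat.add_sub_cancel_left,
    List.getElem?_append_left hi]

/-- Execution is translation invariant: the position enters only additively, and label resolution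
matters only at the targets of the instruction itself. -/
theorem exec_shift {T : Params Val Opr Var Lock Reg} {f g : Lab → ℕ} {a i : ℕ}
    {regs : Reg → Val} {mds : Mds Var Lock} {m : Mem Val Var Lock}
    {ins : Instr Val Opr Var Lock Reg}
    (h : ∀ x, (ins = .jmp x ∨ ∃ r, ins = .jz x r) → f x = a + g x) :
    exec T f (a + i) regs mds m ins =
      (a + (exec T g i regs mds m ins).1, (exec T g i regs mds m ins).2) := by
  cases ins <;> simp [exec, add_assoc] <;> try split_ifs <;> simp_all
  all_goals simp_all

theorem exec_le {T : Params Val Opr Var Lock Reg} {f : Lab → ℕ} {n i : ℕ}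
    {regs : Reg → Val} {mds : Mds Var Lock} {m : Mem Val Var Lock}
    {ins : Instr Val Opr Var Lock Reg} (hi : i < n) (hf : ∀ x, f x ≤ n) :
    (exec T f i regs mds m ins).1 ≤ n := by
  cases ins <;> simp only [exec] <;> try split_ifs
  all_goals first | exact hf _ | omega

theorem mem_jumps_of_getElem? {Q : Prog Val Opr Var Lock Reg} {i : ℕ} {l : Option Lab}
    {ins : Instr Val Opr Var Lock Reg} (hi : Q[i]? = some (l, ins)) {x : Lab}
    (hx : ins = .jmp x ∨ ∃ r, ins = .jz x r) : x ∈ jumps Q :=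
  ⟨_, List.mem_of_getElem? hi, hx⟩

/-- The modularity principle: a step of the whole program inside `Q` is a translated step of `Q`
alone. The value `j = |Q|` is allowed and means that control has left `Q` for the start of `B`. -/
theorem Embeds.step {T : Params Val Opr Var Lock Reg} {A Q B P : Prog Val Opr Var Lock Reg}
    (h : Embeds A Q B) (hP : P = A ++ Q ++ B) {i pc : ℕ} (hi : i < Q.length)
    (hpc : pc = A.length + i)
    {regs : Reg → Val} {mds : Mds Var Lock} {m : Mem Val Var Lock}
    {x : RConf Val Opr Var Lock Reg} (hx : RStep T ⟨⟨pc, P, regs⟩, mds, m⟩ x) :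
    ∃ j regs' mds' m', j ≤ Q.length ∧ x = ⟨⟨A.length + j, P, regs'⟩, mds', m'⟩ ∧
      RStep T ⟨⟨i, Q, regs⟩, mds, m⟩ ⟨⟨j, Q, regs'⟩, mds', m'⟩ := by
  subst hP hpc
  obtain ⟨l, ins, hins, rfl⟩ := rstep_iff.1 hx
  rw [getElem?_embed _ _ _ hi] at hins
  refine ⟨_, _, _, _, exec_le (T := T) (ins := ins) (regs := regs) (mds := mds) (m := m) hi
    (resolve_le Q), ?_, rstep_iff.2 ⟨l, ins, hins, rfl⟩⟩
  rw [exec_shift (g := resolve Q) fun y hy => h.resolve_eq (mem_jumps_of_getElem? hins hy)]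
  rfl

/-- Source and target of a jump are shifted by the same offset, so whether it goes forward is
unaffected. -/
theorem Embeds.isEpilogueStep_iff {A Q B P : Prog Val Opr Var Lock Reg} (h : Embeds A Q B)
    (hP : P = A ++ Q ++ B) {i pc : ℕ} (hi : i < Q.length) (hpc : pc = A.length + i) :
    isEpilogueStep P pc ↔ isEpilogueStep Q i := by
  subst hP hpc
  unfold isEpilogueStep
  rw [getElem?_embed _ _ _ hi]
  refine or_congr Iff.rfl (exists_congr fun l => exists_congr fun x => and_congr_right fun hx => ?_)
  rw [h.resolve_eq (mem_jumps_of_getElem? hx (.inl rfl))]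
  omega

theorem joinable.embeds_left {P Q : Prog Val Opr Var Lock Reg} (h : joinable P Q) :
    Embeds [] P Q := fun x hx =>
  ⟨by simp [labels_nil], (h.1 x hx).imp_right .inr⟩

theorem joinable.embeds_right {P Q : Prog Val Opr Var Lock Reg} (h : joinable P Q) :
    Embeds P Q [] := fun x hx =>
  ⟨h.2 x hx, .inr (.inl rfl)⟩

end Exec

/-! ### Sequences of steps -/

section Steps

variable {Val Opr Var Lock Reg : Type*}

theorem nSteps_det {α : Type*} {step : α → α → Prop}
    (hdet : ∀ a b c, step a b → step a c → b = c) {n : ℕ} {a b c : α}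
    (hb : nSteps step n a b) (hc : nSteps step n a c) : b = c := by
  induction n generalizing a with
  | zero => exact hb.symm.trans hc
  | succ n ih =>
    obtain ⟨x, hx, hb⟩ := hb
    obtain ⟨y, hy, hc⟩ := hc
    obtain rfl := hdet _ _ _ hx hy
    exact ih hb hc

/-- The only two rules that could overlap without contradictory side conditions are `seqStop` and
`seq`, and `stopped` has no step of its own. -/
theorem wstep_det (T : Params Val Opr Var Lock Reg) (a b c : WConf Val Opr Var Lock)
    (hb : WStep T a b) (hc : WStep T a c) : b = c := by
  induction hb generalizing c with
  | seq c₁ c₁' c₂ mds mds' m m' h ih =>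
    cases hc with
    | seqStop => cases h
    | seq _ _ _ _ _ _ _ h' => cases ih _ h'; rfl
  | seqStop =>
    cases hc with
    | seqStop => rfl
    | seq _ _ _ _ _ _ _ h' => cases h'
  | _ => cases hc <;> first | rfl | contradiction

theorem nSteps_one {α : Type*} {step : α → α → Prop} {a b : α} (h : step a b) :
    nSteps step 1 a b := ⟨b, h, rfl⟩

theorem nSteps_seq {T : Params Val Opr Var Lock Reg} {n : ℕ} {d d' : Cmd Val Opr Var Lock}
    {mds mds' : Mds Var Lock} {m m' : Mem Val Var Lock}
    (h : nSteps (WStep T) n ⟨d, mds, m⟩ ⟨d', mds', m'⟩) (c : Cmd Val Opr Var Lock) :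
    nSteps (WStep T) n ⟨.seq d c, mds, m⟩ ⟨.seq d' c, mds', m'⟩ := by
  induction n generalizing d mds m with
  | zero => cases h; rfl
  | succ n ih =>
    obtain ⟨⟨x, mdsx, mx⟩, hx, h⟩ := h
    exact ⟨_, .seq _ _ _ _ _ _ _ hx, ih h⟩

end Steps

/-! ### Static properties of the compiler -/

section Static

variable {Val Opr Var Lock Reg : Type*}

theorem upd_self {α β : Type*} (f : α → β) (a : α) (b : β) : upd f a b a = b := by
  simp [upd]

theorem upd_of_ne {α β : Type*} (f : α → β) {a x : α} (b : β) (h : x ≠ a) :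
    upd f a b x = f x := by
  simp [upd, h]

theorem AProg.text_append (P Q : AProg Val Opr Var Lock Reg) :
    AProg.text (P ++ Q) = P.text ++ Q.text := by
  simp [AProg.text]

theorem AProg.text_nil : AProg.text ([] : AProg Val Opr Var Lock Reg) = [] := rfl

theorem AProg.text_cons (i : LInstr Val Opr Var Lock Reg) (C : CompRec Val Opr Var Reg)
    (P : AProg Val Opr Var Lock Reg) : AProg.text ((i, C) :: P) = i :: P.text := rfl

theorem AProg.length_text (P : AProg Val Opr Var Lock Reg) : P.text.length = P.length := by
  simp [AProg.text]

theorem AProg.recAt_append_left {P : AProg Val Opr Var Lock Reg} {j : ℕ} (hj : j < P.length)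
    (Q : AProg Val Opr Var Lock Reg) (C C' : CompRec Val Opr Var Reg) :
    AProg.recAt (P ++ Q) C j = P.recAt C' j := by
  simp [AProg.recAt, List.getD_eq_getElem?_getD, List.getElem?_append_left, hj]

theorem AProg.recAt_append_right (P Q : AProg Val Opr Var Lock Reg)
    (C : CompRec Val Opr Var Reg) (j : ℕ) :
    AProg.recAt (P ++ Q) C (P.length + j) = Q.recAt C j := by
  simp [AProg.recAt, List.getD_eq_getElem?_getD, List.getElem?_append_right]

theorem AProg.recAt_length (P : AProg Val Opr Var Lock Reg) (C : CompRec Val Opr Var Reg) :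
    P.recAt C P.length = C := by
  simp [AProg.recAt, List.getD_eq_getElem?_getD]

theorem AProg.recAt_mem {P : AProg Val Opr Var Lock Reg} {C : CompRec Val Opr Var Reg}
    {p : CompRec Val Opr Var Reg → Prop} (hP : ∀ x ∈ P, p x.2) (hC : p C) (j : ℕ) :
    p (P.recAt C j) := by
  rcases lt_or_ge j P.length with hj | hj
  · have : P.recAt C j = (P[j]).2 := by simp [AProg.recAt, List.getD_eq_getElem?_getD, hj]
    rw [this]
    exact hP _ (List.getElem_mem hj)
  · have : P.recAt C j = C := by simp [AProg.recAt, List.getD_eq_getElem?_getD, hj]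
    rwa [this]

/-! ### Comparison of compilation records, and local soundness of annotations -/

/-- `C₁` records at most as much as `C₂`. -/
def RecLe (C₁ C₂ : CompRec Val Opr Var Reg) : Prop :=
  C₁.2 = C₂.2 ∧ ∀ r e, C₁.1 r = some e → C₂.1 r = some e

theorem RecLe.refl (C : CompRec Val Opr Var Reg) : RecLe C C := ⟨rfl, fun _ _ h => h⟩

theorem RecLe.of_eq {C₁ C₂ : CompRec Val Opr Var Reg} (h : C₁ = C₂) : RecLe C₁ C₂ :=
  h ▸ RecLe.refl _

theorem RecLe.consistent {T : Params Val Opr Var Lock Reg} {C₁ C₂ : CompRec Val Opr Var Reg}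
    (h : RecLe C₁ C₂) {regs : Reg → Val} {mds : Mds Var Lock} {m : Mem Val Var Lock}
    (hc : compiledCmdConfigConsistent T C₂ regs mds m) :
    compiledCmdConfigConsistent T C₁ regs mds m :=
  ⟨fun r e hr => hc.1 r e (h.2 r e hr), h.1 ▸ hc.2⟩

theorem RecLe.stable {T : Params Val Opr Var Lock Reg} {C₁ C₂ : CompRec Val Opr Var Reg}
    (h : RecLe C₁ C₂) (hs : regrecStable T C₂) : regrecStable T C₁ := fun r e hr v hv =>
  h.1 ▸ hs r e (h.2 r e hr) v hv

theorem recLe_meet_left {Φ Φ' : RegRec Val Opr Var Reg} {S : AsmRec Var} :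
    RecLe (meet Φ Φ', S) (Φ, S) :=
  ⟨rfl, fun r e h => by simp only [meet] at h; split_ifs at h; exact h⟩

theorem recLe_meet_right {Φ Φ' : RegRec Val Opr Var Reg} {S : AsmRec Var} :
    RecLe (meet Φ Φ', S) (Φ', S) :=
  ⟨rfl, fun r e h => by
    simp only [meet] at h; split_ifs at h with hh; rw [hh] at h; exact h⟩

theorem recLe_empty {C : CompRec Val Opr Var Reg} {S : AsmRec Var} (h : S = C.2) :
    RecLe (fun _ => none, S) C :=
  ⟨h, fun r e h => by simp at h⟩

/-- The instruction at position `pc` takes configurations that are consistent with the annotation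
at `pc` to ones that are consistent with the annotation at the position reached. -/
def AnnSoundAt (T : Params Val Opr Var Lock Reg) (P : AProg Val Opr Var Lock Reg)
    (C' : CompRec Val Opr Var Reg) (pc : ℕ) : Prop :=
  ∀ regs mds m pc' regs' mds' m', compiledCmdConfigConsistent T (P.recAt C' pc) regs mds m →
    RStep T ⟨⟨pc, P.text, regs⟩, mds, m⟩ ⟨⟨pc', P.text, regs'⟩, mds', m'⟩ →
    compiledCmdConfigConsistent T (P.recAt C' pc') regs' mds' m'

/-- Only the seam needs care. A step that leaves `Q` is known to respect the final record of `Q`,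
while the annotation found there is the first record of `B`. It suffices that the latter records no
more. Equality would be too strong, since a loop starts from an empty register record. -/
theorem AnnSoundAt.embed {T : Params Val Opr Var Lock Reg} {A Q B P : AProg Val Opr Var Lock Reg}
    {C CQ : CompRec Val Opr Var Reg} {i pc : ℕ} (h : AnnSoundAt T Q CQ i)
    (hE : Embeds A.text Q.text B.text) (hP : P = A ++ Q ++ B) (hB : RecLe (B.recAt C 0) CQ)
    (hi : i < Q.length) (hpc : pc = A.length + i) : AnnSoundAt T P C pc := by
  subst hP hpc
  intro regs mds m pc' regs' mds' m' hc hstep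
  have hrec : ∀ j < Q.length, AProg.recAt (A ++ Q ++ B) C (A.length + j) = Q.recAt CQ j := by
    intro j hj
    rw [List.append_assoc, AProg.recAt_append_right, AProg.recAt_append_left hj]
  obtain ⟨j, regs₁, mds₁, m₁, hj, hx, hs⟩ := hE.step (i := i)
    (by simp only [AProg.text_append]) (by rwa [AProg.length_text])
    (by rw [AProg.length_text]) hstep
  simp only [LocalConf.mk.injEq, RState.mk.injEq] at hx
  obtain ⟨⟨rfl, -, rfl⟩, rfl, rfl⟩ := hx
  rw [AProg.length_text] at hj ⊢
  rw [hrec i hi] at hc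
  have := h _ _ _ _ _ _ _ hc hs
  rcases hj.lt_or_eq with hj | rfl
  · rwa [hrec j hj]
  · rw [AProg.recAt_length] at this
    rw [List.append_assoc, AProg.recAt_append_right, ← Nat.add_zero Q.length,
      AProg.recAt_append_right]
    exact hB.consistent this

/-- A single step, described by `exec`. -/
theorem annSoundAt_of_exec {T : Params Val Opr Var Lock Reg} {A B P : AProg Val Opr Var Lock Reg}
    {l : Option Lab} {ins : Instr Val Opr Var Lock Reg} {C₁ C : CompRec Val Opr Var Reg} {pc : ℕ}
    (hP : P = A ++ [((l, ins), C₁)] ++ B) (hpc : pc = A.length)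
    (h : ∀ regs mds m, compiledCmdConfigConsistent T C₁ regs mds m →
      let s := exec T (resolve P.text) pc regs mds m ins
      compiledCmdConfigConsistent T (P.recAt C s.1) s.2.1 s.2.2.1 s.2.2.2) :
    AnnSoundAt T P C pc := by
  intro regs mds m pc' regs' mds' m' hc hstep
  obtain ⟨l', i', hi', hx⟩ := rstep_iff.1 hstep
  have : P.text[pc]? = some (l, ins) := by
    subst hP hpc
    simp [AProg.text]
  rw [this] at hi'
  cases hi'
  have hrec : P.recAt C pc = C₁ := by
    subst hP hpc
    simp [AProg.recAt, List.getD_eq_getElem?_getD]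
  rw [hrec] at hc
  simp only [confOf, LocalConf.mk.injEq, RState.mk.injEq, true_and] at hx
  obtain ⟨⟨rfl, rfl⟩, rfl, rfl⟩ := hx
  exact h _ _ _ hc

/-! ### The expression compiler -/

/-- Instructions that evaluate expressions. -/
def IsEval : Instr Val Opr Var Lock Reg → Prop
  | .load _ _ => True
  | .moveK _ _ => True
  | .op _ _ _ => True
  | _ => False

/-- The induction invariant of the expression compiler. `keep` protects intermediate results: the
register of a left operand belongs to the reserved set while the right operand is compiled. `head`
needs `P ≠ []`, because a cached variable produces no code and the entry label then passes to the
next instruction. -/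
structure ExprSpec (T : Params Val Opr Var Lock Reg) (C : CompRec Val Opr Var Reg) (A : Set Reg)
    (l : Option Lab) (e : Exp Val Opr Var) (P : AProg Val Opr Var Lock Reg) (r : Reg)
    (C' : CompRec Val Opr Var Reg) : Prop where
  asm : C'.2 = C.2
  notMem : r ∉ A
  keep : ∀ a ∈ A, C'.1 a = C.1 a
  result : C'.1 r = some e
  isEval : ∀ x ∈ P, IsEval x.1.2
  head : ∀ x, l = some x → P ≠ [] → HeadLabel P.text x
  labels : ∀ x ∈ labels P.text, l = some x
  entry : P.recAt C' 0 = C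
  stable : regrecStable T C → (∀ x ∈ P, regrecStable T x.2) ∧ regrecStable T C'
  sound : ∀ pc < P.length, AnnSoundAt T P C' pc

theorem jumps_eq_empty {P : AProg Val Opr Var Lock Reg} (h : ∀ x ∈ P, IsEval x.1.2) :
    jumps P.text = ∅ := by
  ext x
  simp only [jumps, AProg.text, Set.mem_ofPred_eq, Set.mem_empty_iff_false, iff_false]
  rintro ⟨i, hi, hx⟩
  obtain ⟨y, hy, rfl⟩ := List.mem_map.1 hi
  have := h y hy
  rcases hx with hx | ⟨r, hx⟩ <;> simp [hx, IsEval] at this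

theorem regrecMemConsistent_upd {T : Params Val Opr Var Lock Reg} {Φ : RegRec Val Opr Var Reg}
    {regs : Reg → Val} {m : Mem Val Var Lock} (h : regrecMemConsistent T Φ regs m) (r : Reg)
    (e : Exp Val Opr Var) {n : Val} (hn : n = evExp T m e) :
    regrecMemConsistent T (upd Φ r (some e)) (upd regs r n) m := by
  intro r' e' hr'
  by_cases hr : r' = r
  · subst hr
    rw [upd_self] at hr' ⊢
    cases hr'
    exact hn
  · rw [upd_of_ne _ _ hr] at hr' ⊢
    exact h _ _ hr'

theorem regrecStable_upd {T : Params Val Opr Var Lock Reg} {C : CompRec Val Opr Var Reg}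
    (h : regrecStable T C) (r : Reg) (e : Exp Val Opr Var)
    (he : ∀ v ∈ e.vars, varStable T C.2 v) : regrecStable T (upd C.1 r (some e), C.2) := by
  intro r' e' hr'
  by_cases hr : r' = r
  · subst hr
    simp only [upd_self] at hr'
    cases hr'
    exact he
  · simp only [upd_of_ne _ _ hr] at hr'
    exact h _ _ hr'

theorem compileExpr_op_inv {T : Params Val Opr Var Lock Reg} {C C' : CompRec Val Opr Var Reg}
    {A : Set Reg} {l : Option Lab} {o : Opr} {e₁ e₂ : Exp Val Opr Var}
    {P : AProg Val Opr Var Lock Reg} {r : Reg}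
    (h : compileExpr T C A l (.op o e₁ e₂) = some (P, r, C')) :
    ∃ P₁ r₁ C₁ P₂ r₂ C₂, compileExpr T C A l e₁ = some (P₁, r₁, C₁) ∧
      compileExpr T C₁ (A ∪ {r₁}) (if P₁ = [] then l else none) e₂ = some (P₂, r₂, C₂) ∧
      P = P₁ ++ P₂ ++ [((if P₁ ++ P₂ = [] then l else none, .op o r₁ r₂), C₂)] ∧ r = r₁ ∧
      C' = (upd C₂.1 r₁ (some (.op o e₁ e₂)), C₂.2) := by
  simp only [compileExpr, Option.bind_eq_some_iff] at h
  obtain ⟨⟨P₁, r₁, C₁⟩, h₁, ⟨P₂, r₂, C₂⟩, h₂, h⟩ := h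
  cases h
  exact ⟨_, _, _, _, _, _, h₁, h₂, rfl, rfl, rfl⟩

theorem compileExpr_vars {T : Params Val Opr Var Lock Reg} {C C' : CompRec Val Opr Var Reg}
    {A : Set Reg} {l : Option Lab} {e : Exp Val Opr Var} {P : AProg Val Opr Var Lock Reg} {r : Reg}
    (h : compileExpr T C A l e = some (P, r, C')) :
    C'.2 = C.2 ∧ ∀ v ∈ e.vars, varStable T C.2 v := by
  induction e generalizing C A l P r C' with
  | const n =>
    simp only [compileExpr, Option.bind_eq_some_iff, Option.some.injEq, Prod.mk.injEq] at h
    obtain ⟨r', -, -, -, rfl⟩ := h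
    exact ⟨rfl, by simp [Exp.vars]⟩
  | var v =>
    simp only [compileExpr] at h
    split_ifs at h with hv
    refine ⟨?_, by simpa [Exp.vars] using hv⟩
    split at h
    · cases h; rfl
    · simp only [Option.bind_eq_some_iff, Option.some.injEq, Prod.mk.injEq] at h
      obtain ⟨r', -, -, -, rfl⟩ := h
      rfl
  | op o e₁ e₂ ih₁ ih₂ =>
    obtain ⟨P₁, r₁, C₁, P₂, r₂, C₂, h₁, h₂, -, -, rfl⟩ := compileExpr_op_inv h
    have h₁ := ih₁ h₁
    have h₂ := ih₂ h₂
    refine ⟨h₂.1.trans h₁.1, ?_⟩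
    rintro v (hv | hv)
    · exact h₁.2 v hv
    · exact h₁.1 ▸ h₂.2 v hv

/-- Code is empty only for a cached variable, and an empty register record caches nothing. Hence a
loop begins with at least one evaluation instruction, which can be paired with the source step that
unfolds the loop. -/
theorem compileExpr_ne_nil {T : Params Val Opr Var Lock Reg} {S : AsmRec Var}
    {C' : CompRec Val Opr Var Reg}
    {A : Set Reg} {l : Option Lab} {e : Exp Val Opr Var} {P : AProg Val Opr Var Lock Reg} {r : Reg}
    (h : compileExpr T (fun _ => none, S) A l e = some (P, r, C')) : P ≠ [] := by
  cases e with
  | const n =>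
    simp only [compileExpr, Option.bind_eq_some_iff, Option.some.injEq, Prod.mk.injEq] at h
    obtain ⟨r', -, rfl, -, rfl⟩ := h
    simp
  | var v =>
    simp only [compileExpr] at h
    split_ifs at h with hv
    split at h
    · rename_i hr
      simpa using T.regAllocCached_eq _ _ _ _ hr
    · simp only [Option.bind_eq_some_iff, Option.some.injEq, Prod.mk.injEq] at h
      obtain ⟨r', -, rfl, -, rfl⟩ := h
      simp
  | op o e₁ e₂ =>
    obtain ⟨P₁, r₁, C₁, P₂, r₂, C₂, h₁, h₂, rfl, -, rfl⟩ := compileExpr_op_inv h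
    simp

theorem ExprSpec.single {T : Params Val Opr Var Lock Reg} {C : CompRec Val Opr Var Reg}
    {A : Set Reg} {l : Option Lab} {e : Exp Val Opr Var} {r : Reg}
    {ins : Instr Val Opr Var Lock Reg} (hr : r ∉ A) (hins : IsEval ins)
    (he : ∀ v ∈ e.vars, varStable T C.2 v)
    (hexec : ∀ f pc regs mds m, exec T f pc regs mds m ins =
      (pc + 1, upd regs r (evExp T m e), mds, m)) :
    ExprSpec T C A l e [((l, ins), C)] r (upd C.1 r (some e), C.2) where
  asm := rfl
  notMem := hr
  keep a ha := upd_of_ne _ _ (by rintro rfl; exact hr ha)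
  result := upd_self _ _ _
  isEval := by simpa using hins
  head x hx _ := by simpa [AProg.text, headLabel_cons] using hx
  labels x hx := by simpa [AProg.text, mem_labels_singleton] using hx
  entry := rfl
  stable hs := ⟨by simpa using hs, regrecStable_upd hs _ _ he⟩
  sound pc hpc := by
    obtain rfl : pc = 0 := by simpa using hpc
    refine annSoundAt_of_exec (l := l) (ins := ins) (C₁ := C) (A := []) (B := []) rfl rfl
      fun regs mds m hc => ?_
    simp only [hexec]
    exact ⟨regrecMemConsistent_upd hc.1 _ _ rfl, hc.2⟩

theorem headLabel_text_append {P Q : AProg Val Opr Var Lock Reg} {x : Lab}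
    (hP : P ≠ [] → HeadLabel P.text x) (hQ : P = [] → HeadLabel Q.text x) :
    HeadLabel (AProg.text (P ++ Q)) x := by
  by_cases h : P = []
  · subst h
    exact hQ rfl
  · rw [AProg.text_append]
    exact (hP h).append _

theorem AProg.recAt_zero_append {P Q : AProg Val Opr Var Lock Reg}
    {C C₁ C' : CompRec Val Opr Var Reg} (hP : P.recAt C₁ 0 = C') (hQ : Q.recAt C 0 = C₁) :
    AProg.recAt (P ++ Q) C 0 = C' := by
  cases P with
  | nil => exact hQ.trans hP
  | cons a P => exact hP

theorem embeds_of_isEval {A P B : AProg Val Opr Var Lock Reg} (h : ∀ x ∈ P, IsEval x.1.2) :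
    Embeds A.text P.text B.text := by
  intro x hx
  simp [jumps_eq_empty h] at hx

theorem exprSpec_of_compileExpr {T : Params Val Opr Var Lock Reg} {C C' : CompRec Val Opr Var Reg}
    {A : Set Reg} {l : Option Lab} {e : Exp Val Opr Var} {P : AProg Val Opr Var Lock Reg} {r : Reg}
    (h : compileExpr T C A l e = some (P, r, C')) : ExprSpec T C A l e P r C' := by
  induction e generalizing C A l P r C' with
  | const n =>
    simp only [compileExpr, Option.bind_eq_some_iff, Option.some.injEq, Prod.mk.injEq] at h
    obtain ⟨r', hr, rfl, rfl, rfl⟩ := h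
    exact .single (T.regAlloc_notMem _ _ _ hr) trivial (by simp [Exp.vars])
      (fun f pc regs mds m => rfl)
  | var v =>
    have hv := (compileExpr_vars h).2
    simp only [compileExpr] at h
    split_ifs at h
    split at h
    · rename_i r' hr
      cases h
      exact
        { asm := rfl
          notMem := T.regAllocCached_notMem _ _ _ _ hr
          keep := fun _ _ => rfl
          result := T.regAllocCached_eq _ _ _ _ hr
          isEval := by simp
          head := by simp
          labels := by simp [AProg.text, WR.labels]
          entry := rfl
          stable := fun hs => ⟨by simp, hs⟩
          sound := by simp }
    · simp only [Option.bind_eq_some_iff, Option.some.injEq, Prod.mk.injEq] at h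
      obtain ⟨r', hr, rfl, rfl, rfl⟩ := h
      exact .single (T.regAlloc_notMem _ _ _ hr) trivial hv (fun f pc regs mds m => rfl)
  | op o e₁ e₂ ih₁ ih₂ =>
    have hv := (compileExpr_vars h).2
    obtain ⟨P₁, r₁, C₁, P₂, r₂, C₂, h₁, h₂, rfl, rfl, rfl⟩ := compileExpr_op_inv h
    have h₁ := ih₁ h₁
    have h₂ := ih₂ h₂
    have hasm := h₂.asm.trans h₁.asm
    -- The left result survives the evaluation of the right operand because its register was
    -- reserved there.
    have hr₁ : C₂.1 r = some e₁ := (h₂.keep r (by simp)).trans h₁.result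
    exact
      { asm := hasm
        notMem := h₁.notMem
        keep := fun a ha => by
          have : a ≠ r := by rintro rfl; exact h₁.notMem ha
          simp only [upd_of_ne _ _ this]
          rw [h₂.keep a (.inl ha), h₁.keep a ha]
        result := upd_self _ _ _
        isEval := by
          intro x hx
          simp only [List.mem_append, List.mem_singleton] at hx
          rcases hx with (hx | hx) | rfl
          · exact h₁.isEval x hx
          · exact h₂.isEval x hx
          · trivial
        head := fun x hx _ => by
          rw [List.append_assoc]
          refine headLabel_text_append (h₁.head x hx) fun hP₁ => ?_
          refine headLabel_text_append (h₂.head x (by rw [if_pos hP₁, hx])) fun hP₂ => ?_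
          simp [AProg.text, headLabel_cons, hP₁, hP₂, hx]
        labels := fun x hx => by
          simp only [AProg.text_append, AProg.text_cons, AProg.text_nil, mem_labels_append,
            mem_labels_singleton] at hx
          rcases hx with (hx | hx) | hx
          · exact h₁.labels x hx
          · have := h₂.labels x hx
            split_ifs at this
            exact this
          · split_ifs at hx
            exact hx
        entry := by
          rw [List.append_assoc]
          exact AProg.recAt_zero_append h₁.entry (AProg.recAt_zero_append h₂.entry rfl)
        stable := fun hs => by
          have hs₁ := h₁.stable hs
          have hs₂ := h₂.stable hs₁.2
          refine ⟨?_, regrecStable_upd hs₂.2 _ _ (by rwa [hasm])⟩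
          intro x hx
          simp only [List.mem_append, List.mem_singleton] at hx
          rcases hx with (hx | hx) | rfl
          · exact hs₁.1 x hx
          · exact hs₂.1 x hx
          · exact hs₂.2
        sound := fun pc hpc => by
          simp only [List.length_append, List.length_singleton] at hpc
          rcases lt_or_ge pc P₁.length with hlt | hge
          · refine (h₁.sound pc hlt).embed (A := []) (Q := P₁) (embeds_of_isEval h₁.isEval)
              (B := P₂ ++ [((if P₁ ++ P₂ = [] then l else none, .op o r r₂), C₂)]) (by simp)
              (.of_eq ?_) hlt (by simp)
            exact AProg.recAt_zero_append h₂.entry rfl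
          rcases lt_or_ge pc (P₁.length + P₂.length) with hlt | hge'
          · exact (h₂.sound (pc - P₁.length) (by omega)).embed (A := P₁) (Q := P₂)
              (embeds_of_isEval h₂.isEval) rfl (.of_eq rfl) (by omega) (by omega)
          · obtain rfl : pc = (P₁ ++ P₂).length := by rw [List.length_append]; omega
            refine annSoundAt_of_exec (B := []) (by simp; exact ⟨⟨rfl, rfl⟩, rfl⟩) rfl
              fun regs mds m hc => ?_
            have hrec : AProg.recAt (P₁ ++ P₂ ++ [((if P₁ ++ P₂ = [] then l else none,
                Instr.op o r r₂), C₂)]) (upd C₂.1 r (some (.op o e₁ e₂)), C₂.2)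
                ((P₁ ++ P₂).length + 1) = (upd C₂.1 r (some (.op o e₁ e₂)), C₂.2) := by
              rw [AProg.recAt_append_right]
              rfl
            simp only [exec, hrec]
            refine ⟨regrecMemConsistent_upd hc.1 _ _ ?_, hc.2⟩
            rw [hc.1 _ _ hr₁, hc.1 _ _ h₂.result]
            rfl }

end Static

/-! ### The command compiler -/

section Static

variable {Val Opr Var Lock Reg : Type*} {T : Params Val Opr Var Lock Reg}
  {C C' C₁ C₂ C₃ : CompRec Val Opr Var Reg} {l l' l₁ l₂ : Option Lab} {nl nl' nl₁ nl₂ : Lab}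
  {c c₁ c₂ : Cmd Val Opr Var Lock} {e : Exp Val Opr Var} {v : Var} {r : Reg}
  {P Pe P₁ P₂ : AProg Val Opr Var Lock Reg}

/-- The evaluation of an expression, followed by an instruction that uses its value. -/
def exprThen (Pe : AProg Val Opr Var Lock Reg) (l : Option Lab) (i : Instr Val Opr Var Lock Reg)
    (C₁ : CompRec Val Opr Var Reg) : AProg Val Opr Var Lock Reg :=
  Pe ++ [((if Pe = [] then l else none, i), C₁)]

theorem compileCmd_seq_inv (h : compileCmd T C l nl (.seq c₁ c₂) = some (P, l', nl', C')) :
    ∃ P₁ l₁ nl₁ C₁ P₂, compileCmd T C l nl c₁ = some (P₁, l₁, nl₁, C₁) ∧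
      compileCmd T C₁ l₁ nl₁ c₂ = some (P₂, l', nl', C') ∧ P = P₁ ++ P₂ := by
  simp only [compileCmd, Option.bind_eq_some_iff] at h
  obtain ⟨⟨P₁, l₁, nl₁, C₁⟩, h₁, ⟨P₂, l₂, nl₂, C₂⟩, h₂, h⟩ := h
  cases h
  exact ⟨_, _, _, _, _, h₁, h₂, rfl⟩

theorem compileCmd_ite_inv (h : compileCmd T C l nl (.ite e c₁ c₂) = some (P, l', nl', C')) :
    ∃ Pe r C₁ P₁ l₁ nl₁ C₂ P₂ l₂ C₃, compileExpr T C ∅ l e = some (Pe, r, C₁) ∧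
      compileCmd T C₁ none (nl + 2) c₁ = some (P₁, l₁, nl₁, C₂) ∧
      compileCmd T C₁ (some nl) nl₁ c₂ = some (P₂, l₂, nl', C₃) := by
  simp only [compileCmd, Option.bind_eq_some_iff] at h
  obtain ⟨⟨Pe, r, C₁⟩, he, ⟨P₁, l₁, nl₁, C₂⟩, h₁, ⟨P₂, l₂, nl₂, C₃⟩, h₂, h⟩ := h
  cases h
  exact ⟨_, _, _, _, _, _, _, _, _, _, he, h₁, h₂⟩

theorem compileCmd_ite_eq (h : compileCmd T C l nl (.ite e c₁ c₂) = some (P, l', nl', C'))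
    (he : compileExpr T C ∅ l e = some (Pe, r, C₁))
    (h₁ : compileCmd T C₁ none (nl + 2) c₁ = some (P₁, l₁, nl₁, C₂))
    (h₂ : compileCmd T C₁ (some nl) nl₁ c₂ = some (P₂, l₂, nl₂, C₃)) :
    P = exprThen Pe l (.jz nl r) C₁ ++ P₁ ++ [((l₁, .jmp (nl + 1)), C₂)] ++ P₂ ++
      [((l₂, .epi), C₃)] ∧ l' = some (nl + 1) ∧ nl' = nl₂ ∧ C' = (meet C₂.1 C₃.1, C₂.2) := by
  simp only [compileCmd, he, h₁, h₂, Option.bind_some, Option.some.injEq, Prod.mk.injEq] at h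
  obtain ⟨rfl, rfl, rfl, rfl⟩ := h
  exact ⟨rfl, rfl, rfl, rfl⟩

theorem compileCmd_while_inv (h : compileCmd T C l nl (.while e c) = some (P, l', nl', C')) :
    ∃ Pe r C₁ P₁ l₁ C₂,
      compileExpr T (fun _ => none, C.2) ∅ (some (loopLabel l nl).1) e = some (Pe, r, C₁) ∧
      compileCmd T C₁ none ((loopLabel l nl).2 + 1) c = some (P₁, l₁, nl', C₂) := by
  simp only [compileCmd, Option.bind_eq_some_iff] at h
  obtain ⟨⟨Pe, r, C₁⟩, he, ⟨P₁, l₁, nl₁, C₂⟩, h₁, h⟩ := h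
  cases h
  exact ⟨_, _, _, _, _, _, he, h₁⟩

theorem compileCmd_while_eq (h : compileCmd T C l nl (.while e c) = some (P, l', nl', C'))
    (he : compileExpr T (fun _ => none, C.2) ∅ (some (loopLabel l nl).1) e = some (Pe, r, C₁))
    (h₁ : compileCmd T C₁ none ((loopLabel l nl).2 + 1) c = some (P₁, l₁, nl₁, C₂)) :
    P = exprThen Pe (some (loopLabel l nl).1) (.jz (loopLabel l nl).2 r) C₁ ++ P₁ ++
      [((l₁, .jmp (loopLabel l nl).1), C₂)] ∧ l' = some (loopLabel l nl).2 ∧ nl' = nl₁ ∧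
      C' = C₁ := by
  simp only [compileCmd, he, h₁, Option.bind_some, Option.some.injEq, Prod.mk.injEq] at h
  obtain ⟨rfl, rfl, rfl, rfl⟩ := h
  exact ⟨rfl, rfl, rfl, rfl⟩

theorem compileCmd_assign_inv (h : compileCmd T C l nl (.assign v e) = some (P, l', nl', C')) :
    ∃ Pe r C₁, compileExpr T C ∅ l e = some (Pe, r, C₁) := by
  simp only [compileCmd, Option.ite_none_right_eq_some, Option.bind_eq_some_iff] at h
  obtain ⟨-, ⟨Pe, r, C₁⟩, he, -⟩ := h
  exact ⟨_, _, _, he⟩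

theorem compileCmd_assign_eq (h : compileCmd T C l nl (.assign v e) = some (P, l', nl', C'))
    (he : compileExpr T C ∅ l e = some (Pe, r, C₁)) :
    P = exprThen Pe l (.store v r) C₁ ∧ l' = none ∧ nl' = nl ∧ C' = (purge C₁.1 {v}, C₁.2) := by
  simp only [compileCmd, he, Option.bind_some, Option.ite_none_right_eq_some, Option.some.injEq,
    Prod.mk.injEq] at h
  obtain ⟨-, rfl, rfl, rfl, rfl⟩ := h
  exact ⟨rfl, rfl, rfl, rfl⟩

theorem length_exprThen {i : Instr Val Opr Var Lock Reg} :
    (exprThen Pe l i C₁).length = Pe.length + 1 := by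
  simp [exprThen]

theorem exprThen_ne_nil {i : Instr Val Opr Var Lock Reg} : exprThen Pe l i C₁ ≠ [] := by
  simp [exprThen]

section ExprThen

variable {S : CompRec Val Opr Var Reg} {A : Set Reg} {i : Instr Val Opr Var Lock Reg}

theorem ExprSpec.headLabel_exprThen (h : ExprSpec T S A l e Pe r C₁) {x : Lab} (hx : l = some x) :
    HeadLabel (exprThen Pe l i C₁).text x :=
  headLabel_text_append (h.head x hx) fun hP => by simp [AProg.text, headLabel_cons, hP, hx]

theorem ExprSpec.labels_exprThen (h : ExprSpec T S A l e Pe r C₁) {x : Lab}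
    (hx : x ∈ WR.labels (exprThen Pe l i C₁).text) : l = some x := by
  simp only [exprThen, AProg.text_append, AProg.text_cons, AProg.text_nil, mem_labels_append,
    mem_labels_singleton] at hx
  rcases hx with hx | hx
  · exact h.labels x hx
  · split_ifs at hx
    exact hx

theorem ExprSpec.jumps_exprThen (h : ExprSpec T S A l e Pe r C₁) {x : Lab} :
    x ∈ jumps (exprThen Pe l i C₁).text ↔ i = .jmp x ∨ ∃ r, i = .jz x r := by
  simp only [exprThen, AProg.text_append, AProg.text_cons, AProg.text_nil, mem_jumps_append,
    mem_jumps_singleton, jumps_eq_empty h.isEval, Set.mem_empty_iff_false, false_or]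

theorem ExprSpec.recAt_exprThen_zero (h : ExprSpec T S A l e Pe r C₁)
    (Q : AProg Val Opr Var Lock Reg) (C' : CompRec Val Opr Var Reg) :
    AProg.recAt (exprThen Pe l i C₁ ++ Q) C' 0 = S := by
  rw [exprThen, List.append_assoc]
  exact AProg.recAt_zero_append h.entry rfl

theorem ExprSpec.stable_exprThen (h : ExprSpec T S A l e Pe r C₁) (hs : regrecStable T S) :
    ∀ x ∈ exprThen Pe l i C₁, regrecStable T x.2 := by
  intro x hx
  simp only [exprThen, List.mem_append, List.mem_singleton] at hx
  rcases hx with hx | rfl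
  · exact (h.stable hs).1 x hx
  · exact (h.stable hs).2

theorem ExprSpec.annSoundAt_exprThen (h : ExprSpec T S A l e Pe r C₁)
    (Q : AProg Val Opr Var Lock Reg) (C' : CompRec Val Opr Var Reg) {pc : ℕ}
    (hpc : pc < Pe.length) : AnnSoundAt T (exprThen Pe l i C₁ ++ Q) C' pc :=
  (h.sound pc hpc).embed (A := []) (Q := Pe) (B := [((if Pe = [] then l else none, i), C₁)] ++ Q)
    (embeds_of_isEval h.isEval) (by simp [exprThen]) (.of_eq rfl) hpc (by simp)

end ExprThen

theorem exprThen_head {i : Instr Val Opr Var Lock Reg} {Q : AProg Val Opr Var Lock Reg}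
    (h : ∀ x ∈ Pe, IsEval x.1.2) (hi : i ≠ .epi) (hj : ∀ x, i ≠ .jmp x)
    {a : LInstr Val Opr Var Lock Reg}
    (ha : (AProg.text (exprThen Pe l i C₁ ++ Q))[0]? = some a) :
    a.2 ≠ .epi ∧ ∀ x, a.2 ≠ .jmp x := by
  cases Pe with
  | nil =>
    simp only [exprThen, AProg.text, List.nil_append, List.cons_append, List.map_cons,
      List.getElem?_cons_zero, Option.some.injEq] at ha
    subst ha
    exact ⟨hi, hj⟩
  | cons b Pe =>
    simp only [exprThen, AProg.text, List.cons_append, List.map_cons,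
      List.getElem?_cons_zero, Option.some.injEq] at ha
    subst ha
    have := h b (by simp)
    constructor
    · intro hb
      simp [hb, IsEval] at this
    · intro x hb
      simp [hb, IsEval] at this

/-- The head of a compiled command: it carries the entry label, and it is no epilogue step. -/
theorem compileCmd_head (h : compileCmd T C l nl c = some (P, l', nl', C')) :
    P ≠ [] ∧ (∀ x, l = some x → HeadLabel P.text x) ∧
      (∀ a, P.text[0]? = some a → a.2 ≠ .epi ∧ ∀ x, a.2 ≠ .jmp x) ∧
      RecLe (P.recAt C' 0) C := by
  induction c generalizing C l nl P l' nl' C' with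
  | stopped => simp [compileCmd] at h
  | skip =>
    cases h
    simp [AProg.text, headLabel_cons, AProg.recAt, RecLe.refl]
  | lockAcq k =>
    cases h
    simp [AProg.text, headLabel_cons, AProg.recAt, RecLe.refl]
  | lockRel k =>
    cases h
    simp [AProg.text, headLabel_cons, AProg.recAt, RecLe.refl]
  | seq c₁ c₂ ih₁ ih₂ =>
    obtain ⟨P₁, l₁, nl₁, C₁, P₂, h₁, h₂, rfl⟩ := compileCmd_seq_inv h
    obtain ⟨hn, hl, hi, hr⟩ := ih₁ h₁
    have hlen : 0 < P₁.length := List.length_pos_iff.2 hn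
    refine ⟨by simp [hn], fun x hx => ?_, fun a ha => ?_, ?_⟩
    · rw [AProg.text_append]
      exact (hl x hx).append _
    · rw [AProg.text_append, List.getElem?_append_left (by rwa [AProg.length_text])] at ha
      exact hi a ha
    · rwa [AProg.recAt_append_left hlen P₂ _ C₁]
  | assign v e =>
    obtain ⟨Pe, r, C₁, he⟩ := compileCmd_assign_inv h
    obtain ⟨rfl, -, -, -⟩ := compileCmd_assign_eq h he
    have he := exprSpec_of_compileExpr he
    refine ⟨exprThen_ne_nil, fun x hx => he.headLabel_exprThen hx, fun a ha => ?_, ?_⟩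
    · exact exprThen_head he.isEval (i := .store v r) (Q := []) (by simp) (by simp)
        (by simpa using ha)
    · exact .of_eq (by simpa using he.recAt_exprThen_zero (i := .store v r) [] C')
  | ite e c₁ c₂ ih₁ ih₂ =>
    obtain ⟨Pe, r, C₁, P₁, l₁, nl₁, C₂, P₂, l₂, C₃, he, h₁, h₂⟩ := compileCmd_ite_inv h
    obtain ⟨rfl, -, -, -⟩ := compileCmd_ite_eq h he h₁ h₂
    have he := exprSpec_of_compileExpr he
    simp only [List.append_assoc]
    refine ⟨by simp [exprThen_ne_nil], fun x hx => ?_, fun a ha => ?_, ?_⟩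
    · rw [AProg.text_append]
      exact (he.headLabel_exprThen hx).append _
    · exact exprThen_head he.isEval (by simp) (by simp) ha
    · exact .of_eq (he.recAt_exprThen_zero _ _)
  | _ e c ih =>
    obtain ⟨Pe, r, C₁, P₁, l₁, C₂, he, h₁⟩ := compileCmd_while_inv h
    obtain ⟨rfl, -, -, -⟩ := compileCmd_while_eq h he h₁
    have he := exprSpec_of_compileExpr he
    simp only [List.append_assoc]
    refine ⟨by simp [exprThen_ne_nil], fun x hx => ?_, fun a ha => ?_, ?_⟩
    · rw [AProg.text_append]
      refine (he.headLabel_exprThen ?_).append _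
      rw [hx]
      rfl
    · exact exprThen_head he.isEval (by simp) (by simp) ha
    -- A loop starts from the empty register record, and only here is the first annotation smaller
    -- than the initial record.
    · rw [he.recAt_exprThen_zero]
      exact recLe_empty rfl

end Static

section Static

variable {Val Opr Var Lock Reg : Type*} {T : Params Val Opr Var Lock Reg}
  {C C' C₁ C₂ C₃ : CompRec Val Opr Var Reg} {l l' l₁ l₂ : Option Lab} {nl nl' nl₁ nl₂ : Lab}
  {c c₁ c₂ : Cmd Val Opr Var Lock} {e : Exp Val Opr Var} {v : Var} {r : Reg}
  {P Pe P₁ P₂ : AProg Val Opr Var Lock Reg}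

/-! ### Labels of compiled commands -/

/-- The freshness invariant, in a form that composes. New labels come from the interval `[nl, nl')`,
the exit label comes from it too but is not placed inside `P`, and a jump that leaves `P` goes to
the exit label. -/
structure LabelSpec (P : Prog Val Opr Var Lock Reg) (l : Option Lab) (nl : Lab) (l' : Option Lab)
    (nl' : Lab) : Prop where
  mono : nl ≤ nl'
  labels : ∀ x ∈ labels P, l = some x ∨ nl ≤ x ∧ x < nl'
  exit : ∀ x, l' = some x → nl ≤ x ∧ x < nl' ∧ x ∉ WR.labels P
  jumps : ∀ x ∈ jumps P, x ∈ WR.labels P ∨ l' = some x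

theorem LabelSpec.single {i : Instr Val Opr Var Lock Reg} (hi : WR.jumps [(l, i)] = ∅) :
    LabelSpec [(l, i)] l nl none nl where
  mono := le_rfl
  labels x hx := .inl (mem_labels_singleton.1 hx)
  exit := by simp
  jumps := by simp [hi]

theorem le_loopLabel (l : Option Lab) (nl : Lab) : nl ≤ (loopLabel l nl).2 := by
  cases l <;> simp [loopLabel]

theorem loopLabel_fst_lt (hl : ∀ x, l = some x → x < nl) :
    (loopLabel l nl).1 < (loopLabel l nl).2 := by
  cases l <;> simp_all [loopLabel]

theorem loopLabel_fst (l : Option Lab) (nl : Lab) :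
    l = some (loopLabel l nl).1 ∨ nl ≤ (loopLabel l nl).1 := by
  cases l <;> simp [loopLabel]

theorem labelSpec_of_compileCmd (h : compileCmd T C l nl c = some (P, l', nl', C'))
    (hl : ∀ x, l = some x → x < nl) : LabelSpec P.text l nl l' nl' := by
  induction c generalizing C l nl P l' nl' C' with
  | stopped => simp [compileCmd] at h
  | skip =>
    cases h
    exact .single (by simp [jumps])
  | lockAcq k =>
    cases h
    exact .single (by simp [jumps])
  | lockRel k =>
    cases h
    exact .single (by simp [jumps])
  | seq c₁ c₂ ih₁ ih₂ =>
    obtain ⟨P₁, l₁, nl₁, C₁, P₂, h₁, h₂, rfl⟩ := compileCmd_seq_inv h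
    have s₁ := ih₁ h₁ hl
    have s₂ := ih₂ h₂ fun x hx => (s₁.exit x hx).2.1
    have hhead := (compileCmd_head h₂).2.1
    have m₁ := s₁.mono
    have m₂ := s₂.mono
    constructor
    · lia
    · intro x hx
      rw [AProg.text_append, mem_labels_append] at hx
      rcases hx with hx | hx
      · rcases s₁.labels x hx with h | h
        · exact .inl h
        · right; lia
      · rcases s₂.labels x hx with h | h
        · have := s₁.exit x h
          right; lia
        · right; lia
    · intro x hx
      have hx' := s₂.exit x hx
      refine ⟨by lia, by lia, ?_⟩
      rw [AProg.text_append, mem_labels_append]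
      rintro (hx₁ | hx₁)
      · rcases s₁.labels x hx₁ with h | h
        · have := hl x h
          lia
        · lia
      · exact hx'.2.2 hx₁
    · intro x hx
      rw [AProg.text_append, mem_jumps_append] at hx
      rw [AProg.text_append, mem_labels_append]
      rcases hx with hx | hx
      · rcases s₁.jumps x hx with h | h
        · exact .inl (.inl h)
        -- The exit label of the first part is the entry label of the second, so jumps out of the
        -- first part land on the head of the second.
        · exact .inl (.inr (hhead x h).mem_labels)
      · rcases s₂.jumps x hx with h | h
        · exact .inl (.inr h)
        · exact .inr h
  | assign v e =>
    obtain ⟨Pe, r, C₁, he⟩ := compileCmd_assign_inv h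
    obtain ⟨rfl, rfl, rfl, -⟩ := compileCmd_assign_eq h he
    have he := exprSpec_of_compileExpr he
    exact ⟨le_rfl, fun x hx => .inl (he.labels_exprThen hx), by simp, fun x hx => by
      simpa using he.jumps_exprThen.1 hx⟩
  | ite e c₁ c₂ ih₁ ih₂ =>
    obtain ⟨Pe, r, C₁, P₁, l₁, nl₁, C₂, P₂, l₂, C₃, he, h₁, h₂⟩ := compileCmd_ite_inv h
    obtain ⟨rfl, rfl, -, -⟩ := compileCmd_ite_eq h he h₁ h₂
    have he := exprSpec_of_compileExpr he
    have s₁ := ih₁ h₁ (by simp)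
    have m₁ := s₁.mono
    have s₂ := ih₂ h₂ (by rintro x ⟨⟩; lia)
    have m₂ := s₂.mono
    have hhead := (compileCmd_head h₂).2.1 nl rfl
    -- The labels `nl` (second branch) and `nl + 1` (exit) are reserved before the first branch is
    -- compiled from `nl + 2` on. The exit label occurs on no instruction, which is recorded
    -- together with the bounds.
    have hlab : ∀ x ∈ labels (AProg.text (exprThen Pe l (.jz nl r) C₁ ++ P₁ ++
        [((l₁, .jmp (nl + 1)), C₂)] ++ P₂ ++ [((l₂, .epi), C₃)])),
        l = some x ∨ nl ≤ x ∧ x < nl' ∧ x ≠ nl + 1 := by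
      intro x hx
      simp only [AProg.text_append, AProg.text_cons, AProg.text_nil, mem_labels_append,
        mem_labels_singleton] at hx
      rcases hx with (((hx | hx) | hx) | hx) | hx
      · exact .inl (he.labels_exprThen hx)
      · rcases s₁.labels x hx with h | h
        · simp at h
        · right; lia
      · have := s₁.exit x hx
        right; lia
      · rcases s₂.labels x hx with h | h
        · cases h
          right; lia
        · right; lia
      · have := s₂.exit x hx
        right; lia
    refine ⟨by lia, fun x hx => (hlab x hx).imp_right fun h => ⟨h.1, h.2.1⟩, ?_, ?_⟩
    · rintro x ⟨⟩
      refine ⟨by lia, by lia, fun hx => ?_⟩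
      rcases hlab _ hx with h | h
      · have := hl _ h
        lia
      · lia
    · intro x hx
      simp only [AProg.text_append, AProg.text_cons, AProg.text_nil, mem_labels_append,
        mem_labels_singleton, mem_jumps_append, mem_jumps_singleton, he.jumps_exprThen] at hx ⊢
      rcases hx with (((hx | hx) | hx) | hx) | hx
      · obtain rfl : nl = x := by simpa using hx
        exact .inl (.inl (.inr hhead.mem_labels))
      · rcases s₁.jumps x hx with h | h
        · exact .inl (.inl (.inl (.inl (.inr h))))
        · exact .inl (.inl (.inl (.inr h)))
      · right
        simpa using hx
      · rcases s₂.jumps x hx with h | h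
        · exact .inl (.inl (.inr h))
        · exact .inl (.inr h)
      · simp at hx
  | _ e c ih =>
    obtain ⟨Pe, r, C₁, P₁, l₁, C₂, he, h₁⟩ := compileCmd_while_inv h
    obtain ⟨rfl, rfl, -, -⟩ := compileCmd_while_eq h he h₁
    have he := exprSpec_of_compileExpr he
    have s₁ := ih h₁ (by simp)
    have m₁ := s₁.mono
    have hle := le_loopLabel l nl
    have hlt := loopLabel_fst_lt hl
    have hlp := loopLabel_fst l nl
    have hlab : ∀ x ∈ labels (AProg.text (exprThen Pe (some (loopLabel l nl).1)
        (.jz (loopLabel l nl).2 r) C₁ ++ P₁ ++ [((l₁, .jmp (loopLabel l nl).1), C₂)])),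
        (l = some x ∨ nl ≤ x ∧ x < nl') ∧ x ≠ (loopLabel l nl).2 := by
      intro x hx
      simp only [AProg.text_append, AProg.text_cons, AProg.text_nil, mem_labels_append,
        mem_labels_singleton] at hx
      rcases hx with (hx | hx) | hx
      · cases he.labels_exprThen hx
        exact ⟨hlp.imp_right fun h => ⟨h, by lia⟩, by lia⟩
      · rcases s₁.labels x hx with h | h
        · simp at h
        · exact ⟨.inr (by lia), by lia⟩
      · have := s₁.exit x hx
        exact ⟨.inr (by lia), by lia⟩
    refine ⟨by lia, fun x hx => (hlab x hx).1, ?_, ?_⟩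
    · rintro x ⟨⟩
      exact ⟨by lia, by lia, fun hx => (hlab _ hx).2 rfl⟩
    · intro x hx
      simp only [AProg.text_append, AProg.text_cons, AProg.text_nil, mem_labels_append,
        mem_labels_singleton, mem_jumps_append, mem_jumps_singleton, he.jumps_exprThen] at hx ⊢
      rcases hx with (hx | hx) | hx
      · right
        simpa using hx
      · rcases s₁.jumps x hx with h | h
        · exact .inl (.inl (.inr h))
        · exact .inl (.inr h)
      · obtain rfl : (loopLabel l nl).1 = x := by simpa using hx
        exact .inl (.inl (.inl (he.headLabel_exprThen rfl).mem_labels))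

/-- Jumps of the second part go to its entry label `l₁` or to labels from `nl₁` on. Labels of the
first part are below `nl₁` and differ from its exit label `l₁`. -/
theorem joinable_of_compileCmd (h₁ : compileCmd T C l nl c₁ = some (P₁, l₁, nl₁, C₁))
    (h₂ : compileCmd T C₁ l₁ nl₁ c₂ = some (P₂, l₂, nl₂, C₂)) (hl : ∀ x, l = some x → x < nl) :
    joinable P₁.text P₂.text := by
  have s₁ := labelSpec_of_compileCmd h₁ hl
  have s₂ := labelSpec_of_compileCmd h₂ fun x hx => (s₁.exit x hx).2.1
  have m₁ := s₁.mono
  refine ⟨fun x hx => (s₁.jumps x hx).imp_right ((compileCmd_head h₂).2.1 x), fun x hx hx₁ => ?_⟩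
  have hx₂ : l₁ = some x ∨ nl₁ ≤ x := by
    rcases s₂.jumps x hx with h | h
    · exact (s₂.labels x h).imp_right And.left
    · exact .inr (s₂.exit x h).1
  rcases hx₂ with h | h
  · exact (s₁.exit x h).2.2 hx₁
  · rcases s₁.labels x hx₁ with h' | h'
    · have := hl x h'
      lia
    · lia

/-- Labels in front of the first branch are below `nl`, jumps of the branch go to `nl + 2` or
beyond, and its exit label sits on the `jmp` that follows. The surrounding instructions are
arbitrary because only their labels matter. -/
theorem embeds_ite_fst (he : compileExpr T C ∅ l e = some (Pe, r, C₁))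
    (h₁ : compileCmd T C₁ none (nl + 2) c₁ = some (P₁, l₁, nl₁, C₂))
    (hl : ∀ x, l = some x → x < nl) (i j : Instr Val Opr Var Lock Reg)
    (Q : AProg Val Opr Var Lock Reg) :
    Embeds (exprThen Pe l i C₁).text P₁.text (AProg.text ([((l₁, j), C₂)] ++ Q)) := by
  have he := exprSpec_of_compileExpr he
  have s₁ := labelSpec_of_compileCmd h₁ (by simp)
  intro x hx
  have hx' := s₁.jumps x hx
  refine ⟨fun hx₀ => ?_, hx'.imp_right fun h => .inr ?_⟩
  · have := hl x (he.labels_exprThen hx₀)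
    rcases hx' with h | h
    · rcases s₁.labels x h with h | h
      · simp at h
      · lia
    · have := s₁.exit x h
      lia
  · rw [AProg.text_append]
    exact headLabel_cons.2 h

/-- Jumps of the second branch go to `nl` or to labels from `nl₁` on. Labels in front of it are
either below `nl` or lie between `nl + 2` and `nl₁`. -/
theorem embeds_ite_snd (he : compileExpr T C ∅ l e = some (Pe, r, C₁))
    (h₁ : compileCmd T C₁ none (nl + 2) c₁ = some (P₁, l₁, nl₁, C₂))
    (h₂ : compileCmd T C₁ (some nl) nl₁ c₂ = some (P₂, l₂, nl₂, C₃))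
    (hl : ∀ x, l = some x → x < nl) (i j k : Instr Val Opr Var Lock Reg) :
    Embeds (AProg.text (exprThen Pe l i C₁ ++ P₁ ++ [((l₁, j), C₂)])) P₂.text
      (AProg.text [((l₂, k), C₃)]) := by
  have he := exprSpec_of_compileExpr he
  have s₁ := labelSpec_of_compileCmd h₁ (by simp)
  have m₁ := s₁.mono
  have s₂ := labelSpec_of_compileCmd h₂ (by rintro x ⟨⟩; lia)
  intro x hx
  have hx' := s₂.jumps x hx
  refine ⟨fun hx₀ => ?_, hx'.imp_right fun h => .inr (headLabel_cons.2 h)⟩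
  have hx₂ : nl = x ∨ nl₁ ≤ x := by
    rcases hx' with h | h
    · rcases s₂.labels x h with h | h
      · simpa using Or.inl h
      · exact .inr h.1
    · exact .inr (s₂.exit x h).1
  simp only [AProg.text_append, AProg.text_cons, AProg.text_nil, mem_labels_append,
    mem_labels_singleton] at hx₀
  rcases hx₀ with (hx₀ | hx₀) | hx₀
  · have := hl x (he.labels_exprThen hx₀)
    lia
  · rcases s₁.labels x hx₀ with h | h
    · simp at h
    · lia
  · have := s₁.exit x hx₀
    lia

/-- The conditional jump of a conditional leads to the second branch. -/
theorem resolve_ite_snd (he : compileExpr T C ∅ l e = some (Pe, r, C₁))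
    (h₁ : compileCmd T C₁ none (nl + 2) c₁ = some (P₁, l₁, nl₁, C₂))
    (h₂ : compileCmd T C₁ (some nl) nl₁ c₂ = some (P₂, l₂, nl₂, C₃))
    (hl : ∀ x, l = some x → x < nl) (i j : Instr Val Opr Var Lock Reg)
    (Q : AProg Val Opr Var Lock Reg) :
    resolve (AProg.text (exprThen Pe l i C₁ ++ P₁ ++ [((l₁, j), C₂)] ++ P₂ ++ Q)) nl =
      Pe.length + 1 + P₁.length + 1 := by
  have he := exprSpec_of_compileExpr he
  have s₁ := labelSpec_of_compileCmd h₁ (by simp)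
  have hn : nl ∉ labels (AProg.text (exprThen Pe l i C₁ ++ P₁ ++ [((l₁, j), C₂)])) := by
    simp only [AProg.text_append, AProg.text_cons, AProg.text_nil, mem_labels_append,
      mem_labels_singleton, not_or]
    refine ⟨⟨fun h => ?_, fun h => ?_⟩, fun h => ?_⟩
    · exact lt_irrefl _ (hl _ (he.labels_exprThen h))
    · rcases s₁.labels _ h with h | h
      · simp at h
      · lia
    · have := s₁.exit _ h
      lia
  rw [List.append_assoc _ P₂ Q, AProg.text_append, resolve_append_of_notMem hn,
    AProg.text_append P₂, (((compileCmd_head h₂).2.1 nl rfl).append _).resolve_eq_zero,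
    AProg.length_text]
  simp only [List.length_append, length_exprThen, List.length_singleton, add_zero]

/-- The only label in front of the body is that of the loop head, which is smaller than every label
to which the body jumps. Hence the body never jumps back to the head by itself. -/
theorem embeds_while
    (he : compileExpr T (fun _ => none, C.2) ∅ (some (loopLabel l nl).1) e = some (Pe, r, C₁))
    (h₁ : compileCmd T C₁ none ((loopLabel l nl).2 + 1) c = some (P₁, l₁, nl₁, C₂))
    (hl : ∀ x, l = some x → x < nl) (i j : Instr Val Opr Var Lock Reg) :
    Embeds (exprThen Pe (some (loopLabel l nl).1) i C₁).text P₁.text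
      (AProg.text [((l₁, j), C₂)]) := by
  have he := exprSpec_of_compileExpr he
  have s₁ := labelSpec_of_compileCmd h₁ (by simp)
  have hlt := loopLabel_fst_lt hl
  intro x hx
  have hx' := s₁.jumps x hx
  refine ⟨fun hx₀ => ?_, hx'.imp_right fun h => .inr (headLabel_cons.2 h)⟩
  cases he.labels_exprThen hx₀
  rcases hx' with h | h
  · rcases s₁.labels _ h with h | h
    · simp at h
    · lia
  · have := s₁.exit _ h
    lia

/-- Exit labels lead to the end of the program. -/
theorem resolve_exit (h : compileCmd T C l nl c = some (P, some nl₁, nl', C'))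
    (hl : ∀ x, l = some x → x < nl) : resolve P.text nl₁ = P.length := by
  rw [resolve_of_notMem ((labelSpec_of_compileCmd h hl).exit _ rfl).2.2, AProg.length_text]

/-! ### Assumption records and stability of annotations -/

/-- Connects the compiler with the static check: both track assumptions in the same way, so the
equations that the check demands of branches and loop bodies become equations between records. -/
theorem asm_compileCmd (h : compileCmd T C l nl c = some (P, l', nl', C')) :
    C'.2 = asmAfter T c C.2 := by
  induction c generalizing C l nl P l' nl' C' with
  | stopped => simp [compileCmd] at h
  | skip => cases h; rfl
  | lockAcq k => cases h; rfl
  | lockRel k => cases h; rfl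
  | seq c₁ c₂ ih₁ ih₂ =>
    obtain ⟨P₁, l₁, nl₁, C₁, P₂, h₁, h₂, rfl⟩ := compileCmd_seq_inv h
    rw [ih₂ h₂, ih₁ h₁]
    rfl
  | assign v e =>
    obtain ⟨Pe, r, C₁, he⟩ := compileCmd_assign_inv h
    obtain ⟨-, -, -, rfl⟩ := compileCmd_assign_eq h he
    exact (compileExpr_vars he).1
  | ite e c₁ c₂ ih₁ ih₂ =>
    obtain ⟨Pe, r, C₁, P₁, l₁, nl₁, C₂, P₂, l₂, C₃, he, h₁, h₂⟩ := compileCmd_ite_inv h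
    obtain ⟨-, -, -, rfl⟩ := compileCmd_ite_eq h he h₁ h₂
    show C₂.2 = _
    rw [ih₁ h₁, (compileExpr_vars he).1]
    rfl
  | _ e c ih =>
    obtain ⟨Pe, r, C₁, P₁, l₁, C₂, he, h₁⟩ := compileCmd_while_inv h
    obtain ⟨-, -, -, rfl⟩ := compileCmd_while_eq h he h₁
    exact (compileExpr_vars he).1

theorem varStable.mono {S S' : AsmRec Var} {w : Var} (h : varStable T S w)
    (hS : S.1 ∪ S.2 ⊆ S'.1 ∪ S'.2) : varStable T S' w :=
  ⟨hS h.1, fun y hy => (h.2 y hy).imp fun _ hu => ⟨hS hu.1, hu.2⟩⟩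

theorem purge_eq_some {Φ : RegRec Val Opr Var Reg} {bad : Set Var} {r : Reg}
    {e : Exp Val Opr Var} (h : purge Φ bad r = some e) : Φ r = some e ∧ Disjoint e.vars bad := by
  simp only [purge, Option.bind_eq_some_iff, Option.ite_none_right_eq_some,
    Option.some.injEq] at h
  obtain ⟨e', h, hd, rfl⟩ := h
  exact ⟨h, hd⟩

/-- Acquiring a lock only enlarges the set of stable variables. Releasing one may shrink it, and the
purge removes precisely the entries that mention a variable which is no longer stable. -/
theorem stable_compileCmd (h : compileCmd T C l nl c = some (P, l', nl', C'))
    (hs : regrecStable T C) : (∀ x ∈ P, regrecStable T x.2) ∧ regrecStable T C' := by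
  induction c generalizing C l nl P l' nl' C' with
  | stopped => simp [compileCmd] at h
  | skip =>
    cases h
    simpa using hs
  | lockAcq k =>
    cases h
    refine ⟨by simpa using hs, fun r e hr v hv => (hs r e hr v hv).mono ?_⟩
    simp only [asmAcq]
    exact Set.union_subset_union Set.subset_union_left Set.subset_union_left
  | lockRel k =>
    cases h
    refine ⟨by simpa using hs, fun r e hr v hv => ?_⟩
    by_contra hv'
    exact Set.disjoint_left.1 (purge_eq_some hr).2 hv hv'
  | seq c₁ c₂ ih₁ ih₂ =>
    obtain ⟨P₁, l₁, nl₁, C₁, P₂, h₁, h₂, rfl⟩ := compileCmd_seq_inv h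
    have s₁ := ih₁ h₁ hs
    have s₂ := ih₂ h₂ s₁.2
    refine ⟨fun x hx => ?_, s₂.2⟩
    rcases List.mem_append.1 hx with hx | hx
    · exact s₁.1 x hx
    · exact s₂.1 x hx
  | assign v e =>
    obtain ⟨Pe, r, C₁, he⟩ := compileCmd_assign_inv h
    obtain ⟨rfl, -, -, rfl⟩ := compileCmd_assign_eq h he
    have he := exprSpec_of_compileExpr he
    exact ⟨he.stable_exprThen hs, fun r e hr v hv =>
      (he.stable hs).2 r e (purge_eq_some hr).1 v hv⟩
  | ite e c₁ c₂ ih₁ ih₂ =>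
    obtain ⟨Pe, r, C₁, P₁, l₁, nl₁, C₂, P₂, l₂, C₃, he, h₁, h₂⟩ := compileCmd_ite_inv h
    obtain ⟨rfl, -, -, rfl⟩ := compileCmd_ite_eq h he h₁ h₂
    have he := exprSpec_of_compileExpr he
    have s₁ := ih₁ h₁ (he.stable hs).2
    have s₂ := ih₂ h₂ (he.stable hs).2
    refine ⟨fun x hx => ?_, recLe_meet_left.stable s₁.2⟩
    simp only [List.mem_append, List.mem_singleton] at hx
    rcases hx with (((hx | hx) | rfl) | hx) | rfl
    · exact he.stable_exprThen hs x hx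
    · exact s₁.1 x hx
    · exact s₁.2
    · exact s₂.1 x hx
    · exact s₂.2
  | _ e c ih =>
    obtain ⟨Pe, r, C₁, P₁, l₁, C₂, he, h₁⟩ := compileCmd_while_inv h
    obtain ⟨rfl, -, -, rfl⟩ := compileCmd_while_eq h he h₁
    have he := exprSpec_of_compileExpr he
    have hs' : regrecStable T ((fun _ => none, C.2) : CompRec Val Opr Var Reg) :=
      (recLe_empty rfl).stable hs
    have s₁ := ih h₁ (he.stable hs').2
    refine ⟨fun x hx => ?_, (he.stable hs').2⟩
    simp only [List.mem_append, List.mem_singleton] at hx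
    rcases hx with (hx | hx) | rfl
    · exact he.stable_exprThen hs' x hx
    · exact s₁.1 x hx
    · exact s₁.2

theorem stable_recAt (h : compileCmd T C l nl c = some (P, l', nl', C'))
    (hs : regrecStable T C) (pc : ℕ) : regrecStable T (P.recAt C' pc) :=
  AProg.recAt_mem (stable_compileCmd h hs).1 (stable_compileCmd h hs).2 pc

/-! ### Soundness of annotations -/

theorem evExp_upd_lock (m : Mem Val Var Lock) (k : Lock) (n : Val) (e : Exp Val Opr Var) :
    evExp T (upd m (.lock k) n) e = evExp T m e := by
  induction e with
  | const => rfl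
  | var v => simp [evExp, upd]
  | op o e₁ e₂ ih₁ ih₂ => simp only [evExp, ih₁, ih₂]

theorem evExp_congr {m m' : Mem Val Var Lock} {e : Exp Val Opr Var}
    (h : ∀ v ∈ e.vars, m (.var v) = m' (.var v)) : evExp T m e = evExp T m' e := by
  induction e with
  | const => rfl
  | var v => exact h v rfl
  | op o e₁ e₂ ih₁ ih₂ =>
    simp only [evExp, ih₁ fun v hv => h v (.inl hv), ih₂ fun v hv => h v (.inr hv)]

theorem regrecMemConsistent_store {Φ : RegRec Val Opr Var Reg} {regs : Reg → Val}
    {m : Mem Val Var Lock} (h : regrecMemConsistent T Φ regs m) (v : Var) (n : Val) :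
    regrecMemConsistent T (purge Φ {v}) regs (upd m (.var v) n) := by
  intro r e hr
  obtain ⟨hr, hd⟩ := purge_eq_some hr
  rw [h r e hr]
  refine evExp_congr fun w hw => ?_
  have : w ≠ v := by
    rintro rfl
    exact Set.disjoint_left.1 hd hw rfl
  rw [upd_of_ne _ _ (by simpa using this)]

theorem asmrecMdsConsistent_acq {S : AsmRec Var} {mds : Mds Var Lock}
    (h : asmrecMdsConsistent S mds) (k : Lock) :
    asmrecMdsConsistent (asmAcq T k S) (lockAcqUpd T k mds) := by
  simp only [asmrecMdsConsistent, asmAcq, lockAcqUpd, Set.image_union, h.1, h.2, and_self]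

theorem asmrecMdsConsistent_rel {S : AsmRec Var} {mds : Mds Var Lock}
    (h : asmrecMdsConsistent S mds) (k : Lock) :
    asmrecMdsConsistent (asmRel T k S) (lockRelUpd T k mds) := by
  have hinj : Function.Injective (Shared.var : Var → Shared Var Lock) := by
    intro a b hab
    cases hab
    rfl
  simp only [asmrecMdsConsistent, asmRel, lockRelUpd, Set.image_sdiff hinj, h.1, h.2, and_self]

/-- Inside subprograms this is inherited through `AnnSoundAt.embed`. What remains are the
instructions emitted by the construct itself, where the record at the position reached must be below
the record at the position left. -/
theorem annSoundAt_compileCmd (h : compileCmd T C l nl c = some (P, l', nl', C'))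
    (hl : ∀ x, l = some x → x < nl) (hu : noUnstableExprsAsm T c C.2) {pc : ℕ}
    (hpc : pc < P.length) : AnnSoundAt T P C' pc := by
  induction c generalizing C l nl P l' nl' C' pc with
  | stopped => simp [compileCmd] at h
  | skip =>
    cases h
    obtain rfl : pc = 0 := by simpa using hpc
    exact annSoundAt_of_exec (l := l) (ins := .nop) (C₁ := C) (A := []) (B := []) rfl rfl
      fun regs mds m hc => hc
  | lockAcq k =>
    cases h
    obtain rfl : pc = 0 := by simpa using hpc
    refine annSoundAt_of_exec (l := l) (ins := .lockAcq k) (C₁ := C) (A := []) (B := []) rfl rfl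
      fun regs mds m hc => ?_
    simp only [exec]
    split_ifs with hk
    · refine ⟨fun r e hr => ?_, asmrecMdsConsistent_acq hc.2 k⟩
      rw [evExp_upd_lock]
      exact hc.1 r e hr
    · exact hc
  | lockRel k =>
    cases h
    obtain rfl : pc = 0 := by simpa using hpc
    refine annSoundAt_of_exec (l := l) (ins := .lockRel k) (C₁ := C) (A := []) (B := []) rfl rfl
      fun regs mds m hc => ?_
    simp only [exec]
    split_ifs with hk
    · refine ⟨fun r e hr => ?_, asmrecMdsConsistent_rel hc.2 k⟩
      rw [evExp_upd_lock]
      exact hc.1 r e (purge_eq_some hr).1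
    · exact hc
  | seq c₁ c₂ ih₁ ih₂ =>
    obtain ⟨P₁, l₁, nl₁, C₁, P₂, h₁, h₂, rfl⟩ := compileCmd_seq_inv h
    have hj := joinable_of_compileCmd h₁ h₂ hl
    have s₁ := labelSpec_of_compileCmd h₁ hl
    rw [List.length_append] at hpc
    rcases lt_or_ge pc P₁.length with hlt | hge
    · exact (ih₁ h₁ hl hu.1 hlt).embed (A := []) (Q := P₁) (B := P₂) hj.embeds_left rfl
        (compileCmd_head h₂).2.2.2 hlt (by simp)
    · exact (ih₂ h₂ (fun x hx => (s₁.exit x hx).2.1) (by rw [asm_compileCmd h₁]; exact hu.2)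
        (pc := pc - P₁.length) (by omega)).embed (A := P₁) (Q := P₂) (B := []) hj.embeds_right
        (by simp) (.of_eq rfl) (by omega) (by omega)
  | assign v e =>
    obtain ⟨Pe, r, C₁, he⟩ := compileCmd_assign_inv h
    obtain ⟨rfl, -, -, rfl⟩ := compileCmd_assign_eq h he
    have he := exprSpec_of_compileExpr he
    rw [length_exprThen] at hpc
    rcases lt_or_ge pc Pe.length with hlt | hge
    · simpa using he.annSoundAt_exprThen (i := .store v r) [] (purge C₁.1 {v}, C₁.2) hlt
    · refine annSoundAt_of_exec (A := Pe) (B := []) (P := exprThen Pe l (.store v r) C₁)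
        (List.append_nil _).symm (by omega) fun regs mds m hc => ?_
      have hrec := AProg.recAt_length (exprThen Pe l (.store v r) C₁) (purge C₁.1 {v}, C₁.2)
      rw [length_exprThen, show Pe.length = pc by omega] at hrec
      simp only [exec, hrec]
      exact ⟨regrecMemConsistent_store hc.1 _ _, hc.2⟩
  | ite e c₁ c₂ ih₁ ih₂ =>
    obtain ⟨Pe, r, C₁, P₁, l₁, nl₁, C₂, P₂, l₂, C₃, he, h₁, h₂⟩ := compileCmd_ite_inv h
    obtain ⟨hP, rfl, -, rfl⟩ := compileCmd_ite_eq h he h₁ h₂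
    have hx := resolve_exit h hl
    have hs := exprSpec_of_compileExpr he
    have hbr := resolve_ite_snd he h₁ h₂ hl (.jz nl r) (.jmp (nl + 1)) [((l₂, .epi), C₃)]
    have m₁ := (labelSpec_of_compileCmd h₁ (by simp)).mono
    -- The final record takes its assumptions from the first branch. The static check makes them
    -- valid after the second branch as well.
    have hasm : C₂.2 = C₃.2 := by
      rw [asm_compileCmd h₁, asm_compileCmd h₂, hs.asm]
      exact hu.2.2.2
    have hlen : P.length = Pe.length + 1 + P₁.length + 1 + P₂.length + 1 := by
      simp only [hP, List.length_append, length_exprThen, List.length_singleton]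
    have h0₁ := (compileCmd_head h₁).2.2.2
    have h0₂ := (compileCmd_head h₂).2.2.2
    have n₁ := (compileCmd_head h₁).1
    have n₂ := (compileCmd_head h₂).1
    have hend := AProg.recAt_length P (meet C₂.1 C₃.1, C₂.2)
    rcases lt_or_ge pc Pe.length with hlt | hge
    · rw [hP]
      simp only [List.append_assoc]
      exact hs.annSoundAt_exprThen _ _ hlt
    rcases hge.eq_or_lt with rfl | hge
    · refine annSoundAt_of_exec (A := Pe) (B := P₁ ++ [((l₁, .jmp (nl + 1)), C₂)] ++ P₂ ++
        [((l₂, .epi), C₃)]) (by rw [hP]; simp [exprThen]; exact ⟨⟨rfl, rfl⟩, rfl⟩) rfl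
        fun regs mds m hc => ?_
      simp only [exec]
      split_ifs with hz
      · refine RecLe.consistent ?_ hc
        rw [hP, hbr, List.append_assoc _ P₂, show Pe.length + 1 + P₁.length + 1 =
          (exprThen Pe l (.jz nl r) C₁ ++ P₁ ++ [((l₁, Instr.jmp (nl + 1)), C₂)]).length + 0 by
            simp only [List.length_append, length_exprThen, List.length_singleton, add_zero],
          AProg.recAt_append_right, AProg.recAt_append_left (List.length_pos_iff.2 n₂) _ _ C₃]
        exact h0₂
      · refine RecLe.consistent ?_ hc
        rw [hP, List.append_assoc, List.append_assoc, List.append_assoc, show Pe.length + 1 =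
          (exprThen Pe l (.jz nl r) C₁).length + 0 by simp [length_exprThen],
          AProg.recAt_append_right, AProg.recAt_append_left (List.length_pos_iff.2 n₁) _ _ C₂]
        exact h0₁
    rcases lt_or_ge pc (Pe.length + 1 + P₁.length) with hlt | hge'
    · exact (ih₁ h₁ (by simp) (by rw [hs.asm]; exact hu.2.1) (pc := pc - (Pe.length + 1))
        (by omega)).embed (embeds_ite_fst he h₁ hl (.jz nl r) (.jmp (nl + 1))
        (P₂ ++ [((l₂, .epi), C₃)])) (by rw [hP]; simp) (.of_eq rfl) (by omega)
        (by rw [length_exprThen]; omega)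
    rcases hge'.eq_or_lt with rfl | hge'
    · refine annSoundAt_of_exec (A := exprThen Pe l (.jz nl r) C₁ ++ P₁)
        (B := P₂ ++ [((l₂, .epi), C₃)]) (by rw [hP]; simp; exact ⟨⟨rfl, rfl⟩, rfl⟩)
        (by simp [length_exprThen]) fun regs mds m hc => ?_
      simp only [exec, hx, hend]
      exact recLe_meet_left.consistent hc
    rcases lt_or_ge pc (Pe.length + 1 + P₁.length + 1 + P₂.length) with hlt | hge''
    · exact (ih₂ h₂ (by rintro x ⟨⟩; lia) (by rw [hs.asm]; exact hu.2.2.1)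
        (pc := pc - (Pe.length + 1 + P₁.length + 1))
        (by omega)).embed (embeds_ite_snd he h₁ h₂ hl (.jz nl r) (.jmp (nl + 1)) .epi)
        (by rw [hP]) (.of_eq rfl) (by omega)
        (by simp only [List.length_append, length_exprThen, List.length_singleton]; omega)
    · refine annSoundAt_of_exec (B := []) (A := exprThen Pe l (.jz nl r) C₁ ++ P₁ ++
        [((l₁, .jmp (nl + 1)), C₂)] ++ P₂) (by rw [hP]; exact (List.append_nil _).symm)
        (by simp only [List.length_append, length_exprThen, List.length_singleton]; omega)
        fun regs mds m hc => ?_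
      simp only [exec, show pc + 1 = P.length by omega, hend]
      rw [hasm]
      exact recLe_meet_right.consistent hc
  | _ e c ih =>
    obtain ⟨Pe, r, C₁, P₁, l₁, C₂, he, h₁⟩ := compileCmd_while_inv h
    obtain ⟨hP, rfl, -, rfl⟩ := compileCmd_while_eq h he h₁
    have hx := resolve_exit h hl
    have hs := exprSpec_of_compileExpr he
    -- The body restores the assumptions. Since the head of the loop records no registers, this is
    -- all that the backward jump must provide.
    have hasm : C₂.2 = C.2 := by
      rw [asm_compileCmd h₁, hs.asm]
      exact hu.2.2
    have hlen : P.length = Pe.length + 1 + P₁.length + 1 := by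
      simp only [hP, List.length_append, length_exprThen, List.length_singleton]
    have h0₁ := (compileCmd_head h₁).2.2.2
    have n₁ := (compileCmd_head h₁).1
    have hend := AProg.recAt_length P C'
    rcases lt_or_ge pc Pe.length with hlt | hge
    · rw [hP]
      simp only [List.append_assoc]
      exact hs.annSoundAt_exprThen _ _ hlt
    rcases hge.eq_or_lt with rfl | hge
    · refine annSoundAt_of_exec (A := Pe) (B := P₁ ++ [((l₁, .jmp (loopLabel l nl).1), C₂)])
        (by rw [hP]; simp [exprThen]; exact ⟨⟨rfl, rfl⟩, rfl⟩) rfl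
        fun regs mds m hc => ?_
      simp only [exec]
      split_ifs with hz
      · rw [hx, hend]
        exact hc
      · refine RecLe.consistent ?_ hc
        rw [hP, List.append_assoc, show Pe.length + 1 =
          (exprThen Pe (some (loopLabel l nl).1) (.jz (loopLabel l nl).2 r) C').length + 0 by
            simp [length_exprThen],
          AProg.recAt_append_right, AProg.recAt_append_left (List.length_pos_iff.2 n₁) _ _ C₂]
        exact h0₁
    rcases lt_or_ge pc (Pe.length + 1 + P₁.length) with hlt | hge'
    · exact (ih h₁ (by simp) (by rw [hs.asm]; exact hu.2.1) (pc := pc - (Pe.length + 1))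
        (by omega)).embed (embeds_while he h₁ hl (.jz (loopLabel l nl).2 r)
        (.jmp (loopLabel l nl).1)) (by rw [hP]) (.of_eq rfl) (by omega)
        (by rw [length_exprThen]; omega)
    · refine annSoundAt_of_exec (B := []) (A := exprThen Pe (some (loopLabel l nl).1)
        (.jz (loopLabel l nl).2 r) C' ++ P₁) (by rw [hP]; exact (List.append_nil _).symm)
        (by simp only [List.length_append, length_exprThen]; omega)
        fun regs mds m hc => ?_
      have hlp : resolve P.text (loopLabel l nl).1 = 0 := by
        rw [hP, List.append_assoc, AProg.text_append]
        exact ((hs.headLabel_exprThen rfl).append _).resolve_eq_zero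
      simp only [exec, hlp]
      rw [hP, List.append_assoc, hs.recAt_exprThen_zero]
      exact (recLe_empty hasm.symm).consistent hc

end Static

section Layout

variable {Val Opr Var Lock Reg : Type*} {T : Params Val Opr Var Lock Reg}
  {C C' C₁ C₂ C₃ : CompRec Val Opr Var Reg} {l l' l₁ l₂ : Option Lab} {nl nl' nl₁ nl₂ : Lab}
  {c c₁ c₂ : Cmd Val Opr Var Lock} {e : Exp Val Opr Var} {v : Var} {r : Reg}
  {P Pe P₁ P₂ : AProg Val Opr Var Lock Reg}

/-! ### The layout of compiled commands -/

theorem text_getElem?_eq {A B : AProg Val Opr Var Lock Reg} {i : LInstr Val Opr Var Lock Reg}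
    (hP : P = A ++ [(i, C₁)] ++ B) {pc : ℕ} (hpc : pc = A.length) :
    P.text[pc]? = some i ∧ P.recAt C pc = C₁ := by
  subst hP hpc
  constructor
  · simp [AProg.text]
  · simp [AProg.recAt, List.getD_eq_getElem?_getD]

theorem isEval_text {B : AProg Val Opr Var Lock Reg} (h : ∀ x ∈ Pe, IsEval x.1.2)
    (hP : P = Pe ++ B) {pc : ℕ} (hpc : pc < Pe.length) :
    ∃ l i, P.text[pc]? = some (l, i) ∧ IsEval i := by
  subst hP
  refine ⟨Pe[pc].1.1, Pe[pc].1.2, ?_, h _ (List.getElem_mem hpc)⟩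
  rw [AProg.text_append, List.getElem?_append_left (by rwa [AProg.length_text])]
  simp [AProg.text, hpc]

/-- This structure and the next two collect what the case analyses over the refinement relation
need: which instruction stands where, where its jumps lead, and how subprograms are embedded. The
syntax of the compiler is not unfolded again there. -/
structure AssignLayout (P Pe : AProg Val Opr Var Lock Reg) (C' C₁ : CompRec Val Opr Var Reg)
    (v : Var) (r : Reg) : Prop where
  length : P.length = Pe.length + 1
  eval : ∀ pc < Pe.length, ∃ l i, P.text[pc]? = some (l, i) ∧ IsEval i
  store : ∃ l, P.text[Pe.length]? = some (l, .store v r)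
  recAt : P.recAt C' Pe.length = C₁

structure IteLayout (P Pe P₁ P₂ : AProg Val Opr Var Lock Reg) (C' C₁ : CompRec Val Opr Var Reg)
    (r : Reg) : Prop where
  length : P.length = Pe.length + 1 + P₁.length + 1 + P₂.length + 1
  fst_pos : 0 < P₁.length
  snd_pos : 0 < P₂.length
  eval : ∀ pc < Pe.length, ∃ l i, P.text[pc]? = some (l, i) ∧ IsEval i
  recAt : P.recAt C' Pe.length = C₁
  jz : ∃ l x, P.text[Pe.length]? = some (l, .jz x r) ∧
    resolve P.text x = Pe.length + 1 + P₁.length + 1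
  jmp : ∃ l x, P.text[Pe.length + 1 + P₁.length]? = some (l, .jmp x) ∧
    resolve P.text x = P.length
  epi : ∃ l, P.text[Pe.length + 1 + P₁.length + 1 + P₂.length]? = some (l, .epi)
  fst : ∃ A B, Embeds A P₁.text B ∧ P.text = A ++ P₁.text ++ B ∧ A.length = Pe.length + 1
  snd : ∃ A B, Embeds A P₂.text B ∧ P.text = A ++ P₂.text ++ B ∧
    A.length = Pe.length + 1 + P₁.length + 1

structure WhileLayout (P Pe P₁ : AProg Val Opr Var Lock Reg) (C' C₁ : CompRec Val Opr Var Reg)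
    (r : Reg) : Prop where
  length : P.length = Pe.length + 1 + P₁.length + 1
  expr_pos : 0 < Pe.length
  body_pos : 0 < P₁.length
  eval : ∀ pc < Pe.length, ∃ l i, P.text[pc]? = some (l, i) ∧ IsEval i
  recAt : P.recAt C' Pe.length = C₁
  jz : ∃ l x, P.text[Pe.length]? = some (l, .jz x r) ∧ resolve P.text x = P.length
  jmp : ∃ l x, P.text[Pe.length + 1 + P₁.length]? = some (l, .jmp x) ∧ resolve P.text x = 0
  body : ∃ A B, Embeds A P₁.text B ∧ P.text = A ++ P₁.text ++ B ∧ A.length = Pe.length + 1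

theorem assignLayout (h : compileCmd T C l nl (.assign v e) = some (P, l', nl', C'))
    (he : compileExpr T C ∅ l e = some (Pe, r, C₁)) : AssignLayout P Pe C' C₁ v r := by
  obtain ⟨hP, -, -, -⟩ := compileCmd_assign_eq h he
  have hs := exprSpec_of_compileExpr he
  have h₁ := text_getElem?_eq (C := C') (A := Pe) (B := [])
    (hP.trans (List.append_nil _).symm) rfl
  exact
    { length := by rw [hP, length_exprThen]
      eval := fun pc hpc => isEval_text hs.isEval hP hpc
      store := ⟨_, h₁.1⟩
      recAt := h₁.2 }

theorem iteLayout (h : compileCmd T C l nl (.ite e c₁ c₂) = some (P, l', nl', C'))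
    (he : compileExpr T C ∅ l e = some (Pe, r, C₁))
    (hc₁ : compileCmd T C₁ none (nl + 2) c₁ = some (P₁, l₁, nl₁, C₂))
    (hc₂ : compileCmd T C₁ (some nl) nl₁ c₂ = some (P₂, l₂, nl₂, C₃))
    (hl : ∀ x, l = some x → x < nl) : IteLayout P Pe P₁ P₂ C' C₁ r := by
  obtain ⟨hP, rfl, -, -⟩ := compileCmd_ite_eq h he hc₁ hc₂
  have hs := exprSpec_of_compileExpr he
  have hP' : P = Pe ++ [((if Pe = [] then l else none, .jz nl r), C₁)] ++ (P₁ ++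
      [((l₁, .jmp (nl + 1)), C₂)] ++ P₂ ++ [((l₂, .epi), C₃)]) := by
    rw [hP]
    simp only [exprThen, List.append_assoc]
  have h₁ := text_getElem?_eq (C := C') hP' rfl
  exact
    { length := by
        simp only [hP, List.length_append, length_exprThen, List.length_singleton]
      fst_pos := List.length_pos_iff.2 (compileCmd_head hc₁).1
      snd_pos := List.length_pos_iff.2 (compileCmd_head hc₂).1
      eval := fun pc hpc => isEval_text hs.isEval (hP'.trans (List.append_assoc _ _ _)) hpc
      recAt := h₁.2
      jz := ⟨_, _, h₁.1, by
        rw [hP]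
        exact resolve_ite_snd he hc₁ hc₂ hl _ _ _⟩
      jmp := ⟨_, _, (text_getElem?_eq (P := P) (C := C') (A := exprThen Pe l (.jz nl r) C₁ ++ P₁)
        (hP.trans (List.append_assoc _ _ _))
        (by simp only [List.length_append, length_exprThen])).1, resolve_exit h hl⟩
      epi := ⟨_, (text_getElem?_eq (P := P) (C := C') (B := [])
        (hP.trans (List.append_nil _).symm)
        (by simp only [List.length_append, length_exprThen, List.length_singleton])).1⟩
      fst := ⟨_, _, embeds_ite_fst he hc₁ hl (.jz nl r) (.jmp (nl + 1)) (P₂ ++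
        [((l₂, .epi), C₃)]), by rw [hP]; simp only [AProg.text_append, List.append_assoc],
        by rw [AProg.length_text, length_exprThen]⟩
      snd := ⟨_, _, embeds_ite_snd he hc₁ hc₂ hl (.jz nl r) (.jmp (nl + 1)) .epi,
        by rw [hP]; simp only [AProg.text_append, List.append_assoc],
        by simp only [AProg.length_text, List.length_append, length_exprThen,
          List.length_singleton]⟩ }

theorem whileLayout (h : compileCmd T C l nl (.while e c) = some (P, l', nl', C'))
    (he : compileExpr T (fun _ => none, C.2) ∅ (some (loopLabel l nl).1) e = some (Pe, r, C₁))
    (hc₁ : compileCmd T C₁ none ((loopLabel l nl).2 + 1) c = some (P₁, l₁, nl₁, C₂))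
    (hl : ∀ x, l = some x → x < nl) : WhileLayout P Pe P₁ C' C₁ r := by
  obtain ⟨hP, rfl, -, -⟩ := compileCmd_while_eq h he hc₁
  have hs := exprSpec_of_compileExpr he
  have hP' : P = Pe ++ [((if Pe = [] then some (loopLabel l nl).1 else none,
      .jz (loopLabel l nl).2 r), C₁)] ++ (P₁ ++ [((l₁, .jmp (loopLabel l nl).1), C₂)]) := by
    rw [hP]
    simp only [exprThen, List.append_assoc]
  have h₁ := text_getElem?_eq (C := C') hP' rfl
  exact
    { length := by
        simp only [hP, List.length_append, length_exprThen, List.length_singleton]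
      expr_pos := List.length_pos_iff.2 (compileExpr_ne_nil he)
      body_pos := List.length_pos_iff.2 (compileCmd_head hc₁).1
      eval := fun pc hpc => isEval_text hs.isEval (hP'.trans (List.append_assoc _ _ _)) hpc
      recAt := h₁.2
      jz := ⟨_, _, h₁.1, resolve_exit h hl⟩
      jmp := ⟨_, _, (text_getElem?_eq (P := P) (C := C') (B := [])
        (hP.trans (List.append_nil _).symm)
        (by simp only [List.length_append, length_exprThen])).1, by
        rw [hP, List.append_assoc, AProg.text_append]
        exact ((hs.headLabel_exprThen rfl).append _).resolve_eq_zero⟩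
      body := ⟨_, _, embeds_while he hc₁ hl (.jz (loopLabel l nl).2 r) (.jmp (loopLabel l nl).1),
        by rw [hP]; simp only [AProg.text_append],
        by rw [AProg.length_text, length_exprThen]⟩ }

theorem eval_step {Q : Prog Val Opr Var Lock Reg} {pc : ℕ} {i : Instr Val Opr Var Lock Reg}
    (hi : Q[pc]? = some (l, i)) (he : IsEval i) {regs : Reg → Val} {mds : Mds Var Lock}
    {m : Mem Val Var Lock} {x : RConf Val Opr Var Lock Reg}
    (hx : RStep T ⟨⟨pc, Q, regs⟩, mds, m⟩ x) : ∃ regs', x = ⟨⟨pc + 1, Q, regs'⟩, mds, m⟩ := by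
  obtain ⟨l', j, hj, rfl⟩ := rstep_iff.1 hx
  rw [hi] at hj
  cases hj
  cases i
  all_goals first | exact he.elim | exact ⟨_, rfl⟩

theorem step_eq {Q : Prog Val Opr Var Lock Reg} {pc : ℕ} {i : Instr Val Opr Var Lock Reg}
    (hi : Q[pc]? = some (l, i)) {regs : Reg → Val} {mds : Mds Var Lock}
    {m : Mem Val Var Lock} {x : RConf Val Opr Var Lock Reg}
    (hx : RStep T ⟨⟨pc, Q, regs⟩, mds, m⟩ x) :
    x = confOf Q (exec T (resolve Q) pc regs mds m i) := by
  obtain ⟨l', j, hj, rfl⟩ := rstep_iff.1 hx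
  rw [hi] at hj
  cases hj
  rfl

/-- Steps of compiled commands preserve consistency with the annotations. -/
theorem consistent_step (h : compileCmd T C l nl c = some (P, l', nl', C'))
    (hreq : compileCmdInputReqs T C l nl c) {pc pc' : ℕ} {regs regs' : Reg → Val}
    {mds mds' : Mds Var Lock} {m m' : Mem Val Var Lock}
    (hcons : compiledCmdConfigConsistent T (P.recAt C' pc) regs mds m)
    (hstep : RStep T ⟨⟨pc, P.text, regs⟩, mds, m⟩ ⟨⟨pc', P.text, regs'⟩, mds', m'⟩) :
    compiledCmdConfigConsistent T (P.recAt C' pc') regs' mds' m' := by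
  obtain ⟨l, i, hi, -⟩ := rstep_iff.1 hstep
  have hpc : pc < P.text.length := (List.getElem?_eq_some_iff.1 hi).1
  rw [AProg.length_text] at hpc
  exact annSoundAt_compileCmd h hreq.2.1 hreq.2.2.1 hpc _ _ _ _ _ _ _ hcons hstep

end Layout

/-! ### Elementary properties of the refinement relation -/

section Rel

variable {Val Opr Var Lock Reg : Type*} {T : Params Val Opr Var Lock Reg}
  {a : WConf Val Opr Var Lock} {c : RConf Val Opr Var Lock Reg}

theorem RwrRel.modesMem (h : RwrRel T a c) : a.mds = c.mds ∧ a.mem = c.mem := by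
  cases h <;> exact ⟨rfl, rfl⟩

/-- A variable of a recorded expression is stable, hence lies under an active assumption of the mode
state and is not writable. So the change cannot affect recorded values. -/
theorem consistent_of_writable {C : CompRec Val Opr Var Reg} {regs : Reg → Val}
    {mds : Mds Var Lock} {m m' : Mem Val Var Lock} (hs : regrecStable T C)
    (hw : ∀ x, m x ≠ m' x → writable mds x)
    (hc : compiledCmdConfigConsistent T C regs mds m) :
    compiledCmdConfigConsistent T C regs mds m' := by
  refine ⟨fun r e hr => ?_, hc.2⟩
  rw [hc.1 r e hr]
  refine evExp_congr fun v hv => ?_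
  by_contra hne
  obtain ⟨h₁, h₂⟩ := hw _ hne
  rw [← hc.2.1] at h₁
  rw [← hc.2.2] at h₂
  rcases (hs r e hr v hv).1 with h | h
  · exact h₁ ⟨v, h, rfl⟩
  · exact h₂ ⟨v, h, rfl⟩

/-- Epilogue steps are silent: they change only the position, and they do so in the same way for
every memory. -/
theorem isEpilogueStep.step_iff {P : Prog Val Opr Var Lock Reg} {pc : ℕ}
    (h : isEpilogueStep P pc) {regs : Reg → Val} {mds : Mds Var Lock} {m : Mem Val Var Lock}
    {x : RConf Val Opr Var Lock Reg} (hx : RStep T ⟨⟨pc, P, regs⟩, mds, m⟩ x) :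
    ∃ pc', x = ⟨⟨pc', P, regs⟩, mds, m⟩ ∧
      ∀ m', RStep T ⟨⟨pc, P, regs⟩, mds, m'⟩ ⟨⟨pc', P, regs⟩, mds, m'⟩ := by
  rcases h with ⟨l, hi⟩ | ⟨l, l', hi, -⟩
  · cases step_eq hi hx
    exact ⟨_, rfl, fun m' => .epi _ _ _ _ _ _ hi⟩
  · cases step_eq hi hx
    exact ⟨_, rfl, fun m' => .jmp _ _ _ _ _ _ _ hi⟩

/-- Each case constrains the memory only through consistency with a stable record, which survives
writable changes, or through a relation for the current subprogram, to which induction applies. The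
premises about initial configurations already range over all memories. -/
theorem RwrRel.change_mem (h : RwrRel T a c) {m' : Mem Val Var Lock}
    (hw : ∀ x, a.mem x ≠ m' x → writable a.mds x) :
    RwrRel T ⟨a.tps, a.mds, m'⟩ ⟨c.tps, c.mds, m'⟩ := by
  induction h with
  | stopped => exact .stopped _ _ _ _
  | skip_nop => exact .skip_nop _ _ _ _
  | assign_expr C l nl v e PCs l' nl' C' Pe r C₁ pc regs mds m hreq hc he hpc hcons hstab =>
    exact .assign_expr (hreq := hreq) (hc := hc) (he := he) (hpc := hpc)
      (hcons := consistent_of_writable hstab hw hcons) (hstab := hstab)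
  | assign_store C l nl v e PCs l' nl' C' Pe r C₁ pc regs mds m hreq hc he hpc hcons hstab hwr =>
    exact .assign_store (hreq := hreq) (hc := hc) (he := he) (hpc := hpc)
      (hcons := consistent_of_writable hstab hw hcons) (hstab := hstab) (hw := hwr)
  | lock_acq => exact .lock_acq _ _ _ _ _
  | lock_rel => exact .lock_rel _ _ _ _ _
  | seq C l nl c₁ PCs₁ l₁ nl₁ C₁ c₂ PCs₂ l₂ nl₂ C₂ d pc regs mds m hreq hc₁ hc₂ hj hpc hcons
      hstab h₁ h₂ ih₁ ih₂ =>
    exact .seq (hreq := hreq) (hc₁ := hc₁) (hc₂ := hc₂) (hj := hj) (hpc := hpc)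
      (hcons := consistent_of_writable hstab hw hcons) (hstab := hstab) (h₁ := ih₁ hw) (h₂ := h₂)
  | join P₁ P₂ c pc regs mds m hj hpc h ih => exact .join (hj := hj) (hpc := hpc) (h := ih hw)
  | if_expr C l nl e c₁ c₂ PCs l' nl₂ C' Pe r C₁ PCs₁ l₁ nl₁ C₂ PCs₂ l₂ C₃ pc regs mds m hreq hc
      he hc₁ hc₂ hpc hcons hstab h₁ h₂ =>
    exact .if_expr (hreq := hreq) (hc := hc) (he := he) (hc₁ := hc₁) (hc₂ := hc₂) (hpc := hpc)
      (hcons := consistent_of_writable hstab hw hcons) (hstab := hstab) (h₁ := h₁) (h₂ := h₂)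
  | if_c1 C l nl e c₁ c₂ PCs l' nl₂ C' Pe r C₁ PCs₁ l₁ nl₁ C₂ PCs₂ l₂ C₃ d pc₁ pc regs mds m hreq
      hc he hc₁ hc₂ hpc₁ hpc hcons hstab h ih =>
    exact .if_c1 (hreq := hreq) (hc := hc) (he := he) (hc₁ := hc₁) (hc₂ := hc₂) (hpc₁ := hpc₁)
      (hpc := hpc) (hcons := consistent_of_writable hstab hw hcons) (hstab := hstab) (h := ih hw)
  | if_c2 C l nl e c₁ c₂ PCs l' nl₂ C' Pe r C₁ PCs₁ l₁ nl₁ C₂ PCs₂ l₂ C₃ d pc₂ pc regs mds m hreq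
      hc he hc₁ hc₂ hpc₂ hpc hcons hstab h ih =>
    exact .if_c2 (hreq := hreq) (hc := hc) (he := he) (hc₁ := hc₁) (hc₂ := hc₂) (hpc₂ := hpc₂)
      (hpc := hpc) (hcons := consistent_of_writable hstab hw hcons) (hstab := hstab) (h := ih hw)
  | epilogue_step pc P regs mds m hp h ih =>
    refine .epilogue_step (hp := hp) (h := fun pc' regs' mds' m₁ hstep => ?_)
    -- The premise concerns steps from the old memory, so the step from the new one is replayed
    -- there.
    obtain ⟨pc₁, hx, hst⟩ := hp.step_iff hstep
    cases hx
    exact ih _ _ _ _ (hst m) hw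
  | while_expr C l nl e c PCs l' nl₁ C' Pe r C₁ PCs₁ l₁ C₂ d pc regs mds m hreq hc he hc₁ hd hcons
      hstab h =>
    exact .while_expr (hreq := hreq) (hc := hc) (he := he) (hc₁ := hc₁) (hd := hd)
      (hcons := consistent_of_writable hstab hw hcons) (hstab := hstab) (h := h)
  | while_inner C l nl e c PCs l' nl₁ C' Pe r C₁ PCs₁ l₁ C₂ d pc₁ pc regs mds m hreq hc he hc₁ hpc₁
      hpc hcons hstab h h' ih ih' =>
    exact .while_inner (hreq := hreq) (hc := hc) (he := he) (hc₁ := hc₁) (hpc₁ := hpc₁)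
      (hpc := hpc) (hcons := consistent_of_writable hstab hw hcons) (hstab := hstab) (h := ih hw)
      (h' := h')
  | while_loop C l nl e c PCs l' nl₁ C' Pe r C₁ PCs₁ l₁ C₂ pc₁ pc regs mds m hreq hc he hc₁ hpc₁
      hpc hcons hstab h h' ih ih' =>
    exact .while_loop (hreq := hreq) (hc := hc) (he := he) (hc₁ := hc₁) (hpc₁ := hpc₁)
      (hpc := hpc) (hcons := consistent_of_writable hstab hw hcons) (hstab := hstab) (h := ih hw)
      (h' := h')

theorem isEpilogueStep.lt {P : Prog Val Opr Var Lock Reg} {pc : ℕ} (h : isEpilogueStep P pc) :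
    pc < P.length := by
  rcases h with ⟨l, hi⟩ | ⟨l, l', hi, -⟩ <;> exact (List.getElem?_eq_some_iff.1 hi).1

/-- A program counter at the end belongs to a terminated command, and before the end terminated
commands only perform epilogue steps. -/
theorem RwrRel.bounds (h : RwrRel T a c) : c.tps.pc ≤ c.tps.prog.length ∧
    (c.tps.pc = c.tps.prog.length → a.tps = .stopped) ∧
    (a.tps = .stopped → c.tps.pc < c.tps.prog.length → isEpilogueStep c.tps.prog c.tps.pc) := by
  induction h with
  | stopped => simp
  | skip_nop => simp
  | assign_expr C l nl v e PCs l' nl' C' Pe r C₁ pc regs mds m hreq hc he hpc hcons hstab =>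
    have := (assignLayout hc he).length
    simp only [AProg.length_text]
    exact ⟨by omega, fun h => by omega, by simp⟩
  | assign_store C l nl v e PCs l' nl' C' Pe r C₁ pc regs mds m hreq hc he hpc hcons hstab hwr =>
    have := (assignLayout hc he).length
    simp only [AProg.length_text]
    exact ⟨by omega, fun h => by omega, by simp⟩
  | lock_acq => simp
  | lock_rel => simp
  | seq C l nl c₁ PCs₁ l₁ nl₁ C₁ c₂ PCs₂ l₂ nl₂ C₂ d pc regs mds m hreq hc₁ hc₂ hj hpc hcons
      hstab h₁ h₂ ih₁ ih₂ =>
    -- The position is at most `|P₁|`, and `P₂` is not empty, so the end of the whole program is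
    -- never reached in this case.
    have := List.length_pos_iff.2 (compileCmd_head hc₂).1
    simp only [List.length_append, AProg.length_text]
    exact ⟨by omega, fun h => by omega, by simp⟩
  | join P₁ P₂ c pc regs mds m hj hpc h ih =>
    simp only [List.length_append] at ih ⊢
    refine ⟨by omega, fun h => ih.2.1 (by omega), fun h hlt => ?_⟩
    have := ih.2.2 h (by omega)
    rwa [hj.embeds_right.isEpilogueStep_iff (P := P₁ ++ P₂) (i := pc - P₁.length) (by simp)
      (by omega) (by omega)]
  | if_expr C l nl e c₁ c₂ PCs l' nl₂ C' Pe r C₁ PCs₁ l₁ nl₁ C₂ PCs₂ l₂ C₃ pc regs mds m hreq hc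
      he hc₁ hc₂ hpc hcons hstab h₁ h₂ =>
    have := (iteLayout hc he hc₁ hc₂ hreq.2.1).length
    simp only [AProg.length_text]
    exact ⟨by omega, fun h => by omega, by simp⟩
  | if_c1 C l nl e c₁ c₂ PCs l' nl₂ C' Pe r C₁ PCs₁ l₁ nl₁ C₂ PCs₂ l₂ C₃ d pc₁ pc regs mds m hreq
      hc he hc₁ hc₂ hpc₁ hpc hcons hstab h ih =>
    have L := iteLayout hc he hc₁ hc₂ hreq.2.1
    have := L.length
    obtain ⟨A, B, hE, hP, hA⟩ := L.fst
    simp only [AProg.length_text] at ih ⊢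
    refine ⟨by omega, fun h => by omega, fun h _ => ?_⟩
    exact (hE.isEpilogueStep_iff hP (by rwa [AProg.length_text]) (by omega)).2 (ih.2.2 h hpc₁)
  | if_c2 C l nl e c₁ c₂ PCs l' nl₂ C' Pe r C₁ PCs₁ l₁ nl₁ C₂ PCs₂ l₂ C₃ d pc₂ pc regs mds m hreq
      hc he hc₁ hc₂ hpc₂ hpc hcons hstab h ih =>
    have L := iteLayout hc he hc₁ hc₂ hreq.2.1
    have := L.length
    obtain ⟨A, B, hE, hP, hA⟩ := L.snd
    simp only [AProg.length_text] at ih ⊢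
    refine ⟨by omega, fun h => by omega, fun h _ => ?_⟩
    exact (hE.isEpilogueStep_iff hP (by rwa [AProg.length_text]) (by omega)).2 (ih.2.2 h hpc₂)
  | epilogue_step pc P regs mds m hp h ih =>
    exact ⟨hp.lt.le, fun _ => rfl, fun _ _ => hp⟩
  | while_expr C l nl e c PCs l' nl₁ C' Pe r C₁ PCs₁ l₁ C₂ d pc regs mds m hreq hc he hc₁ hd hcons
      hstab h =>
    have := (whileLayout hc he hc₁ hreq.2.1).length
    simp only [AProg.length_text]
    refine ⟨by omega, fun h => by omega, fun h => ?_⟩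
    rcases hd with ⟨-, rfl⟩ | ⟨-, -, rfl⟩ <;> simp at h
  | while_inner C l nl e c PCs l' nl₁ C' Pe r C₁ PCs₁ l₁ C₂ d pc₁ pc regs mds m hreq hc he hc₁ hpc₁
      hpc hcons hstab h h' ih ih' =>
    have := (whileLayout hc he hc₁ hreq.2.1).length
    simp only [AProg.length_text]
    exact ⟨by omega, fun h => by omega, by simp⟩
  | while_loop C l nl e c PCs l' nl₁ C' Pe r C₁ PCs₁ l₁ C₂ pc₁ pc regs mds m hreq hc he hc₁ hpc₁
      hpc hcons hstab h h' ih ih' =>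
    have := (whileLayout hc he hc₁ hreq.2.1).length
    simp only [AProg.length_text]
    exact ⟨by omega, fun h => by omega, by simp⟩

end Rel

section Simulation

variable {Val Opr Var Lock Reg : Type*} {T : Params Val Opr Var Lock Reg}
  {a : WConf Val Opr Var Lock} {c : RConf Val Opr Var Lock Reg}

/-! ### The pacing of the refinement -/

/-- The number of source steps that match the execution of the instruction `i`, where `ep` tells
whether it is an epilogue step. -/
def absSteps (i : Option (Instr Val Opr Var Lock Reg)) (ep : Prop) : Cmd Val Opr Var Lock → ℕ
  | .stopped => 0
  | .skip => 1
  | .lockAcq _ => 1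
  | .lockRel _ => 1
  -- The first evaluation instruction of a loop is paired with the unfolding of the loop into a
  -- conditional.
  | .while _ _ => 1
  | .assign _ _ => if ∃ v r, i = some (.store v r) then 1 else 0
  | .ite _ _ _ => if ∃ x r, i = some (.jz x r) then 1 else 0
  | .seq c₁ c₂ =>
      if c₁ = .stopped then
        -- With `stop` in front there are three situations: still in the epilogue of the first part;
        -- at the backward jump of a loop, which removes `stop`; or at the first instruction of the
        -- second part, where no instruction corresponds to the removal and it is done together with
        -- the steps for that instruction.
        if ep then 0 else if ∃ x, i = some (.jmp x) then 1 else absSteps i ep c₂ + 1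
      else absSteps i ep c₁

/-- The number of source steps that match the instruction of `P` at `pc`. -/
def stepsAt (P : Prog Val Opr Var Lock Reg) (pc : ℕ) (d : Cmd Val Opr Var Lock) : ℕ :=
  absSteps (P[pc]?.map Prod.snd) (isEpilogueStep P pc) d

theorem Embeds.stepsAt_eq {A Q B P : Prog Val Opr Var Lock Reg} (h : Embeds A Q B)
    (hP : P = A ++ Q ++ B) {i pc : ℕ} (hi : i < Q.length) (hpc : pc = A.length + i)
    (d : Cmd Val Opr Var Lock) : stepsAt P pc d = stepsAt Q i d := by
  have := propext (h.isEpilogueStep_iff hP hi hpc)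
  unfold stepsAt
  rw [this, hP, hpc, getElem?_embed _ _ _ hi]

/-- The refinement relation simulates steps to the configuration `x`. -/
def Simulated (T : Params Val Opr Var Lock Reg) (n : ℕ) (a : WConf Val Opr Var Lock)
    (x : RConf Val Opr Var Lock Reg) : Prop :=
  ∃ d, nSteps (WStep T) n a ⟨d, x.mds, x.mem⟩ ∧ RwrRel T ⟨d, x.mds, x.mem⟩ x

theorem stepsAt_of_isEval {P : Prog Val Opr Var Lock Reg} {pc : ℕ} {l : Option Lab}
    {i : Instr Val Opr Var Lock Reg} (hi : P[pc]? = some (l, i)) (he : IsEval i)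
    {d : Cmd Val Opr Var Lock} (hd : (∃ v e, d = .assign v e) ∨ ∃ e c₁ c₂, d = .ite e c₁ c₂) :
    stepsAt P pc d = 0 := by
  simp only [stepsAt, hi, Option.map_some]
  rcases hd with ⟨v, e, rfl⟩ | ⟨e, c₁, c₂, rfl⟩
  · rw [absSteps, if_neg]
    rintro ⟨v, r, h⟩
    cases h
    exact he
  · rw [absSteps, if_neg]
    rintro ⟨v, r, h⟩
    cases h
    exact he

theorem stepsAt_ite_jz {P : Prog Val Opr Var Lock Reg} {pc : ℕ} {l : Option Lab} {x : Lab}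
    {r : Reg} (hi : P[pc]? = some (l, .jz x r)) (e : Exp Val Opr Var)
    (c₁ c₂ : Cmd Val Opr Var Lock) : stepsAt P pc (.ite e c₁ c₂) = 1 := by
  simp only [stepsAt, hi, Option.map_some]
  rw [absSteps, if_pos ⟨_, _, rfl⟩]

/-- Before the end of the first part the continuation is irrelevant; if the first part has
terminated already, both counts are zero on its epilogue. -/
theorem stepsAt_seq {P : Prog Val Opr Var Lock Reg} {pc : ℕ} {d : Cmd Val Opr Var Lock}
    (h : d = .stopped → isEpilogueStep P pc) (c : Cmd Val Opr Var Lock) :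
    stepsAt P pc (.seq d c) = stepsAt P pc d := by
  unfold stepsAt
  rw [absSteps]
  split_ifs with hd hep
  · subst hd
    rfl
  · exact absurd (h hd) hep
  · exact absurd (h hd) hep
  · rfl

/-! ### Simulation of `RISC` steps by source steps -/

theorem RwrRel.of_pc_eq {P : Prog Val Opr Var Lock Reg} {pc : ℕ} (h : pc = P.length)
    {regs : Reg → Val} {mds : Mds Var Lock} {m : Mem Val Var Lock} :
    RwrRel T ⟨.stopped, mds, m⟩ ⟨⟨pc, P, regs⟩, mds, m⟩ := h ▸ .stopped P regs mds m

/-- Induction on the refinement relation. Inside a subprogram the step is translated to the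
subprogram alone, simulated there, and wrapped again. When the step reaches the end of the
subprogram, `RwrRel.bounds` says that the source part has terminated, which selects the case of the
relation that applies next. The explicit number of source steps is what makes the result usable for
two runs at once. -/
theorem RwrRel.simulated (h : RwrRel T a c) {x : RConf Val Opr Var Lock Reg}
    (hx : RStep T c x) : Simulated T (stepsAt c.tps.prog c.tps.pc a.tps) a x := by
  induction h generalizing x with
  | stopped =>
    obtain ⟨l, i, hi, -⟩ := rstep_iff.1 hx
    simp at hi
  | skip_nop l regs mds m =>
    cases step_eq rfl hx
    exact ⟨.stopped, nSteps_one (.skip _ _), .stopped [(l, .nop)] regs mds m⟩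
  | assign_expr C l nl v e PCs l' nl' C' Pe r C₁ pc regs mds m hreq hc he hpc hcons hstab =>
    have L := assignLayout hc he
    obtain ⟨l₀, i, hi, hev⟩ := L.eval pc hpc
    simp only
    rw [stepsAt_of_isEval hi hev (.inl ⟨_, _, rfl⟩)]
    obtain ⟨regs', rfl⟩ := eval_step hi hev hx
    have hcons' := consistent_step hc hreq hcons hx
    refine ⟨_, rfl, ?_⟩
    have hst := stable_recAt hc hreq.2.2.2 (pc + 1)
    rcases (Nat.succ_le_of_lt hpc).lt_or_eq with hlt | heq
    · exact .assign_expr (hreq := hreq) (hc := hc) (he := he) (hpc := hlt) (hcons := hcons')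
        (hstab := hst)
    · refine .assign_store (hreq := hreq) (hc := hc) (he := he) (hpc := heq) (hcons := hcons')
        (hstab := hst) (hw := ?_)
      rw [show pc + 1 = Pe.length from heq, L.recAt, (compileExpr_vars he).1]
      exact hreq.2.2.1.2
  | assign_store C l nl v e PCs l' nl' C' Pe r C₁ pc regs mds m hreq hc he hpc hcons hstab hwr =>
    have L := assignLayout hc he
    subst hpc
    obtain ⟨l₀, hi⟩ := L.store
    rw [L.recAt] at hcons
    -- Consistency with the record at the `store` says that the stored register holds the value of
    -- the source expression.
    have hr := hcons.1 _ _ (exprSpec_of_compileExpr he).result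
    cases step_eq hi hx
    have hn : stepsAt PCs.text Pe.length (.assign v e) = 1 := by
      simp only [stepsAt, hi, Option.map_some]
      rw [absSteps, if_pos ⟨_, _, rfl⟩]
    simp only [exec, confOf]
    rw [hn, hr]
    exact ⟨_, nSteps_one (.assign _ _ _ _), .of_pc_eq (L.length.symm.trans PCs.length_text.symm)⟩
  | lock_acq l k regs mds m =>
    cases step_eq rfl hx
    simp only [exec]
    split_ifs with hk
    · exact ⟨.stopped, nSteps_one (.lockAcq _ _ _ hk), .stopped [(l, .lockAcq k)] _ _ _⟩
    · exact ⟨_, nSteps_one (.lockSpin _ _ _ hk), .lock_acq _ _ _ _ _⟩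
  | lock_rel l k regs mds m =>
    cases step_eq rfl hx
    simp only [exec]
    split_ifs with hk
    · exact ⟨.stopped, nSteps_one (.lockRel _ _ _ hk), .stopped [(l, .lockRel k)] _ _ _⟩
    · exact ⟨_, nSteps_one (.lockInvalid _ _ _ hk), .lock_rel _ _ _ _ _⟩
  | seq C l nl c₁ PCs₁ l₁ nl₁ C₁ c₂ PCs₂ l₂ nl₂ C₂ d pc regs mds m hreq hc₁ hc₂ hj hpc hcons
      hstab h₁ h₂ ih₁ ih₂ =>
    have hb := h₁.bounds
    simp only [AProg.length_text] at hb
    rcases hpc.lt_or_eq with hlt | rfl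
    · have hlt' : pc < PCs₁.text.length := by rwa [AProg.length_text]
      have hE := hj.embeds_left
      have hpc₀ : pc = ([] : Prog Val Opr Var Lock Reg).length + pc := by simp
      obtain ⟨j, regs', mds', m', hj', rfl, hs⟩ := hE.step (P := PCs₁.text ++ PCs₂.text) rfl
        hlt' hpc₀ hx
      obtain ⟨d', hn, hr⟩ := ih₁ hs
      rw [AProg.length_text] at hj'
      rw [stepsAt_seq fun hd => (hE.isEpilogueStep_iff (P := PCs₁.text ++ PCs₂.text) rfl
        hlt' hpc₀).2 (hb.2.2 hd hlt), hE.stepsAt_eq (P := PCs₁.text ++ PCs₂.text) rfl hlt' hpc₀]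
      refine ⟨_, nSteps_seq hn c₂, ?_⟩
      simp only [List.length_nil, Nat.zero_add]
      exact .seq (hreq := hreq) (hc₁ := hc₁) (hc₂ := hc₂) (hj := hj) (hpc := hj')
        (hcons := consistent_step hc₁ hreq hcons hs)
        (hstab := stable_recAt hc₁ hreq.2.2.2 j) (h₁ := hr) (h₂ := h₂)
    -- At the seam the source is `stop; c₂`. The step is the first one of `P₂`, simulated by the
    -- premise on initial configurations of `c₂` and preceded by the removal of `stop`.
    · obtain rfl : d = .stopped := hb.2.1 rfl
      obtain ⟨hne, -, hhead, -⟩ := compileCmd_head hc₂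
      have hlt' : 0 < PCs₂.text.length := by
        rw [AProg.length_text]
        exact List.length_pos_iff.2 hne
      have hE := hj.embeds_right
      have hP : PCs₁.text ++ PCs₂.text = PCs₁.text ++ PCs₂.text ++ [] := by simp
      have hpc₀ : PCs₁.length = PCs₁.text.length + 0 := by simp [AProg.length_text]
      obtain ⟨j, regs', mds', m', hj', rfl, hs⟩ := hE.step hP hlt' hpc₀ hx
      rw [AProg.recAt_length] at hcons hstab
      obtain ⟨d', hn, hr⟩ := ih₂ _ _ _ hcons hstab hs
      have hi : PCs₂.text[0]? = some PCs₂.text[0] := List.getElem?_eq_getElem hlt'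
      obtain ⟨hh₁, hh₂⟩ := hhead _ hi
      -- Compiled code never begins with an epilogue step or a `jmp`, so the last of the three
      -- situations of `absSteps` applies.
      have hsteps : stepsAt (PCs₁.text ++ PCs₂.text) PCs₁.length (.seq .stopped c₂) =
          stepsAt PCs₂.text 0 c₂ + 1 := by
        rw [hE.stepsAt_eq hP hlt' hpc₀]
        unfold stepsAt
        rw [absSteps, if_pos rfl, if_neg, if_neg]
        · rintro ⟨y, hy⟩
          rw [hi] at hy
          exact hh₂ y (by simpa using hy)
        · rintro (⟨y, hy⟩ | ⟨y, z, hy, -⟩)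
          · rw [hi] at hy
            exact hh₁ (by rw [Option.some.inj hy])
          · rw [hi] at hy
            exact hh₂ z (by rw [Option.some.inj hy])
      rw [hsteps]
      refine ⟨d', ⟨_, .seqStop _ _ _, hn⟩, ?_⟩
      exact .join (hj := hj) (hpc := by omega) (h := by simpa using hr)
  | join P₁ P₂ c pc regs mds m hj hpc h ih =>
    have hlt : pc - P₁.length < P₂.length := by
      obtain ⟨l, i, hi, -⟩ := rstep_iff.1 hx
      have := (List.getElem?_eq_some_iff.1 hi).1
      rw [List.length_append] at this
      omega
    have hP : P₁ ++ P₂ = P₁ ++ P₂ ++ [] := by simp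
    have hpc₀ : pc = P₁.length + (pc - P₁.length) := by omega
    obtain ⟨j, regs', mds', m', hj', rfl, hs⟩ := hj.embeds_right.step hP hlt hpc₀ hx
    obtain ⟨d', hn, hr⟩ := ih hs
    rw [hj.embeds_right.stepsAt_eq hP hlt hpc₀]
    exact ⟨d', hn, .join (hj := hj) (hpc := by omega) (h := by simpa using hr)⟩
  | if_expr C l nl e c₁ c₂ PCs l' nl₂ C' Pe r C₁ PCs₁ l₁ nl₁ C₂ PCs₂ l₂ C₃ pc regs mds m hreq hc
      he hc₁ hc₂ hpc hcons hstab h₁ h₂ ih₁ ih₂ =>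
    have L := iteLayout hc he hc₁ hc₂ hreq.2.1
    rcases hpc.lt_or_eq with hlt | rfl
    · obtain ⟨l₀, i, hi, hev⟩ := L.eval pc hlt
      simp only
      rw [stepsAt_of_isEval hi hev (.inr ⟨_, _, _, rfl⟩)]
      obtain ⟨regs', rfl⟩ := eval_step hi hev hx
      exact ⟨_, rfl, .if_expr (hreq := hreq) (hc := hc) (he := he) (hc₁ := hc₁) (hc₂ := hc₂)
        (hpc := hlt) (hcons := consistent_step hc hreq hcons hx)
        (hstab := stable_recAt hc hreq.2.2.2 _) (h₁ := h₁) (h₂ := h₂)⟩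
    · obtain ⟨l₀, y, hi, hres⟩ := L.jz
      simp only
      rw [stepsAt_ite_jz hi]
      have hcons' := fun pc' regs' mds' m' => consistent_step (pc' := pc') (regs' := regs')
        (mds' := mds') (m' := m') hc hreq hcons
      rw [L.recAt] at hcons hstab
      have hr := hcons.1 _ _ (exprSpec_of_compileExpr he).result
      cases step_eq hi hx
      simp only [exec, confOf, hres, hr] at hx ⊢
      split_ifs at hx ⊢ with hz
      · refine ⟨_, nSteps_one (.iteFalse _ _ _ _ _ hz), ?_⟩
        exact .if_c2 (hreq := hreq) (hc := hc) (he := he) (hc₁ := hc₁) (hc₂ := hc₂)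
          (hpc₂ := L.snd_pos) (hpc := rfl) (hcons := hcons' _ _ _ _ hx)
          (hstab := stable_recAt hc hreq.2.2.2 _) (h := h₂ _ _ _ hcons hstab)
      · refine ⟨_, nSteps_one (.iteTrue _ _ _ _ _ hz), ?_⟩
        exact .if_c1 (hreq := hreq) (hc := hc) (he := he) (hc₁ := hc₁) (hc₂ := hc₂)
          (hpc₁ := L.fst_pos) (hpc := rfl) (hcons := hcons' _ _ _ _ hx)
          (hstab := stable_recAt hc hreq.2.2.2 _) (h := h₁ _ _ _ hcons hstab)
  | if_c1 C l nl e c₁ c₂ PCs l' nl₂ C' Pe r C₁ PCs₁ l₁ nl₁ C₂ PCs₂ l₂ C₃ d pc₁ pc regs mds m hreq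
      hc he hc₁ hc₂ hpc₁ hpc hcons hstab h ih =>
    have L := iteLayout hc he hc₁ hc₂ hreq.2.1
    have hlen := L.length
    obtain ⟨A, B, hE, hP, hA⟩ := L.fst
    have hlt : pc₁ < PCs₁.text.length := by rwa [AProg.length_text]
    have hpc₀ : pc = A.length + pc₁ := by omega
    have hx₀ := hx
    obtain ⟨j, regs', mds', m', hj, rfl, hs⟩ := hE.step hP hlt hpc₀ hx
    obtain ⟨d', hn, hr⟩ := ih hs
    have hb := hr.bounds
    simp only [AProg.length_text] at hj hb
    rw [hE.stepsAt_eq hP hlt hpc₀]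
    refine ⟨d', hn, ?_⟩
    rcases hj.lt_or_eq with hj | rfl
    · exact .if_c1 (hreq := hreq) (hc := hc) (he := he) (hc₁ := hc₁) (hc₂ := hc₂)
        (hpc₁ := hj) (hpc := by omega) (hcons := consistent_step hc hreq hcons hx₀)
        (hstab := stable_recAt hc hreq.2.2.2 _) (h := hr)
    -- After the first branch, the forward `jmp` to the end is an epilogue step of the terminated
    -- source program.
    · obtain rfl : d' = .stopped := hb.2.1 rfl
      obtain ⟨l₀, y, hi, hres⟩ := L.jmp
      rw [hA]
      refine .epilogue_step (hp := .inr ⟨_, _, hi, by omega⟩) 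
        (h := fun pc' regs'' mds'' m'' hst => ?_)
      cases step_eq hi hst
      exact .of_pc_eq (hres.trans PCs.length_text.symm)
  | if_c2 C l nl e c₁ c₂ PCs l' nl₂ C' Pe r C₁ PCs₁ l₁ nl₁ C₂ PCs₂ l₂ C₃ d pc₂ pc regs mds m hreq
      hc he hc₁ hc₂ hpc₂ hpc hcons hstab h ih =>
    have L := iteLayout hc he hc₁ hc₂ hreq.2.1
    have hlen := L.length
    obtain ⟨A, B, hE, hP, hA⟩ := L.snd
    have hlt : pc₂ < PCs₂.text.length := by rwa [AProg.length_text]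
    have hpc₀ : pc = A.length + pc₂ := by omega
    have hx₀ := hx
    obtain ⟨j, regs', mds', m', hj, rfl, hs⟩ := hE.step hP hlt hpc₀ hx
    obtain ⟨d', hn, hr⟩ := ih hs
    have hb := hr.bounds
    simp only [AProg.length_text] at hj hb
    rw [hE.stepsAt_eq hP hlt hpc₀]
    refine ⟨d', hn, ?_⟩
    rcases hj.lt_or_eq with hj | rfl
    · exact .if_c2 (hreq := hreq) (hc := hc) (he := he) (hc₁ := hc₁) (hc₂ := hc₂)
        (hpc₂ := hj) (hpc := by omega) (hcons := consistent_step hc hreq hcons hx₀)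
        (hstab := stable_recAt hc hreq.2.2.2 _) (h := hr)
    · obtain rfl : d' = .stopped := hb.2.1 rfl
      obtain ⟨l₀, hi⟩ := L.epi
      rw [hA]
      refine .epilogue_step (hp := .inl ⟨_, hi⟩) (h := fun pc' regs'' mds'' m'' hst => ?_)
      cases step_eq hi hst
      exact .of_pc_eq (hlen.symm.trans PCs.length_text.symm)
  | epilogue_step pc P regs mds m hp h ih =>
    obtain ⟨pc', rfl, -⟩ := hp.step_iff hx
    exact ⟨_, rfl, h _ _ _ _ hx⟩
  | while_expr C l nl e c PCs l' nl₁ C' Pe r C₁ PCs₁ l₁ C₂ d pc regs mds m hreq hc he hc₁ hd hcons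
      hstab h ih =>
    have L := whileLayout hc he hc₁ hreq.2.1
    have hpos := L.expr_pos
    rcases lt_or_ge pc Pe.length with hlt | hge
    · obtain ⟨l₀, i, hi, hev⟩ := L.eval pc hlt
      obtain ⟨regs', rfl⟩ := eval_step hi hev hx
      refine ⟨.ite e (.seq c (.while e c)) .stopped, ?_,
        .while_expr (hreq := hreq) (hc := hc) (he := he) (hc₁ := hc₁)
        (hd := .inr ⟨by omega, hlt, rfl⟩) (hcons := consistent_step hc hreq hcons hx)
        (hstab := stable_recAt hc hreq.2.2.2 _) (h := h)⟩
      -- At position 0 the loop is unfolded; at later evaluation instructions the source already is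
      -- the conditional and waits.
      rcases hd with ⟨rfl, rfl⟩ | ⟨-, -, rfl⟩
      · exact nSteps_one (.while _ _ _ _)
      · simp only
        rw [stepsAt_of_isEval hi hev (.inr ⟨_, _, _, rfl⟩)]
        rfl
    -- The `jz` is not at position 0, since evaluation code of a loop is nonempty; so the loop has
    -- been unfolded before the test.
    · rcases hd with ⟨rfl, rfl⟩ | ⟨-, hle, rfl⟩
      · omega
      obtain rfl : pc = Pe.length := le_antisymm hle hge
      obtain ⟨l₀, y, hi, hres⟩ := L.jz
      simp only
      rw [stepsAt_ite_jz hi]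
      have hcons' := fun pc' regs' mds' m' => consistent_step (pc' := pc') (regs' := regs')
        (mds' := mds') (m' := m') hc hreq hcons
      rw [L.recAt] at hcons hstab
      have hr := hcons.1 _ _ (exprSpec_of_compileExpr he).result
      cases step_eq hi hx
      simp only [exec, confOf, hres, hr] at hx ⊢
      split_ifs at hx ⊢ with hz
      · exact ⟨_, nSteps_one (.iteFalse _ _ _ _ _ hz), .of_pc_eq PCs.length_text.symm⟩
      · refine ⟨_, nSteps_one (.iteTrue _ _ _ _ _ hz), ?_⟩
        exact .while_inner (hreq := hreq) (hc := hc) (he := he) (hc₁ := hc₁)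
          (hpc₁ := L.body_pos) (hpc := rfl) (hcons := hcons' _ _ _ _ hx)
          (hstab := stable_recAt hc hreq.2.2.2 _) (h := h _ _ _ hcons hstab) (h' := h)
  | while_inner C l nl e c PCs l' nl₁ C' Pe r C₁ PCs₁ l₁ C₂ d pc₁ pc regs mds m hreq hc he hc₁ hpc₁
      hpc hcons hstab h h' ih ih' =>
    have L := whileLayout hc he hc₁ hreq.2.1
    obtain ⟨A, B, hE, hP, hA⟩ := L.body
    have hb₀ := h.bounds
    have hlt : pc₁ < PCs₁.text.length := by rwa [AProg.length_text]
    have hpc₀ : pc = A.length + pc₁ := by omega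
    have hx₀ := hx
    obtain ⟨j, regs', mds', m', hj, rfl, hs⟩ := hE.step hP hlt hpc₀ hx
    obtain ⟨d', hn, hr⟩ := ih hs
    have hb := hr.bounds
    simp only [AProg.length_text] at hj hb
    rw [stepsAt_seq fun hd => (hE.isEpilogueStep_iff hP hlt hpc₀).2 (hb₀.2.2 hd hlt),
      hE.stepsAt_eq hP hlt hpc₀]
    refine ⟨_, nSteps_seq hn _, ?_⟩
    rcases hj.lt_or_eq with hj | rfl
    · exact .while_inner (hreq := hreq) (hc := hc) (he := he) (hc₁ := hc₁)
        (hpc₁ := hj) (hpc := by omega) (hcons := consistent_step hc hreq hcons hx₀)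
        (hstab := stable_recAt hc hreq.2.2.2 _) (h := hr) (h' := h')
    -- The body is finished and only the jump back is left, which belongs to the case `while_loop`.
    · obtain rfl : d' = .stopped := hb.2.1 rfl
      exact .while_loop (hreq := hreq) (hc := hc) (he := he) (hc₁ := hc₁)
        (hpc₁ := le_rfl) (hpc := by omega) (hcons := consistent_step hc hreq hcons hx₀)
        (hstab := stable_recAt hc hreq.2.2.2 _) (h := hr) (h' := h')
  | while_loop C l nl e c PCs l' nl₁ C' Pe r C₁ PCs₁ l₁ C₂ pc₁ pc regs mds m hreq hc he hc₁ hpc₁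
      hpc hcons hstab h h' ih ih' =>
    have L := whileLayout hc he hc₁ hreq.2.1
    rcases hpc₁.lt_or_eq with hpc₁ | rfl
    · obtain ⟨A, B, hE, hP, hA⟩ := L.body
      have hb₀ := h.bounds
      have hlt : pc₁ < PCs₁.text.length := by rwa [AProg.length_text]
      have hpc₀ : pc = A.length + pc₁ := by omega
      have hx₀ := hx
      obtain ⟨j, regs', mds', m', hj, rfl, hs⟩ := hE.step hP hlt hpc₀ hx
      obtain ⟨d', hn, hr⟩ := ih hs
      simp only [AProg.length_text] at hj
      rw [stepsAt_seq fun hd => (hE.isEpilogueStep_iff hP hlt hpc₀).2 (hb₀.2.2 hd hlt),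
        hE.stepsAt_eq hP hlt hpc₀]
      refine ⟨_, nSteps_seq hn _, ?_⟩
      -- The simulation of `stop` takes zero steps.
      obtain rfl : d' = .stopped := by
        have hn' : nSteps (WStep T) 0 (⟨.stopped, mds, m⟩ : WConf Val Opr Var Lock)
          ⟨d', mds', m'⟩ := hn
        cases hn'
        rfl
      exact .while_loop (hreq := hreq) (hc := hc) (he := he) (hc₁ := hc₁)
        (hpc₁ := hj) (hpc := by omega) (hcons := consistent_step hc hreq hcons hx₀)
        (hstab := stable_recAt hc hreq.2.2.2 _) (h := hr) (h' := h')
    · obtain ⟨l₀, y, hi, hres⟩ := L.jmp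
      rw [← hpc] at hi
      -- The jump to the loop head resolves to position 0, so it is not forward and hence no
      -- epilogue step.
      have hn : stepsAt PCs.text pc (.seq .stopped (.while e c)) = 1 := by
        unfold stepsAt
        rw [absSteps, if_pos rfl, if_neg, if_pos ⟨y, by rw [hi]; rfl⟩]
        rintro (⟨z, hz⟩ | ⟨z, w, hz, hlt⟩)
        · rw [hi] at hz
          cases hz
        · rw [hi] at hz
          cases hz
          omega
      have hx₀ := hx
      cases step_eq hi hx
      simp only [exec, confOf, hres] at hx₀ ⊢
      rw [hn]
      refine ⟨_, nSteps_one (.seqStop _ _ _), ?_⟩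
      exact .while_expr (hreq := hreq) (hc := hc) (he := he) (hc₁ := hc₁)
        (hd := .inl ⟨rfl, rfl⟩) (hcons := consistent_step hc hreq hcons hx₀)
        (hstab := stable_recAt hc hreq.2.2.2 _) (h := h')

end Simulation

section Control

variable {Val Opr Var Lock Reg : Type*} {T : Params Val Opr Var Lock Reg}
  {a : WConf Val Opr Var Lock} {c : RConf Val Opr Var Lock Reg}

/-! ### Control flow of related configurations -/

/-- The command that is executed next, apart from the removal of terminated commands. -/
def activeCmd : Cmd Val Opr Var Lock → Cmd Val Opr Var Lock
  | .seq c₁ c₂ => if c₁ = .stopped then activeCmd c₂ else activeCmd c₁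
  | c => c

/-- What the source command `d` knows about an instruction whose control flow is not static. -/
def ControlSpec (T : Params Val Opr Var Lock Reg) (d : Cmd Val Opr Var Lock) (regs : Reg → Val)
    (m : Mem Val Var Lock) : Instr Val Opr Var Lock Reg → Prop
  | .jz _ r => ∃ e c₁ c₂, activeCmd d = .ite e c₁ c₂ ∧ regs r = evExp T m e
  | .lockAcq k => activeCmd d = .lockAcq k
  | _ => True

theorem controlSpec_of_isEval {d : Cmd Val Opr Var Lock} {regs : Reg → Val}
    {m : Mem Val Var Lock} {i : Instr Val Opr Var Lock Reg} (h : IsEval i) :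
    ControlSpec T d regs m i := by
  cases i
  all_goals first | exact h.elim | trivial

theorem controlSpec_of_isEpilogueStep {P : Prog Val Opr Var Lock Reg} {pc : ℕ} {l : Option Lab}
    {i : Instr Val Opr Var Lock Reg} (hi : P[pc]? = some (l, i)) (h : isEpilogueStep P pc)
    {d : Cmd Val Opr Var Lock} {regs : Reg → Val} {m : Mem Val Var Lock} :
    ControlSpec T d regs m i := by
  rcases h with ⟨l', h⟩ | ⟨l', x, h, -⟩
  all_goals
    rw [hi] at h
    cases h
    trivial

theorem ControlSpec.seq {d : Cmd Val Opr Var Lock} {regs : Reg → Val}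
    {m : Mem Val Var Lock} {i : Instr Val Opr Var Lock Reg} (h : ControlSpec T d regs m i)
    (hd : d ≠ .stopped) (c : Cmd Val Opr Var Lock) : ControlSpec T (.seq d c) regs m i := by
  cases i
  case jz => simpa only [ControlSpec, activeCmd, if_neg hd] using h
  case lockAcq => simpa only [ControlSpec, activeCmd, if_neg hd] using h
  all_goals trivial

theorem ControlSpec.seq_stopped {d : Cmd Val Opr Var Lock} {regs : Reg → Val}
    {m : Mem Val Var Lock} {i : Instr Val Opr Var Lock Reg} (h : ControlSpec T d regs m i) :
    ControlSpec T (.seq .stopped d) regs m i := by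
  cases i
  case jz => simpa only [ControlSpec, activeCmd, if_pos] using h
  case lockAcq => simpa only [ControlSpec, activeCmd, if_pos] using h
  all_goals trivial

/-- The command concerned is the active one, not the leftmost one: at the start of a second part the
source still carries a `stop` that has no instruction of its own. At a `jz` the equation for the
register is consistency with the annotation. -/
theorem RwrRel.controlSpec (h : RwrRel T a c) {l : Option Lab} {i : Instr Val Opr Var Lock Reg}
    (hi : c.tps.prog[c.tps.pc]? = some (l, i)) : ControlSpec T a.tps c.tps.regs a.mem i := by
  induction h generalizing l i with
  | stopped => simp at hi
  | skip_nop =>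
    cases hi
    trivial
  | assign_expr C l nl v e PCs l' nl' C' Pe r C₁ pc regs mds m hreq hc he hpc hcons hstab =>
    obtain ⟨l₀, j, hj, hev⟩ := (assignLayout hc he).eval pc hpc
    cases hj.symm.trans hi
    exact controlSpec_of_isEval hev
  | assign_store C l nl v e PCs l' nl' C' Pe r C₁ pc regs mds m hreq hc he hpc hcons hstab hwr =>
    obtain ⟨l₀, hj⟩ := (assignLayout hc he).store
    subst hpc
    cases hj.symm.trans hi
    trivial
  | lock_acq =>
    cases hi
    rfl
  | lock_rel =>
    cases hi
    trivial
  | seq C l nl c₁ PCs₁ l₁ nl₁ C₁ c₂ PCs₂ l₂ nl₂ C₂ d pc regs mds m hreq hc₁ hc₂ hj hpc hcons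
      hstab h₁ h₂ ih₁ ih₂ =>
    have hb := h₁.bounds
    simp only at hi
    rcases hpc.lt_or_eq with hlt | rfl
    · have hlt' : pc < PCs₁.text.length := by rwa [AProg.length_text]
      rw [List.getElem?_append_left hlt'] at hi
      by_cases hd : d = .stopped
      -- A terminated part before its end is in its epilogue, whose control flow is static.
      · exact controlSpec_of_isEpilogueStep hi (hb.2.2 hd hlt')
      · exact (ih₁ hi).seq hd _
    · obtain rfl : d = .stopped := hb.2.1 (AProg.length_text _).symm
      rw [← AProg.length_text, List.getElem?_append_right le_rfl, Nat.sub_self] at hi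
      rw [AProg.recAt_length] at hcons hstab
      exact (ih₂ _ _ _ hcons hstab hi).seq_stopped
  | join P₁ P₂ c pc regs mds m hj hpc h ih =>
    simp only at hi
    rw [List.getElem?_append_right hpc] at hi
    exact ih hi
  | if_expr C l nl e c₁ c₂ PCs l' nl₂ C' Pe r C₁ PCs₁ l₁ nl₁ C₂ PCs₂ l₂ C₃ pc regs mds m hreq hc
      he hc₁ hc₂ hpc hcons hstab h₁ h₂ ih₁ ih₂ =>
    have L := iteLayout hc he hc₁ hc₂ hreq.2.1
    rcases hpc.lt_or_eq with hlt | rfl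
    · obtain ⟨l₀, j, hj, hev⟩ := L.eval pc hlt
      cases hj.symm.trans hi
      exact controlSpec_of_isEval hev
    · obtain ⟨l₀, x, hj, -⟩ := L.jz
      cases hj.symm.trans hi
      rw [L.recAt] at hcons
      exact ⟨_, _, _, rfl, hcons.1 _ _ (exprSpec_of_compileExpr he).result⟩
  | if_c1 C l nl e c₁ c₂ PCs l' nl₂ C' Pe r C₁ PCs₁ l₁ nl₁ C₂ PCs₂ l₂ C₃ d pc₁ pc regs mds m hreq
      hc he hc₁ hc₂ hpc₁ hpc hcons hstab h ih =>
    obtain ⟨A, B, hE, hP, hA⟩ := (iteLayout hc he hc₁ hc₂ hreq.2.1).fst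
    simp only at hi
    rw [hP, hpc, ← hA, getElem?_embed _ _ _ (by rwa [AProg.length_text])] at hi
    exact ih hi
  | if_c2 C l nl e c₁ c₂ PCs l' nl₂ C' Pe r C₁ PCs₁ l₁ nl₁ C₂ PCs₂ l₂ C₃ d pc₂ pc regs mds m hreq
      hc he hc₁ hc₂ hpc₂ hpc hcons hstab h ih =>
    obtain ⟨A, B, hE, hP, hA⟩ := (iteLayout hc he hc₁ hc₂ hreq.2.1).snd
    simp only at hi
    rw [hP, hpc, ← hA, getElem?_embed _ _ _ (by rwa [AProg.length_text])] at hi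
    exact ih hi
  | epilogue_step pc P regs mds m hp h ih => exact controlSpec_of_isEpilogueStep hi hp
  | while_expr C l nl e c PCs l' nl₁ C' Pe r C₁ PCs₁ l₁ C₂ d pc regs mds m hreq hc he hc₁ hd hcons
      hstab h ih =>
    have L := whileLayout hc he hc₁ hreq.2.1
    have hpos := L.expr_pos
    rcases lt_or_ge pc Pe.length with hlt | hge
    · obtain ⟨l₀, j, hj, hev⟩ := L.eval pc hlt
      cases hj.symm.trans hi
      exact controlSpec_of_isEval hev
    · rcases hd with ⟨rfl, rfl⟩ | ⟨-, hle, rfl⟩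
      · omega
      obtain rfl : pc = Pe.length := le_antisymm hle hge
      obtain ⟨l₀, x, hj, -⟩ := L.jz
      cases hj.symm.trans hi
      rw [L.recAt] at hcons
      exact ⟨_, _, _, rfl, hcons.1 _ _ (exprSpec_of_compileExpr he).result⟩
  | while_inner C l nl e c PCs l' nl₁ C' Pe r C₁ PCs₁ l₁ C₂ d pc₁ pc regs mds m hreq hc he hc₁ hpc₁
      hpc hcons hstab h h' ih ih' =>
    obtain ⟨A, B, hE, hP, hA⟩ := (whileLayout hc he hc₁ hreq.2.1).body
    have hlt : pc₁ < PCs₁.text.length := by rwa [AProg.length_text]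
    simp only at hi
    rw [hP, hpc, ← hA, getElem?_embed _ _ _ hlt] at hi
    by_cases hd : d = .stopped
    · exact controlSpec_of_isEpilogueStep hi (h.bounds.2.2 hd hlt)
    · exact (ih hi).seq hd _
  | while_loop C l nl e c PCs l' nl₁ C' Pe r C₁ PCs₁ l₁ C₂ pc₁ pc regs mds m hreq hc he hc₁ hpc₁
      hpc hcons hstab h h' ih ih' =>
    have L := whileLayout hc he hc₁ hreq.2.1
    rcases hpc₁.lt_or_eq with hpc₁ | rfl
    · obtain ⟨A, B, hE, hP, hA⟩ := L.body
      have hlt : pc₁ < PCs₁.text.length := by rwa [AProg.length_text]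
      simp only at hi
      rw [hP, hpc, ← hA, getElem?_embed _ _ _ hlt] at hi
      exact controlSpec_of_isEpilogueStep hi (h.bounds.2.2 rfl hlt)
    · obtain ⟨l₀, x, hj, -⟩ := L.jmp
      subst hpc
      cases hj.symm.trans hi
      trivial

end Control

/-! ### Low-bisimulations on source configurations -/

section Bisim

variable {Val Opr Var Lock Reg : Type*} {T : Params Val Opr Var Lock Reg}
  {B : Set (WConf Val Opr Var Lock × WConf Val Opr Var Lock)}

theorem strongLowBisimMM.nSteps {TPS : Type*}
    {step : LocalConf TPS Val Var Lock → LocalConf TPS Val Var Lock → Prop}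
    {B : Set (LocalConf TPS Val Var Lock × LocalConf TPS Val Var Lock)}
    (hB : strongLowBisimMM T step B) {n : ℕ} {a₁ a₂ a₁' : LocalConf TPS Val Var Lock}
    (hab : (a₁, a₂) ∈ B) (hmds : a₁.mds = a₂.mds) (hn : nSteps step n a₁ a₁') :
    ∃ a₂', WR.nSteps step n a₂ a₂' ∧ a₁'.mds = a₂'.mds ∧ (a₁', a₂') ∈ B := by
  induction n generalizing a₁ a₂ with
  | zero =>
    cases hn
    exact ⟨_, rfl, hmds, hab⟩
  | succ n ih =>
    obtain ⟨x, hx, hn⟩ := hn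
    obtain ⟨y, hy, hxy, hb⟩ := (hB.2.2 _ _ hab hmds).2 _ hx
    obtain ⟨a₂', hn', h⟩ := ih hb hxy hn
    exact ⟨a₂', ⟨y, hy, hn'⟩, h⟩

/-- Leading occurrences of `stop` are removed by steps that ignore mode state and memory, so one
count and one resulting command serve all memories. -/
theorem nSteps_activeCmd (T : Params Val Opr Var Lock Reg) (d : Cmd Val Opr Var Lock) :
    ∃ n d', leftmostCmd d' = activeCmd d ∧
      ∀ mds m, nSteps (WStep T) n ⟨d, mds, m⟩ ⟨d', mds, m⟩ := by
  induction d with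
  | seq c₁ c₂ ih₁ ih₂ =>
    by_cases h : c₁ = .stopped
    · subst h
      obtain ⟨n, d', hd, hn⟩ := ih₂
      exact ⟨n + 1, d', by rw [hd, activeCmd, if_pos rfl], fun mds m =>
        ⟨_, .seqStop _ _ _, hn mds m⟩⟩
    · obtain ⟨n, d', hd, hn⟩ := ih₁
      exact ⟨n, .seq d' c₂, by rw [leftmostCmd, hd, activeCmd, if_neg h], fun mds m =>
        nSteps_seq (hn mds m) c₂⟩
  | _ => exact ⟨0, _, rfl, fun _ _ => rfl⟩

/-- Non-High-branching speaks of leftmost commands only. Running both sides past leading `stop`s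
stays in `B` and makes it applicable to the active command. -/
theorem strongLowBisimMM.activeCmd (hB : strongLowBisimMM T (WStep T) B)
    {d : Cmd Val Opr Var Lock} {mds : Mds Var Lock} {m₁ m₂ : Mem Val Var Lock}
    (h : ((⟨d, mds, m₁⟩ : WConf Val Opr Var Lock), (⟨d, mds, m₂⟩ : WConf Val Opr Var Lock)) ∈ B) :
    ∃ d', leftmostCmd d' = WR.activeCmd d ∧
      ((⟨d', mds, m₁⟩ : WConf Val Opr Var Lock), (⟨d', mds, m₂⟩ : WConf Val Opr Var Lock)) ∈ B := by
  obtain ⟨n, d', hd, hn⟩ := nSteps_activeCmd T d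
  obtain ⟨a₂', hn', -, hb⟩ := hB.nSteps h rfl (hn mds m₁)
  obtain rfl := nSteps_det (wstep_det T) hn' (hn mds m₂)
  exact ⟨d', hd, hb⟩

theorem wstep_lockAcq_free {d : Cmd Val Opr Var Lock} {k : Lock} (hd : leftmostCmd d = .lockAcq k)
    (mds : Mds Var Lock) {m : Mem Val Var Lock} (hm : m (.lock k) = T.lockFree) :
    ∃ d', leftmostCmd d' = .stopped ∧
      WStep T ⟨d, mds, m⟩ ⟨d', lockAcqUpd T k mds, upd m (.lock k) T.lockTaken⟩ := by
  induction d with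
  | seq c₁ c₂ ih₁ _ =>
    obtain ⟨d', hd', hs⟩ := ih₁ hd
    exact ⟨.seq d' c₂, hd', .seq _ _ _ _ _ _ _ hs⟩
  | _ =>
    cases hd
    try exact ⟨_, rfl, .lockAcq _ _ _ hm⟩

theorem wstep_lockAcq_taken {d : Cmd Val Opr Var Lock} {k : Lock} (hd : leftmostCmd d = .lockAcq k)
    (mds : Mds Var Lock) {m : Mem Val Var Lock} (hm : m (.lock k) ≠ T.lockFree) :
    WStep T ⟨d, mds, m⟩ ⟨d, mds, m⟩ := by
  induction d with
  | seq c₁ c₂ ih₁ _ => exact .seq _ _ _ _ _ _ _ (ih₁ hd)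
  | _ =>
    cases hd
    try exact .lockSpin _ _ _ hm

/-- Related configurations agree on whether the next lock is free. -/
theorem lockFree_of_bisim (hB : strongLowBisimMM T (WStep T) B) (hnhb : noHighBranching T B)
    {d : Cmd Val Opr Var Lock} {mds : Mds Var Lock} {m₁ m₂ : Mem Val Var Lock}
    (h : ((⟨d, mds, m₁⟩ : WConf Val Opr Var Lock), (⟨d, mds, m₂⟩ : WConf Val Opr Var Lock)) ∈ B)
    {k : Lock} (hd : activeCmd d = .lockAcq k) (hm : m₁ (.lock k) = T.lockFree) :
    m₂ (.lock k) = T.lockFree := by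
  -- Low-equivalence does not decide this, since an arbitrary mode state may make a lock variable
  -- unreadable. Instead, let the first run acquire while the second one spins. `B` would then
  -- relate a command whose leftmost part is `stop` to one whose leftmost part is still `lockAcq`.
  obtain ⟨d₀, hd₀, hb⟩ := hB.activeCmd h
  rw [hd] at hd₀
  by_contra hm₂
  obtain ⟨d', hd', hs⟩ := wstep_lockAcq_free hd₀ mds hm
  obtain ⟨x, hx, hmds, hb'⟩ := (hB.2.2 _ _ hb rfl).2 _ hs
  obtain rfl := wstep_det T _ _ _ hx (wstep_lockAcq_taken hd₀ mds hm₂)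
  simp only at hmds
  rw [hmds] at hb'
  have := (hnhb _ _ _ _ _ hb').1
  rw [this, hd₀] at hd'
  cases hd'

/-- Only the positions are compared; registers and memories of the two runs may differ. -/
theorem exec_pc_eq (hB : strongLowBisimMM T (WStep T) B) (hnhb : noHighBranching T B)
    {d : Cmd Val Opr Var Lock} {mds : Mds Var Lock} {m₁ m₂ : Mem Val Var Lock}
    (h : ((⟨d, mds, m₁⟩ : WConf Val Opr Var Lock), (⟨d, mds, m₂⟩ : WConf Val Opr Var Lock)) ∈ B)
    {regs₁ regs₂ : Reg → Val} {i : Instr Val Opr Var Lock Reg}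
    (h₁ : ControlSpec T d regs₁ m₁ i) (h₂ : ControlSpec T d regs₂ m₂ i) (f : Lab → ℕ) (pc : ℕ) :
    (exec T f pc regs₁ mds m₁ i).1 = (exec T f pc regs₂ mds m₂ i).1 := by
  cases i
  case jz x r =>
    obtain ⟨e, c₁, c₂, he, hr₁⟩ := h₁
    obtain ⟨e', c₁', c₂', he', hr₂⟩ := h₂
    cases he.symm.trans he'
    obtain ⟨d', hd', hb⟩ := hB.activeCmd h
    have := (hnhb _ _ _ _ _ hb).2 e c₁ c₂ (hd'.trans he)
    simp only [exec, hr₁, hr₂, this]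
  case lockAcq k =>
    have : m₁ (.lock k) = T.lockFree ↔ m₂ (.lock k) = T.lockFree :=
      ⟨lockFree_of_bisim hB hnhb h h₁, lockFree_of_bisim hB hnhb (hB.2.1 _ _ h) h₁⟩
    simp only [exec, this]
    split_ifs <;> rfl
  case lockRel k =>
    simp only [exec]
    split_ifs <;> rfl
  all_goals rfl

/-- Both `RISC` runs execute the same instruction, so the second has a step as well. Simulating each
step separately yields the lower faces of the cube with the same number of source steps, and
determinism identifies the given second source run with the simulated one. -/
theorem couplingInvPres_Rwr (hB : strongLowBisimMM T (WStep T) B) (hnhb : noHighBranching T B) :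
    couplingInvPres (WStep T) (RStep T) B (Rwr T) (Iwr Val Opr Var Lock Reg) := by
  rintro ⟨d, mds, m₁⟩ ⟨⟨pc, P, regs₁⟩, mdsC, mC⟩ hR x hx
  have hR : RwrRel T ⟨d, mds, m₁⟩ ⟨⟨pc, P, regs₁⟩, mdsC, mC⟩ := hR
  obtain ⟨h₁, h₂⟩ := hR.modesMem
  simp only at h₁ h₂
  subst h₁ h₂
  obtain ⟨d', hn, hR'⟩ := hR.simulated hx
  refine ⟨_, _, hn, hR', ?_⟩
  rintro ⟨d₂, mds₂, m₂⟩ ⟨⟨pc₂, P₂, regs₂⟩, mdsC, mC⟩ a₂' hb hmds hR₂ ⟨hpc, hP⟩ - hn₂ hmds'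
  have hR₂ : RwrRel T ⟨d₂, mds₂, m₂⟩ ⟨⟨pc₂, P₂, regs₂⟩, mdsC, mC⟩ := hR₂
  obtain ⟨h₁, h₂⟩ := hR₂.modesMem
  simp only at h₁ h₂ hmds hpc hP
  subst h₁ h₂ hmds hpc hP
  obtain rfl := (hnhb _ _ _ _ _ hb).1
  obtain ⟨l, i, hi, rfl⟩ := rstep_iff.1 hx
  have hx₂ := rstep_iff (T := T) (regs := regs₂) (mds := mds) (m := m₂).2 ⟨l, i, hi, rfl⟩
  obtain ⟨d₂', hn₂', hR₂'⟩ := hR₂.simulated hx₂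
  obtain rfl := nSteps_det (wstep_det T) hn₂ hn₂'
  exact ⟨_, hx₂, hmds', hR₂', exec_pc_eq hB hnhb hb (hR.controlSpec hi) (hR₂.controlSpec hi) _ _,
    rfl⟩

end Bisim

/-! ### Low-equivalence and the induced relation -/

section Induced

variable {Val Opr Var Lock Reg TPA TPC : Type*} {T : Params Val Opr Var Lock Reg}

theorem classify_eq_of_controlVars {m₁ m₂ : Mem Val Var Lock}
    (h : ∀ x ∈ controlVars T, m₁ x = m₂ x) (x : Shared Var Lock) :
    T.classify m₁ x = T.classify m₂ x :=
  T.classify_congr _ _ _ fun y hy => h y ⟨x, hy⟩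

/-- Control variables agree unconditionally in low-equivalent memories. This makes low-equivalence
symmetric although its definition consults the classification of the first memory only. -/
theorem lowMdsEq.classify_eq {mds : Mds Var Lock} {m₁ m₂ : Mem Val Var Lock}
    (h : lowMdsEq T mds m₁ m₂) (x : Shared Var Lock) : T.classify m₁ x = T.classify m₂ x :=
  classify_eq_of_controlVars (fun y hy => h y (.inl hy)) x

theorem lowMdsEq.symm {mds : Mds Var Lock} {m₁ m₂ : Mem Val Var Lock}
    (h : lowMdsEq T mds m₁ m₂) : lowMdsEq T mds m₂ m₁ := fun x hx =>
  (h x (by rwa [h.classify_eq x])).symm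

theorem confLowMdsEq.symm {TPS : Type*} {lc₁ lc₂ : LocalConf TPS Val Var Lock}
    (h : confLowMdsEq T lc₁ lc₂) : confLowMdsEq T lc₂ lc₁ :=
  ⟨h.1.symm, h.1 ▸ h.2.symm⟩

/-- Secure refinement preserves strong low-bisimulations modulo modes. -/
theorem strongLowBisimMM_concreteBisim
    {stepA : LocalConf TPA Val Var Lock → LocalConf TPA Val Var Lock → Prop}
    {stepC : LocalConf TPC Val Var Lock → LocalConf TPC Val Var Lock → Prop}
    {B : Set (LocalConf TPA Val Var Lock × LocalConf TPA Val Var Lock)}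
    {R : Set (LocalConf TPA Val Var Lock × LocalConf TPC Val Var Lock)}
    {I : Set (LocalConf TPC Val Var Lock × LocalConf TPC Val Var Lock)}
    (hB : strongLowBisimMM T stepA B) (h : secureRefinement T stepA stepC B R I) :
    strongLowBisimMM T stepC (concreteBisim T B R I) := by
  obtain ⟨hmm, hco, hcg, hsym, hcip⟩ := h
  refine ⟨?_, ?_, ?_⟩
  · rintro t₁ m₁ t₂ m₂ mds ⟨⟨s₁, mdsA, mA⟩, ⟨s₂, mdsA', mA'⟩, hR₁, hR₂, hb, hlow, hI⟩ m₁' m₂' hw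
      hlow'
    obtain ⟨rfl, rfl⟩ := hmm _ _ hR₁
    obtain ⟨h₁, rfl⟩ := hmm _ _ hR₂
    simp only at h₁
    subst h₁
    refine ⟨⟨s₁, _, m₁'⟩, ⟨s₂, _, m₂'⟩, ?_, ?_, hB.1 _ _ _ _ _ hb _ _ hw hlow', ⟨rfl, hlow'⟩,
      hcg _ _ _ _ _ hI _ _ hw hlow'⟩
    · exact hco _ _ _ _ _ hR₁ fun x hx => hw x (hx.imp_right .inr)
    -- Global consistency bounds changes of classification in the first memory; they coincide with
    -- those in the second by low-equivalence before and after the change.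
    · refine hco _ _ _ _ _ hR₂ fun x hx => hw x (.inr (hx.imp_right fun hne => ?_))
      rwa [hlow.2.classify_eq x, hlow'.classify_eq x]
  · rintro c₁ c₂ ⟨a₁, a₂, hR₁, hR₂, hb, hlow, hI⟩
    exact ⟨a₂, a₁, hR₂, hR₁, hB.2.1 _ _ hb, hlow.symm, hsym _ _ hI⟩
  · rintro c₁ c₂ ⟨a₁, a₂, hR₁, hR₂, hb, hlow, hI⟩ hmds
    refine ⟨hlow, fun c₁' hs => ?_⟩
    obtain ⟨n, a₁', hn, hR₁', hcube⟩ := hcip _ _ hR₁ _ hs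
    have hmdsA : a₁.mds = a₂.mds := (hmm _ _ hR₁).1.trans (hmds.trans (hmm _ _ hR₂).1.symm)
    obtain ⟨a₂', hn₂, hm', hb'⟩ := hB.nSteps hb hmdsA hn
    obtain ⟨c₂', hs₂, hmC, hR₂', hI'⟩ := hcube _ _ _ hb hmdsA hR₂ hI hmds hn₂ hm'
    refine ⟨c₂', hs₂, hmC, a₁', a₂', hR₁', hR₂', hb', ?_, hI'⟩
    -- The source successors are again in `B` and hence low-equivalent; the refinement carries this
    -- to the target.
    have hlow' := (hB.2.2 _ _ hb' hm').1
    obtain ⟨e₁, e₂⟩ := hmm _ _ hR₁'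
    obtain ⟨e₃, e₄⟩ := hmm _ _ hR₂'
    simp only [confLowMdsEq] at hlow' ⊢
    rwa [e₁, e₂, e₃, e₄] at hlow'

end Induced

/-! ### Initial configurations -/

section Initial

variable {Val Opr Var Lock Reg : Type*} {T : Params Val Opr Var Lock Reg}

/-- The first annotation is below the initial record, so consistency and stability carry over. The
premises on initial configurations of subprograms are the induction hypotheses, which must therefore
be general in registers, mode state and memory. -/
theorem rwrRel_of_compileCmd {C C' : CompRec Val Opr Var Reg} {l l' : Option Lab} {nl nl' : Lab}
    {c : Cmd Val Opr Var Lock} {PCs : AProg Val Opr Var Lock Reg}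
    (h : compileCmd T C l nl c = some (PCs, l', nl', C')) (hreq : compileCmdInputReqs T C l nl c)
    {regs : Reg → Val} {mds : Mds Var Lock} {m : Mem Val Var Lock}
    (hcons : compiledCmdConfigConsistent T C regs mds m) :
    RwrRel T ⟨c, mds, m⟩ ⟨⟨0, PCs.text, regs⟩, mds, m⟩ := by
  have hne : ∀ {C C' : CompRec Val Opr Var Reg} {l l' : Option Lab} {nl nl' : Lab}
      {c : Cmd Val Opr Var Lock} {PCs : AProg Val Opr Var Lock Reg},
      compileCmd T C l nl c = some (PCs, l', nl', C') → c ≠ .stopped := by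
    rintro C C' l l' nl nl' c PCs h rfl
    simp [compileCmd] at h
  induction c generalizing C l nl PCs l' nl' C' regs mds m with
  | stopped => exact absurd rfl hreq.1
  | skip =>
    cases h
    exact .skip_nop _ _ _ _
  | lockAcq k =>
    cases h
    exact .lock_acq _ _ _ _ _
  | lockRel k =>
    cases h
    exact .lock_rel _ _ _ _ _
  | seq c₁ c₂ ih₁ ih₂ =>
    obtain ⟨P₁, l₁, nl₁, C₁, P₂, h₁, h₂, rfl⟩ := compileCmd_seq_inv h
    have hreq₁ : compileCmdInputReqs T C l nl c₁ := ⟨hne h₁, hreq.2.1, hreq.2.2.1.1, hreq.2.2.2⟩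
    have hhead := (compileCmd_head h₁).2.2.2
    rw [AProg.text_append]
    refine .seq (hreq := hreq₁) (hc₁ := h₁) (hc₂ := h₂)
      (hj := joinable_of_compileCmd h₁ h₂ hreq.2.1) (hpc := Nat.zero_le _)
      (hcons := hhead.consistent hcons) (hstab := hhead.stable hreq.2.2.2)
      (h₁ := ih₁ h₁ hreq₁ hcons) (h₂ := fun mds' m' regs' hc hs => ih₂ h₂ ⟨hne h₂,
        fun x hx => ((labelSpec_of_compileCmd h₁ hreq.2.1).exit x hx).2.1, ?_, hs⟩ hc)
    rw [noUnstableExprs, asm_compileCmd h₁]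
    exact hreq.2.2.1.2
  | assign v e =>
    obtain ⟨Pe, r, C₁, he⟩ := compileCmd_assign_inv h
    have L := assignLayout h he
    have hhead := (compileCmd_head h).2.2.2
    -- An already cached variable needs no evaluation code, and then the program starts with the
    -- `store`.
    rcases Nat.eq_zero_or_pos Pe.length with h0 | hpos
    · refine .assign_store (hreq := hreq) (hc := h) (he := he) (hpc := h0.symm)
        (hcons := hhead.consistent hcons) (hstab := hhead.stable hreq.2.2.2) (hw := ?_)
      rw [hhead.1]
      exact hreq.2.2.1.2
    · exact .assign_expr (hreq := hreq) (hc := h) (he := he) (hpc := hpos)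
        (hcons := hhead.consistent hcons) (hstab := hhead.stable hreq.2.2.2)
  | ite e c₁ c₂ ih₁ ih₂ =>
    obtain ⟨Pe, r, C₁, P₁, l₁, nl₁, C₂, P₂, l₂, C₃, he, h₁, h₂⟩ := compileCmd_ite_inv h
    have hhead := (compileCmd_head h).2.2.2
    have hasm := (compileExpr_vars he).1
    have hmono := (labelSpec_of_compileCmd h₁ (by simp)).mono
    refine .if_expr (hreq := hreq) (hc := h) (he := he) (hc₁ := h₁) (hc₂ := h₂)
      (hpc := Nat.zero_le _) (hcons := hhead.consistent hcons)
      (hstab := hhead.stable hreq.2.2.2)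
      (h₁ := fun mds' m' regs' hc hs => ih₁ h₁ ⟨hne h₁, by simp, ?_, hs⟩ hc)
      (h₂ := fun mds' m' regs' hc hs => ih₂ h₂ ⟨hne h₂, by rintro x ⟨⟩; lia, ?_, hs⟩ hc)
    · rw [noUnstableExprs, hasm]
      exact hreq.2.2.1.2.1
    · rw [noUnstableExprs, hasm]
      exact hreq.2.2.1.2.2.1
  | _ e c ih =>
    obtain ⟨Pe, r, C₁, P₁, l₁, C₂, he, h₁⟩ := compileCmd_while_inv h
    have hhead := (compileCmd_head h).2.2.2
    have hasm := (compileExpr_vars he).1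
    refine .while_expr (hreq := hreq) (hc := h) (he := he) (hc₁ := h₁)
      (hd := .inl ⟨rfl, rfl⟩) (hcons := hhead.consistent hcons)
      (hstab := hhead.stable hreq.2.2.2)
      (h := fun mds' m' regs' hc hs => ih h₁ ⟨hne h₁, by simp, ?_, hs⟩ hc)
    rw [noUnstableExprs, hasm]
    exact hreq.2.2.1.2.1

/-- The coupling invariant mentions neither memories nor modes, so it is trivially closed under
globally consistent changes. -/
theorem secureRefinement_Rwr {B : Set (WConf Val Opr Var Lock × WConf Val Opr Var Lock)}
    (hB : strongLowBisimMM T (WStep T) B) (hnhb : noHighBranching T B) :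
    secureRefinement T (WStep T) (RStep T) B (Rwr T) (Iwr Val Opr Var Lock Reg) :=
  ⟨fun _ _ h => RwrRel.modesMem h,
    fun _ _ _ _ _ h hw => RwrRel.change_mem h fun x hx => hw x (.inl hx),
    fun _ _ _ _ _ h _ _ _ _ => h,
    fun _ _ h => ⟨h.1.symm, h.2.symm⟩,
    couplingInvPres_Rwr hB hnhb⟩

end Initial

end WR

end

theorem mainTheorem2 {Val Opr Var Lock Reg : Type*} (T : WR.Params Val Opr Var Lock Reg)
    (B : Set (WR.WConf Val Opr Var Lock × WR.WConf Val Opr Var Lock))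
    (hB : WR.strongLowBisimMM T (WR.WStep T) B) (hnhb : WR.noHighBranching T B) :
    -- secure refinement
    WR.secureRefinement T (WR.WStep T) (WR.RStep T) B (WR.Rwr T) (WR.Iwr Val Opr Var Lock Reg) ∧
    -- the induced relation witnesses noninterference of the target programs
    WR.strongLowBisimMM T (WR.RStep T)
      (WR.concreteBisim T B (WR.Rwr T) (WR.Iwr Val Opr Var Lock Reg)) ∧
    -- it contains the initial configurations of the compilations of the programs covered by `B`
    ∀ C l nl c PCs l' nl' C',
      WR.compileCmd T C l nl c = some (PCs, l', nl', C') →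
      WR.compileCmdInputReqs T C l nl c →
      ∀ regs mds m₁ m₂,
        WR.compiledCmdConfigConsistent T C regs mds m₁ →
        WR.compiledCmdConfigConsistent T C regs mds m₂ →
        WR.lowMdsEq T mds m₁ m₂ →
        (⟨c, mds, m₁⟩, ⟨c, mds, m₂⟩) ∈ B →
        (⟨⟨0, PCs.text, regs⟩, mds, m₁⟩, ⟨⟨0, PCs.text, regs⟩, mds, m₂⟩) ∈
          WR.concreteBisim T B (WR.Rwr T) (WR.Iwr Val Opr Var Lock Reg) := by
  have href := WR.secureRefinement_Rwr (Reg := Reg) hB hnhb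
  refine ⟨href, WR.strongLowBisimMM_concreteBisim hB href, ?_⟩
  intro C l nl c PCs l' nl' C' hc hreq regs mds m₁ m₂ h₁ h₂ hlow hb
  exact ⟨_, _, WR.rwrRel_of_compileCmd hc hreq h₁, WR.rwrRel_of_compileCmd hc hreq h₂, hb,
    ⟨rfl, hlow⟩, rfl, rfl⟩
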